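/- Let $d \ge 1$ be an integer and let $c_1, c_2 \in [1,2)$, $\gamma_1 = 1/c_1$, $\gamma_2 = 1/c_2$ satisfy - if $d = 1$: $(1-\gamma_1) + 15(1-\gamma_2) < 1$ and $3(1-\gamma_1) + 12(1-\gamma_2) < 2$; - if $d = 2$: $3(1-\gamma_1) + 62(1-\gamma_2) < 3$ and $4(1-\gamma_1) + 32(1-\gamma_2) < 3$; - if $3 \le d \le 9$: $\frac{1}{3\cdot 2^d}(1-\gamma_1) + \big(1 + \frac{1}{6(2^d-1)}\big)(1-\gamma_2) < \frac{1}{3\cdot 2^d}$ and $1-\gamma_2 < \frac{1}{4\cdot 2^d}$; - if $d \ge 10$: $\frac{2}{3d(d+1)^2}(1-\gamma_1) + \big(1+\frac{1}{3d(d+1)}\big)(1-\gamma_2) < \frac{2}{3d(d+1)^2}$. Let $\mathcal L$ be the family of slowly varying functions $L : [1,\infty) \to (0,\infty)$ of the form $L(x) = \exp\big(\int_1^x \frac{\vartheta(t)}{t}\,dt\big)$ with $\vartheta \in C^\infty([1,\infty))$ real, $\vartheta(x) \to 0$ and $x^n \vartheta^{(n)}(x) \to 0$ as $x \to \infty$ for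 every $n \ge 1$. Let $\mathcal L_0$ be the family of slowly varying functions $L$ of the same form with $L(x) \to \infty$, where $\vartheta \in C^\infty([1,\infty))$ is positive and decreasing, $\vartheta(x) \to 0$, $x^n\vartheta^{(n)}(x)/\vartheta(x) \to 0$ as $x \to \infty$ for every $n \ge 1$, and for every $\epsilon > 0$ there is $C_\epsilon > 0$ with $1 \le C_\epsilon \vartheta(x) x^\epsilon$ for all $x \ge 1$. For $c \in [1,2)$ let $\mathcal R_c$ be the family of (strictly) increasing convex functions $h : [1,\infty) \to [1,\infty)$ of the form $h(x) = x^c L(x)$, where $L \in \mathcal L_0$ if $c = 1$ and $L \in \mathcal L$ otherwise. Let $h_1 \in \mathcal R_{c_1}$, $h_2 \in \mathcal R_{c_2}$, and let $\varphi_1, \varphi_2 : [1,\infty) \to [1,\infty)$ be their inverse functions. Let $\psi : [1,\infty) \to (0,\infty)$ be a measurable function with $\psi(x) \le \frac12$ for all $x \ge 1$, which is $d+2$ times differentiable for all sufficiently large $x$ and satisfies $$\lim_{x \to \infty} \frac{\psi^{(k)}(x)}{\varphi_2^{(k+1)}(x)} = 1 \qquad \text{for } k = 0, 1, \ldots, d+2.$$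 Let $\mathbf P$ be either of the two sets $$\mathbf P_+ = \{p \text{ prime} : \{\varphi_1(p)\} < \psi(p)\}, \qquad \mathbf P_- = \{p \text{ prime} : \{-\varphi_1(p)\} < \psi(p)\},$$ where $\{y\}$ denotes the fractional part of $y$, and for $N \in \mathbb N$ put $\mathbf P_N = \mathbf P \cap [1,N]$. Then $$|\mathbf P_N| = \bigg(\int_2^N \frac{\psi(x)}{\log x}\,dx\bigg)\big(1+o(1)\big) \qquad \text{as } N \to \infty.$$ -/

import Mathlib

/-!  Functions on `[1, ∞)` are represented by functions `ℝ → ℝ` of which only the values on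
`Set.Ici 1` are used.  Derivatives occur only in limits at `+∞`, that is, at interior points
of `[1, ∞)`. -/

/-- `L` is slowly varying at infinity: `L (a x) / L x → 1` for every `a > 0`. -/
def SlowlyVarying (L : ℝ → ℝ) : Prop :=
  ∀ a : ℝ, 0 < a →
    Filter.Tendsto (fun x : ℝ => L (a * x) / L x) Filter.atTop (nhds 1)

/-- `L x = exp (∫₁ˣ ϑ(t)/t dt)` on `[1, ∞)` (so `L` is positive there). -/
def HasKaramataForm (L ϑ : ℝ → ℝ) : Prop :=
  ∀ x : ℝ, 1 ≤ x → L x = Real.exp (∫ t in (1 : ℝ)..x, ϑ t / t)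

/-- The family `𝓛` of slowly varying functions. -/
def InClassL (L : ℝ → ℝ) : Prop :=
  SlowlyVarying L ∧
  ∃ ϑ : ℝ → ℝ,
    ContDiffOn ℝ ((⊤ : ℕ∞) : WithTop ℕ∞) ϑ (Set.Ici 1) ∧
    HasKaramataForm L ϑ ∧
    Filter.Tendsto ϑ Filter.atTop (nhds 0) ∧
    ∀ n : ℕ, 1 ≤ n →
      Filter.Tendsto (fun x : ℝ => x ^ n * iteratedDeriv n ϑ x) Filter.atTop (nhds 0)

/-- The subfamily `𝓛₀`: here `L → ∞` and `ϑ` is positive, decreasing, and decays more slowly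
than every negative power of `x`. -/
def InClassLZero (L : ℝ → ℝ) : Prop :=
  SlowlyVarying L ∧
  Filter.Tendsto L Filter.atTop Filter.atTop ∧
  ∃ ϑ : ℝ → ℝ,
    ContDiffOn ℝ ((⊤ : ℕ∞) : WithTop ℕ∞) ϑ (Set.Ici 1) ∧
    HasKaramataForm L ϑ ∧
    (∀ x : ℝ, 1 ≤ x → 0 < ϑ x) ∧
    AntitoneOn ϑ (Set.Ici 1) ∧
    Filter.Tendsto ϑ Filter.atTop (nhds 0) ∧
    (∀ n : ℕ, 1 ≤ n →
      Filter.Tendsto (fun x : ℝ => x ^ n * iteratedDeriv n ϑ x / ϑ x) Filter.atTop (nhds 0)) ∧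
    ∀ ε : ℝ, 0 < ε → ∃ C : ℝ, 0 < C ∧ ∀ x : ℝ, 1 ≤ x → 1 ≤ C * ϑ x * x ^ ε

/-- The class `𝓡_c` of increasing convex functions `h : [1, ∞) → [1, ∞)` of the form
`h x = x ^ c * L x`, with `L ∈ 𝓛₀` if `c = 1` and `L ∈ 𝓛` otherwise.  Such an `h` is regularly
varying of index `c`, because `L` is slowly varying; it maps `[1, ∞)` bijectively onto
itself. -/
def InClassR (c : ℝ) (h : ℝ → ℝ) : Prop :=
  Set.MapsTo h (Set.Ici 1) (Set.Ici 1) ∧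
  StrictMonoOn h (Set.Ici 1) ∧
  ConvexOn ℝ (Set.Ici 1) h ∧
  ∃ L : ℝ → ℝ,
    (∀ x : ℝ, 1 ≤ x → h x = x ^ c * L x) ∧
    (c = 1 → InClassLZero L) ∧
    (c ≠ 1 → InClassL L)

/-- The inverse function of `h : [1, ∞) → [1, ∞)`. -/
noncomputable def inverseOnIciOne (h : ℝ → ℝ) : ℝ → ℝ :=
  Function.invFunOn h (Set.Ici 1)

/-- The restrictions on `γ₁ = 1 / c₁`, `γ₂ = 1 / c₂` in terms of the parameter `d ≥ 1`. -/
def AdmissibleExponents (d : ℕ) (γ₁ γ₂ : ℝ) : Prop :=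
  (d = 1 →
    (1 - γ₁) + 15 * (1 - γ₂) < 1 ∧
    3 * (1 - γ₁) + 12 * (1 - γ₂) < 2) ∧
  (d = 2 →
    3 * (1 - γ₁) + 62 * (1 - γ₂) < 3 ∧
    4 * (1 - γ₁) + 32 * (1 - γ₂) < 3) ∧
  (3 ≤ d ∧ d ≤ 9 →
    1 / (3 * 2 ^ d) * (1 - γ₁) + (1 + 1 / (6 * (2 ^ d - 1))) * (1 - γ₂) < 1 / (3 * 2 ^ d) ∧
    1 - γ₂ < 1 / (4 * 2 ^ d)) ∧
  (10 ≤ d →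
    2 / (3 * (d : ℝ) * ((d : ℝ) + 1) ^ 2) * (1 - γ₁)
        + (1 + 1 / (3 * (d : ℝ) * ((d : ℝ) + 1))) * (1 - γ₂)
      < 2 / (3 * (d : ℝ) * ((d : ℝ) + 1) ^ 2))

/-- The admissible functions `ψ : [1, ∞) → (0, 1/2]`, given `d` and `φ₂`.
No separate differentiability hypothesis is needed: since the limits are `1`, the derivatives
`ψ⁽ᵏ⁾ x` with `k ≤ d + 2` are nonzero for all large `x`, and `deriv` of a function at a point
where it is not differentiable is `0`; so `ψ` is `d + 2` times differentiable near infinity. -/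
structure AdmissibleWeight (d : ℕ) (φ₂ ψ : ℝ → ℝ) : Prop where
  measurable : AEMeasurable ψ (MeasureTheory.volume.restrict (Set.Ici 1))
  pos : ∀ x : ℝ, 1 ≤ x → 0 < ψ x
  le_half : ∀ x : ℝ, 1 ≤ x → ψ x ≤ 1 / 2
  tendsto_ratio : ∀ k : ℕ, k ≤ d + 2 →
    Filter.Tendsto (fun x : ℝ => iteratedDeriv k ψ x / iteratedDeriv (k + 1) φ₂ x)
      Filter.atTop (nhds 1)

/-- The set `𝐏₊` of primes `p` with `{φ₁(p)} < ψ(p)`. -/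
def thinPrimesPlus (φ₁ ψ : ℝ → ℝ) : Set ℕ :=
  {p : ℕ | p.Prime ∧ Int.fract (φ₁ (p : ℝ)) < ψ (p : ℝ)}

/-- The set `𝐏₋` of primes `p` with `{-φ₁(p)} < ψ(p)`. -/
def thinPrimesMinus (φ₁ ψ : ℝ → ℝ) : Set ℕ :=
  {p : ℕ | p.Prime ∧ Int.fract (-φ₁ (p : ℝ)) < ψ (p : ℝ)}

/-! The condition `{±φ₁(p)} < ψ(p)` asks that `±φ₁(p)` fall, modulo one, in a slowly shrinking
interval, so the theorem is an equidistribution statement for `φ₁(p)` at the scale `ρ ≈ ψ(N)`. Since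
`ψ ∼ φ₂'`, that scale is `N ^ (γ₂ - 1 + o(1))`. In every range of `d` the hypotheses on the
exponents imply `1 - γ₂ < γ₁ / 15` (`AdmissibleExponents.one_sub_lt`), and this inequality drives
the whole argument: it leaves room for exponents `1 - γ₂ < t' < t < γ₁ / 15`.

The arithmetic core is `RegularPhase.eventually_norm_sum_vonMangoldt_le`: for `N' ≤ 2N` and `1 ≤ m ≤
N ^ t`, the sum of `Λ(n) e(m φ₁(n))` over `(N, N']` is at most `N ^ (1 - t)`. Vaughan's identity
splits it into Type I sums, with a smooth inner variable, and Type II sums, with arbitrary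
coefficients. Type I sums are handled directly by van der Corput's second derivative test, itself a
consequence of the Kusmin–Landau inequality. In Type II sums the outer variable is cut into short
blocks, Cauchy's inequality removes the inner coefficients, and the same test is applied to `k ↦ m
(φ₁(k l₁) - φ₁(k l₂))`. Regular variation enters only through `φ₁'' = -y ^ (γ₁ - 2 + o(1))` and `(y²
φ₁'')' = -y ^ (γ₁ - 1 + o(1))`, which follow from the differential equation satisfied by `h₁`.

Poisson summation, applied to smooth minorants and majorants of the indicator of `[0, ρ)`, turns
these bounds into equidistribution with relative error `o(1)`, uniformly for `ρ ≥ N ^ (-t')`.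

Finally `ψ` and `log` are nearly constant on a block `(N, lN]` with `l` close to `1`. There the
count is compared with `ψ(N) / log N` times the length of the block; the total weight of `Λ` on a
block comes from the prime number theorem, which is deduced from a Wiener–Ikehara theorem, and
proper prime powers are negligible because `t' < 1/2`. Chaining blocks gives a relative error as
small as desired plus a bounded error, and the integral diverges. -/

/-! ### Exponential sums: the Kusmin–Landau inequality and van der Corput's second derivative test.
-/

/-- The additive character `x ↦ e^{2πix}`. -/
noncomputable def addExp (x : ℝ) : ℂ := Complex.exp (2 * Real.pi * x * Complex.I)

lemma addExp_add (x y : ℝ) : addExp (x + y) = addExp x * addExp y := by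
  unfold addExp
  rw [← Complex.exp_add]
  congr 1
  push_cast
  ring

lemma norm_addExp (x : ℝ) : ‖addExp x‖ = 1 := by
  unfold addExp
  have := Complex.norm_exp_ofReal_mul_I (2 * Real.pi * x)
  push_cast at this
  exact this

lemma addExp_int (k : ℤ) : addExp k = 1 := by
  unfold addExp
  rw [Complex.exp_eq_one_iff]
  exact ⟨k, by push_cast; ring⟩

lemma addExp_zero : addExp 0 = 1 := by simpa using addExp_int 0

lemma addExp_neg (x : ℝ) : addExp (-x) = (starRingEnd ℂ) (addExp x) := by
  unfold addExp
  rw [← Complex.exp_conj]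
  congr 1
  simp [Complex.conj_ofNat]

lemma addExp_sub (x y : ℝ) : addExp (x - y) = addExp x * (starRingEnd ℂ) (addExp y) := by
  rw [sub_eq_add_neg, addExp_add, addExp_neg]

/-- This is `1 / (1 - e(x)) = 1/2 + (i/2) cot(πx)`: the reciprocal has constant real part and
monotone imaginary part, which is what makes summation by parts effective in the Kusmin–Landau
inequality. -/
lemma half_add_cot_mul_one_sub_addExp {x : ℝ} (hx : Real.sin (Real.pi * x) ≠ 0) :
    ((1 / 2 : ℂ) + ((Real.cos (Real.pi * x) / Real.sin (Real.pi * x) / 2 : ℝ) : ℂ) * Complex.I)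
      * (1 - addExp x) = 1 := by
  have h2 : addExp x = (Real.cos (2 * (Real.pi * x)) : ℂ) +
      (Real.sin (2 * (Real.pi * x)) : ℂ) * Complex.I := by
    unfold addExp
    rw [show (2 * Real.pi * x * Complex.I : ℂ) = ((2 * (Real.pi * x) : ℝ) : ℂ) * Complex.I by
      push_cast; ring, Complex.exp_mul_I, ← Complex.ofReal_cos, ← Complex.ofReal_sin]
  rw [h2, Real.cos_two_mul, Real.sin_two_mul]
  set c := Real.cos (Real.pi * x)
  set s := Real.sin (Real.pi * x)
  have hcs : c * c = 1 - s * s := by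
    have := Real.sin_sq_add_cos_sq (Real.pi * x)
    linarith
  have h4 : 2 * c ^ 2 - 1 = 1 - 2 * (s * s) := by linarith
  rw [h4]
  have h3 : c / s * s = c := by field_simp
  apply Complex.ext
  · simp
    linear_combination c * h3 + hcs
  · simp
    linear_combination s * h3

lemma cot_le_cot_of_le {x y : ℝ} (hx : 0 < x) (hxy : x ≤ y) (hy : y < 1) :
    Real.cos (Real.pi * y) / Real.sin (Real.pi * y) ≤
      Real.cos (Real.pi * x) / Real.sin (Real.pi * x) := by
  have hπ := Real.pi_pos
  have sx : 0 < Real.sin (Real.pi * x) :=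
    Real.sin_pos_of_pos_of_lt_pi (by positivity) (by nlinarith)
  have sy : 0 < Real.sin (Real.pi * y) :=
    Real.sin_pos_of_pos_of_lt_pi (mul_pos hπ (by linarith)) (by nlinarith)
  rw [div_le_div_iff₀ sy sx]
  have h : 0 ≤ Real.sin (Real.pi * y - Real.pi * x) :=
    Real.sin_nonneg_of_nonneg_of_le_pi (by nlinarith) (by nlinarith)
  rw [Real.sin_sub] at h
  linarith

lemma two_mul_le_sin_pi_mul {x Δ : ℝ} (hΔ : 0 < Δ) (h1 : Δ ≤ x) (h2 : x ≤ 1 - Δ) :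
    2 * Δ ≤ Real.sin (Real.pi * x) := by
  have hπ := Real.pi_pos
  rcases le_total x (1 / 2) with h | h
  · have := Real.mul_le_sin (x := Real.pi * x) (by nlinarith) (by nlinarith)
    have h3 : 2 / Real.pi * (Real.pi * x) = 2 * x := by field_simp
    linarith
  · have := Real.mul_le_sin (x := Real.pi * (1 - x)) (by nlinarith) (by nlinarith)
    have h3 : 2 / Real.pi * (Real.pi * (1 - x)) = 2 * (1 - x) := by field_simp
    rw [h3, show Real.pi * (1 - x) = Real.pi - Real.pi * x by ring, Real.sin_pi_sub] at this
    linarith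

/-- The Kusmin–Landau inequality for phases on `range N` with differences in `[Δ, 1 - Δ]`. -/
lemma norm_sum_range_addExp_le (a : ℕ → ℝ) (N : ℕ) {Δ : ℝ} (hΔ : 0 < Δ) (hΔ2 : Δ ≤ 1 / 2)
    (hg : ∀ n, n + 1 < N → a (n + 1) - a n ∈ Set.Icc Δ (1 - Δ))
    (hanti : ∀ n, n + 2 < N → a (n + 2) - a (n + 1) ≤ a (n + 1) - a n) :
    ‖∑ n ∈ Finset.range N, addExp (a n)‖ ≤ 2 / Δ := by
  rcases Nat.lt_or_ge N 2 with hN | hN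
  · rcases Nat.lt_or_ge N 1 with h0 | h0
    · have : N = 0 := by omega
      subst this
      simp
      positivity
    · have hN1 : N = 1 := by omega
      subst hN1
      simp only [Finset.range_one, Finset.sum_singleton, norm_addExp]
      rw [le_div_iff₀ hΔ]; linarith
  obtain ⟨M, rfl⟩ : ∃ M, N = M + 2 := ⟨N - 2, by omega⟩
  set g : ℕ → ℝ := fun n => a (n + 1) - a n with hgdef
  -- With `w n = 1 / (1 - e(g n))` each term is `z n = w n * (z n - z (n + 1))`. As `g` decreases,
  -- `c` increases, so after summation by parts the variation of `w` telescopes.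
  set c : ℕ → ℝ := fun n => Real.cos (Real.pi * g n) / Real.sin (Real.pi * g n) with hc
  set w : ℕ → ℂ := fun n => 1 / 2 + ((c n / 2 : ℝ) : ℂ) * Complex.I with hw
  set z : ℕ → ℂ := fun n => addExp (a n) with hz
  have hgm : ∀ n ≤ M, g n ∈ Set.Icc Δ (1 - Δ) := fun n hn => hg n (by omega)
  have hsin : ∀ n ≤ M, 2 * Δ ≤ Real.sin (Real.pi * g n) := fun n hn =>
    two_mul_le_sin_pi_mul hΔ (hgm n hn).1 (hgm n hn).2
  have hzw : ∀ n ≤ M, z n = w n * (z n - z (n + 1)) := by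
    intro n hn
    have h1 : z (n + 1) = z n * addExp (g n) := by
      simp only [hz, hgdef]
      rw [← addExp_add]
      congr 1
      ring
    have h2 := half_add_cot_mul_one_sub_addExp (x := g n) (by linarith [hsin n hn])
    have h3 : w n * (1 - addExp (g n)) = 1 := h2
    rw [h1]
    linear_combination (-z n) * h3
  have hcabs : ∀ n ≤ M, |c n| ≤ 1 / (2 * Δ) := by
    intro n hn
    simp only [hc]
    rw [abs_div, abs_of_pos (lt_of_lt_of_le (by positivity) (hsin n hn))]
    exact div_le_div₀ zero_le_one (Real.abs_cos_le_one _) (by positivity) (hsin n hn)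
  have hwabs : ∀ n ≤ M, ‖w n‖ ≤ 1 / (2 * Δ) := by
    intro n hn
    have h1 : ‖w n‖ ≤ 1 / 2 + |c n| / 2 := by
      refine (norm_add_le _ _).trans ?_
      simp
    have h2 := hcabs n hn
    have h3 : (1 : ℝ) ≤ 1 / (2 * Δ) := by
      rw [le_div_iff₀ (by positivity)]; linarith
    linarith
  have hparts : ∀ K, ∑ n ∈ Finset.range (K + 1), w n * (z n - z (n + 1)) =
      w 0 * z 0 - w K * z (K + 1) + ∑ n ∈ Finset.range K, (w (n + 1) - w n) * z (n + 1) := by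
    intro K
    induction K with
    | zero => simp; ring
    | succ K ih =>
      rw [Finset.sum_range_succ, ih, Finset.sum_range_succ _ K]
      ring
  have hdiff : ∀ n < M, ‖(w (n + 1) - w n) * z (n + 1)‖ ≤ (c (n + 1) - c n) / 2 := by
    intro n hn
    have h1 : w (n + 1) - w n = (((c (n + 1) - c n) / 2 : ℝ) : ℂ) * Complex.I := by
      simp only [hw]; push_cast; ring
    have h2 : c n ≤ c (n + 1) :=
      cot_le_cot_of_le (lt_of_lt_of_le hΔ (hgm (n + 1) (by omega)).1) (hanti n (by omega))
        (by linarith [(hgm n (by omega)).2])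
    rw [h1, norm_mul, norm_mul, Complex.norm_real, Complex.norm_I, hz]
    simp only [norm_addExp, mul_one, Real.norm_eq_abs]
    rw [abs_of_nonneg (by linarith)]
  have hsum : ∑ n ∈ Finset.range (M + 2), z n =
      w 0 * z 0 - w M * z (M + 1) + ∑ n ∈ Finset.range M, (w (n + 1) - w n) * z (n + 1)
        + z (M + 1) := by
    rw [Finset.sum_range_succ, ← hparts]
    congr 1
    exact Finset.sum_congr rfl fun n hn => hzw n (by simpa [Nat.lt_succ_iff] using hn)
  have hzn : ∀ n, ‖z n‖ = 1 := fun n => norm_addExp _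
  change ‖∑ n ∈ Finset.range (M + 2), z n‖ ≤ _
  rw [hsum]
  have e1 : ‖w 0 * z 0‖ ≤ 1 / (2 * Δ) := by rw [norm_mul, hzn, mul_one]; exact hwabs 0 (by omega)
  have e2 : ‖w M * z (M + 1)‖ ≤ 1 / (2 * Δ) := by
    rw [norm_mul, hzn, mul_one]; exact hwabs M le_rfl
  have e3 : ‖∑ n ∈ Finset.range M, (w (n + 1) - w n) * z (n + 1)‖ ≤ 1 / (2 * Δ) := by
    refine (norm_sum_le_of_le _ fun n hn => hdiff n (by simpa using hn)).trans ?_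
    rw [← Finset.sum_div, Finset.sum_range_sub]
    have h1 := (abs_le.mp (hcabs M le_rfl)).2
    have h2 := (abs_le.mp (hcabs 0 (by omega))).1
    linarith
  have e4 : (1 : ℝ) ≤ 1 / (2 * Δ) := by
    rw [le_div_iff₀ (by positivity)]; linarith
  -- Four contributions of at most `1 / (2Δ)`: two boundary terms, the variation of `w`, and the
  -- last term, which has no successor to be paired with.
  have e5 : (2 : ℝ) / Δ = 4 * (1 / (2 * Δ)) := by field_simp; norm_num
  rw [e5]
  refine (norm_add_le _ _).trans ?_
  rw [hzn]
  have := norm_add_le (w 0 * z 0 - w M * z (M + 1))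
    (∑ n ∈ Finset.range M, (w (n + 1) - w n) * z (n + 1))
  have := norm_sub_le (w 0 * z 0) (w M * z (M + 1))
  linarith

/-- The Kusmin–Landau inequality: the differences of the phase avoid a `Δ`-neighbourhood of the
integers and decrease. -/
lemma norm_sum_Ico_addExp_le (a : ℕ → ℝ) (p q : ℕ) (k : ℤ) {Δ : ℝ} (hΔ : 0 < Δ) (hΔ2 : Δ ≤ 1 / 2)
    (hg : ∀ n, p ≤ n → n + 1 < q → a (n + 1) - a n ∈ Set.Icc (k + Δ) (k + 1 - Δ))
    (hanti : ∀ n, p ≤ n → n + 2 < q → a (n + 2) - a (n + 1) ≤ a (n + 1) - a n) :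
    ‖∑ n ∈ Finset.Ico p q, addExp (a n)‖ ≤ 2 / Δ := by
  rw [Finset.sum_Ico_eq_sum_range]
  have h1 : ∀ n, addExp (a (p + n)) = addExp (a (p + n) - k * n) := by
    intro n
    rw [sub_eq_add_neg, addExp_add]
    have : addExp (-(k * n : ℝ)) = 1 := by
      have := addExp_int (-(k * n))
      push_cast at this
      exact this
    rw [this, mul_one]
  simp_rw [h1]
  refine norm_sum_range_addExp_le (fun n => a (p + n) - k * n) (q - p) hΔ hΔ2 ?_ ?_
  · intro n hn
    have := hg (p + n) (by omega) (by omega)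
    constructor
    · have := this.1
      push_cast
      rw [show p + (n + 1) = p + n + 1 by ring]
      linarith
    · have := this.2
      push_cast
      rw [show p + (n + 1) = p + n + 1 by ring]
      linarith
  · intro n hn
    have := hanti (p + n) (by omega) (by omega)
    push_cast
    rw [show p + (n + 1) = p + n + 1 by ring, show p + (n + 2) = p + n + 2 by ring]
    linarith

lemma card_le_of_spread (S : Finset ℕ) {lam D : ℝ} (hlam : 0 < lam) (hD : 0 ≤ D)
    (h : ∀ n ∈ S, ∀ m ∈ S, n ≤ m → lam * ((m : ℝ) - n) ≤ D) : (S.card : ℝ) ≤ D / lam + 1 := by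
  rcases S.eq_empty_or_nonempty with rfl | hS
  · simp; positivity
  have h1 : S ⊆ Finset.Icc (S.min' hS) (S.max' hS) := fun n hn =>
    Finset.mem_Icc.mpr ⟨S.min'_le n hn, S.le_max' n hn⟩
  have h2 := Finset.card_le_card h1
  rw [Nat.card_Icc] at h2
  have h3 := h _ (S.min'_mem hS) _ (S.max'_mem hS) (S.min'_le _ (S.max'_mem hS))
  have h4 : (S.min' hS) ≤ S.max' hS := S.min'_le _ (S.max'_mem hS)
  have h5 : (S.card : ℝ) ≤ (S.max' hS : ℝ) - S.min' hS + 1 := by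
    have : S.card + S.min' hS ≤ S.max' hS + 1 := by omega
    have : ((S.card + S.min' hS : ℕ) : ℝ) ≤ ((S.max' hS + 1 : ℕ) : ℝ) := by exact_mod_cast this
    push_cast at this
    linarith
  have h6 : (S.max' hS : ℝ) - S.min' hS ≤ D / lam := by
    rw [le_div_iff₀ hlam]; linarith
  linarith

lemma gap_bounds {g : ℕ → ℝ} {M : ℕ} {lo hi : ℝ}
    (h : ∀ n, n + 1 < M → g n - g (n + 1) ∈ Set.Icc lo hi) {n m : ℕ} (hnm : n ≤ m) (hm : m < M) :
    g n - g m ∈ Set.Icc (lo * ((m : ℝ) - n)) (hi * ((m : ℝ) - n)) := by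
  induction m, hnm using Nat.le_induction with
  | base => simp
  | succ m hnm ih =>
    have h1 := ih (by omega)
    have h2 := h m hm
    push_cast
    constructor
    · nlinarith [h1.1, h2.1]
    · nlinarith [h1.2, h2.2]

/-- Van der Corput's second derivative test, in terms of second differences. -/
lemma norm_sum_addExp_le_of_second_diff (a : ℕ → ℝ) (N : ℕ) {lam h : ℝ} (hlam : 0 < lam)
    (hh : 1 ≤ h)
    (ha : ∀ n, n + 2 < N →
      a (n + 2) - 2 * a (n + 1) + a n ∈ Set.Icc (-(h * lam)) (-lam)) :
    ‖∑ n ∈ Finset.range N, addExp (a n)‖ ≤ 14 * (h * N * lam + 1) * (1 / √lam + 1) := by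
  have hs : 0 < √lam := Real.sqrt_pos.mpr hlam
  have hss : √lam * √lam = lam := Real.mul_self_sqrt hlam.le
  have htriv : ‖∑ n ∈ Finset.range N, addExp (a n)‖ ≤ N := by
    refine (norm_sum_le _ _).trans ?_
    simp [norm_addExp]
  have hN0 : (0 : ℝ) ≤ N := Nat.cast_nonneg _
  -- For `lam > 1/4` the trivial bound `N` suffices; otherwise `√lam ≤ 1/2`, as the Kusmin–Landau
  -- inequality requires of its `Δ`.
  by_cases hbig : 1 / 4 < lam
  · have h1 : 1 / 2 ≤ √lam := by
      apply Real.le_sqrt_of_sq_le; norm_num; linarith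
    have h2 : (N : ℝ) / 4 ≤ h * N * lam := by nlinarith [mul_nonneg hN0 hlam.le]
    have h3 : 0 ≤ 1 / √lam := by positivity
    nlinarith
  push Not at hbig
  have hs2 : √lam ≤ 1 / 2 := by
    rw [Real.sqrt_le_left (by norm_num)]; norm_num; linarith
  rcases Nat.lt_or_ge N 2 with hN | hN
  · have : (N : ℝ) ≤ 1 := by exact_mod_cast (by omega : N ≤ 1)
    have h3 : 0 ≤ 1 / √lam := by positivity
    have h4 : 0 ≤ h * N * lam := by positivity
    nlinarith
  obtain ⟨M, rfl⟩ : ∃ M, N = M + 1 := ⟨N - 1, by omega⟩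
  set g : ℕ → ℝ := fun n => a (n + 1) - a n with hgdef
  have hgap : ∀ n, n + 1 < M → g n - g (n + 1) ∈ Set.Icc lam (h * lam) := by
    intro n hn
    have := ha n (by omega)
    simp only [hgdef]
    constructor
    · have := this.2; rw [show n + 1 + 1 = n + 2 by ring]; linarith
    · have := this.1; rw [show n + 1 + 1 = n + 2 by ring]; linarith
  have hG : ∀ {n m : ℕ}, n ≤ m → m < M →
      g n - g m ∈ Set.Icc (lam * ((m : ℝ) - n)) (h * lam * ((m : ℝ) - n)) :=
    fun hnm hm => gap_bounds hgap hnm hm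
  have hmono : ∀ {n m : ℕ}, n ≤ m → m < M → g m ≤ g n := by
    intro n m hnm hm
    have := (hG hnm hm).1
    have h2 : (n : ℝ) ≤ m := by exact_mod_cast hnm
    nlinarith
  -- Among the `n` with `⌊g n⌋ = k`, at most `2 (Δ / lam + 1)` have `g n` within `Δ` of an endpoint
  -- and are counted trivially; the rest form an interval on which Kusmin–Landau gives `2 / Δ`. The
  -- choice `Δ = √lam` balances the two.
  set Δ := √lam with hΔ
  set T : Finset ℤ := Finset.Icc ⌊g (M - 1)⌋ ⌊g 0⌋ with hT
  have hmaps : ∀ n ∈ Finset.range M, ⌊g n⌋ ∈ T := by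
    intro n hn
    rw [Finset.mem_range] at hn
    rw [hT, Finset.mem_Icc]
    exact ⟨Int.floor_le_floor (hmono (by omega) (by omega)),
      Int.floor_le_floor (hmono (by omega) hn)⟩
  have hTcard : (T.card : ℝ) ≤ h * lam * M + 2 := by
    have h0 := (hG (n := 0) (m := M - 1) (by omega) (by omega)).2
    have h1 : g (M - 1) ≤ g 0 := hmono (by omega) (by omega)
    have h2 : ⌊g (M - 1)⌋ ≤ ⌊g 0⌋ := Int.floor_le_floor h1
    have h3 : (T.card : ℤ) = ⌊g 0⌋ + 1 - ⌊g (M - 1)⌋ := by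
      rw [hT, Int.card_Icc, Int.toNat_of_nonneg (by omega)]
    have h4 : (T.card : ℝ) = ⌊g 0⌋ + 1 - ⌊g (M - 1)⌋ := by exact_mod_cast h3
    have h5 := Int.floor_le (g 0)
    have h6 := Int.lt_floor_add_one (g (M - 1))
    have h7 : ((M - 1 : ℕ) : ℝ) ≤ M := by exact_mod_cast Nat.sub_le M 1
    have h8 : h * lam * (((M - 1 : ℕ) : ℝ) - (0 : ℕ)) ≤ h * lam * M := by
      apply mul_le_mul_of_nonneg_left _ (by positivity)
      simp
    rw [h4]
    linarith
  have hfib : ∀ k ∈ T, ‖∑ n ∈ (Finset.range M).filter (fun n => ⌊g n⌋ = k), addExp (a n)‖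
      ≤ 6 / Δ := by
    intro k _
    set F := (Finset.range M).filter (fun n => ⌊g n⌋ = k) with hF
    have hFm : ∀ n ∈ F, n < M ∧ (k : ℝ) ≤ g n ∧ g n < k + 1 := by
      intro n hn
      rw [hF, Finset.mem_filter, Finset.mem_range, Int.floor_eq_iff] at hn
      exact hn
    set A1 := F.filter (fun n => g n < k + Δ)
    set A2 := F.filter (fun n => ¬ g n < k + Δ)
    set B1 := A2.filter (fun n => k + 1 - Δ < g n)
    set B2 := A2.filter (fun n => ¬ (k + 1 - Δ < g n)) with hB2
    have e1 : ∑ n ∈ F, addExp (a n) = ∑ n ∈ A1, addExp (a n) +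
        (∑ n ∈ B1, addExp (a n) + ∑ n ∈ B2, addExp (a n)) := by
      rw [Finset.sum_filter_add_sum_filter_not, Finset.sum_filter_add_sum_filter_not]
    have triv : ∀ S : Finset ℕ, ‖∑ n ∈ S, addExp (a n)‖ ≤ S.card := by
      intro S
      refine (norm_sum_le _ _).trans ?_
      simp [norm_addExp]
    have hΔl : Δ / lam = 1 / Δ := by
      rw [← hss]; field_simp
    have c1 : (A1.card : ℝ) ≤ 1 / Δ + 1 := by
      rw [← hΔl]
      refine card_le_of_spread _ hlam hs.le fun n hn m hm hnm => ?_
      have hn' := Finset.mem_filter.mp hn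
      have hm' := Finset.mem_filter.mp hm
      have := (hG hnm (hFm m hm'.1).1).1
      linarith [(hFm m hm'.1).2.1, hn'.2]
    have c2 : (B1.card : ℝ) ≤ 1 / Δ + 1 := by
      rw [← hΔl]
      refine card_le_of_spread _ hlam hs.le fun n hn m hm hnm => ?_
      have hn' := Finset.mem_filter.mp hn
      have hm' := Finset.mem_filter.mp hm
      have hn2 := Finset.mem_filter.mp hn'.1
      have hm2 := Finset.mem_filter.mp hm'.1
      have := (hG hnm (hFm m hm2.1).1).1
      linarith [(hFm n hn2.1).2.2, hm'.2]
    have hB2m : ∀ n, n ∈ B2 ↔ n < M ∧ k + Δ ≤ g n ∧ g n ≤ k + 1 - Δ := by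
      intro n
      simp only [hB2, A2, hF, Finset.mem_filter, Finset.mem_range, Int.floor_eq_iff, not_lt]
      constructor
      · rintro ⟨⟨⟨h1, h2, h3⟩, h4⟩, h5⟩
        exact ⟨h1, h4, h5⟩
      · rintro ⟨h1, h4, h5⟩
        exact ⟨⟨⟨h1, by linarith, by linarith⟩, h4⟩, h5⟩
    have c3 : ‖∑ n ∈ B2, addExp (a n)‖ ≤ 2 / Δ := by
      rcases B2.eq_empty_or_nonempty with hE | hE
      · rw [hE]; simp; positivity
      have hmin := (hB2m _).mp (B2.min'_mem hE)
      have hmax := (hB2m _).mp (B2.max'_mem hE)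
      have hB : B2 = Finset.Ico (B2.min' hE) (B2.max' hE + 1) := by
        ext n
        rw [Finset.mem_Ico, Nat.lt_succ_iff]
        constructor
        · intro hn
          exact ⟨B2.min'_le n hn, B2.le_max' n hn⟩
        · rintro ⟨h1, h2⟩
          rw [hB2m]
          exact ⟨by omega, hmax.2.1.trans (hmono h2 hmax.1),
            (hmono h1 (by omega)).trans hmin.2.2⟩
      have hI : ∀ n, B2.min' hE ≤ n → n < B2.max' hE + 1 → n ∈ B2 := by
        intro n h1 h2
        rw [hB]; exact Finset.mem_Ico.mpr ⟨h1, h2⟩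
      rw [hB]
      refine norm_sum_Ico_addExp_le a _ _ k hs hs2 ?_ ?_
      · intro n h1 h2
        exact ((hB2m n).mp (hI n h1 (by omega))).2
      · intro n h1 h2
        have := hmono (n := n) (m := n + 1) (by omega) (by omega)
        exact this
    rw [e1]
    have h1Δ : 1 ≤ 1 / Δ := by rw [le_div_iff₀ hs]; linarith
    have h6 : 6 / Δ = 6 * (1 / Δ) := by ring
    have h7 : 2 / Δ = 2 * (1 / Δ) := by ring
    have := norm_add_le (∑ n ∈ A1, addExp (a n))
      (∑ n ∈ B1, addExp (a n) + ∑ n ∈ B2, addExp (a n))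
    have := norm_add_le (∑ n ∈ B1, addExp (a n)) (∑ n ∈ B2, addExp (a n))
    have := triv A1
    have := triv B1
    linarith
  have hmain : ‖∑ n ∈ Finset.range M, addExp (a n)‖ ≤ (h * lam * M + 2) * (6 / Δ) := by
    rw [← Finset.sum_fiberwise_of_maps_to hmaps]
    refine (norm_sum_le_of_le _ hfib).trans ?_
    rw [Finset.sum_const, nsmul_eq_mul]
    exact mul_le_mul_of_nonneg_right hTcard (by positivity)
  rw [Finset.sum_range_succ]
  refine (norm_add_le _ _).trans ?_
  rw [norm_addExp]
  push_cast
  have h0 : 0 < 1 / Δ := by positivity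
  have h6 : 6 / Δ = 6 * (1 / Δ) := by ring
  rw [h6] at hmain
  have h9 : 0 ≤ h * lam * M := by positivity
  have h10 : 0 ≤ h * lam := by positivity
  nlinarith [mul_nonneg h9 h0.le, mul_nonneg h10 h0.le]

/-- The mean value theorem is applied first to `y ↦ f (y + 1) - f y`, then to `f'`. -/
lemma exists_second_diff_eq {f f' f'' : ℝ → ℝ} {x : ℝ}
    (hf : ∀ y ∈ Set.Icc x (x + 2), HasDerivAt f (f' y) y)
    (hf' : ∀ y ∈ Set.Icc x (x + 2), HasDerivAt f' (f'' y) y) :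
    ∃ y ∈ Set.Icc x (x + 2), f (x + 2) - 2 * f (x + 1) + f x = f'' y := by
  have hu : ∀ y ∈ Set.Icc x (x + 1),
      HasDerivAt (fun y => f (y + 1) - f y) (f' (y + 1) - f' y) y := by
    intro y hy
    exact ((hf (y + 1) ⟨by linarith [hy.1], by linarith [hy.2]⟩).comp_add_const y 1).sub
      (hf y ⟨hy.1, by linarith [hy.2]⟩)
  obtain ⟨ξ, hξ, h1⟩ := exists_hasDerivAt_eq_slope (fun y => f (y + 1) - f y)
    (fun y => f' (y + 1) - f' y) (show x < x + 1 by linarith)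
    (fun y hy => (hu y hy).continuousAt.continuousWithinAt)
    (fun y hy => hu y (Set.Ioo_subset_Icc_self hy))
  have hv : ∀ y ∈ Set.Icc ξ (ξ + 1), y ∈ Set.Icc x (x + 2) := fun y hy =>
    ⟨by linarith [hy.1, hξ.1], by linarith [hy.2, hξ.2]⟩
  obtain ⟨η, hη, h2⟩ := exists_hasDerivAt_eq_slope f' f'' (show ξ < ξ + 1 by linarith)
    (fun y hy => (hf' y (hv y hy)).continuousAt.continuousWithinAt)
    (fun y hy => hf' y (hv y (Set.Ioo_subset_Icc_self hy)))
  refine ⟨η, hv η (Set.Ioo_subset_Icc_self hη), ?_⟩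
  rw [h2]
  simp only [add_sub_cancel_left, div_one] at h1 ⊢
  rw [h1, show x + 1 + 1 = x + 2 by ring]
  ring

/-- Van der Corput's second derivative test. -/
lemma norm_sum_Ioc_addExp_le {f f' f'' : ℝ → ℝ} {p q : ℕ} (hpq : p ≤ q) {lam h : ℝ}
    (hlam : 0 < lam) (hh : 1 ≤ h)
    (hf : ∀ y ∈ Set.Icc (p + 1 : ℝ) q, HasDerivAt f (f' y) y)
    (hf' : ∀ y ∈ Set.Icc (p + 1 : ℝ) q, HasDerivAt f' (f'' y) y)
    (hf'' : ∀ y ∈ Set.Icc (p + 1 : ℝ) q, f'' y ∈ Set.Icc (-(h * lam)) (-lam)) :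
    ‖∑ n ∈ Finset.Ioc p q, addExp (f n)‖ ≤
      14 * (h * ((q : ℝ) - p) * lam + 1) * (1 / √lam + 1) := by
  have h1 : ∑ n ∈ Finset.Ioc p q, addExp (f n) =
      ∑ n ∈ Finset.range (q - p), addExp (f ((p + 1 + n : ℕ) : ℝ)) := by
    rw [show Finset.Ioc p q = Finset.Ico (p + 1) (q + 1) by ext; simp only [Finset.mem_Ioc, Finset.mem_Ico]; omega,
      Finset.sum_Ico_eq_sum_range]
    simp
  rw [h1, ← Nat.cast_sub hpq]
  refine norm_sum_addExp_le_of_second_diff (fun n => f ((p + 1 + n : ℕ) : ℝ)) (q - p) hlam hh ?_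
  intro n hn
  have hsub : ∀ y ∈ Set.Icc ((p + 1 + n : ℕ) : ℝ) (((p + 1 + n : ℕ) : ℝ) + 2),
      y ∈ Set.Icc (p + 1 : ℝ) q := by
    intro y hy
    have h2 : ((p + 1 + n + 2 : ℕ) : ℝ) ≤ q := by exact_mod_cast (by omega : p + 1 + n + 2 ≤ q)
    push_cast at h2 hy
    have := Nat.cast_nonneg (α := ℝ) n
    exact ⟨by linarith [hy.1], by linarith [hy.2]⟩
  obtain ⟨y, hy, h3⟩ := exists_second_diff_eq (x := ((p + 1 + n : ℕ) : ℝ))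
    (fun y hy => hf y (hsub y hy)) (fun y hy => hf' y (hsub y hy))
  have h4 := hf'' y (hsub y hy)
  rw [← h3] at h4
  push_cast at h4 ⊢
  rw [show (p + 1 + (n + 2) : ℝ) = p + 1 + n + 2 by ring,
    show (p + 1 + (n + 1) : ℝ) = p + 1 + n + 1 by ring]
  exact h4

/-- Abel's inequality for nonnegative monotone weights. -/
lemma norm_sum_range_mul_le {w : ℕ → ℝ} {z : ℕ → ℂ} {N : ℕ} {C W : ℝ} (hW : 0 ≤ W)
    (hw0 : ∀ n < N, 0 ≤ w n) (hwW : ∀ n < N, w n ≤ W) (hw : ∀ n, n + 1 < N → w n ≤ w (n + 1))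
    (hz : ∀ n ≤ N, ‖∑ i ∈ Finset.range n, z i‖ ≤ C) :
    ‖∑ i ∈ Finset.range N, (w i : ℂ) * z i‖ ≤ 2 * W * C := by
  have hC : 0 ≤ C := (norm_nonneg _).trans (hz 0 (Nat.zero_le _))
  rcases Nat.eq_zero_or_pos N with rfl | hN
  · simp; positivity
  obtain ⟨M, rfl⟩ : ∃ M, N = M + 1 := ⟨N - 1, by omega⟩
  have hid : ∀ K, ∑ i ∈ Finset.range (K + 1), (w i : ℂ) * z i =
      (w K : ℂ) * ∑ i ∈ Finset.range (K + 1), z i -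
        ∑ n ∈ Finset.range K, ((w (n + 1) - w n : ℝ) : ℂ) * ∑ i ∈ Finset.range (n + 1), z i := by
    intro K
    induction K with
    | zero => simp
    | succ K ih =>
      rw [Finset.sum_range_succ, ih,
        Finset.sum_range_succ (fun i => z i) (K + 1),
        Finset.sum_range_succ (fun n => ((w (n + 1) - w n : ℝ) : ℂ) * _) K]
      push_cast
      ring
  rw [hid]
  have hWM := hwW M (by omega)
  have h0M := hw0 M (by omega)
  have e1 : ‖(w M : ℂ) * ∑ i ∈ Finset.range (M + 1), z i‖ ≤ W * C := by
    rw [norm_mul, Complex.norm_real, Real.norm_of_nonneg h0M]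
    exact mul_le_mul hWM (hz _ le_rfl) (norm_nonneg _) (h0M.trans hWM)
  have e2 : ‖∑ n ∈ Finset.range M, ((w (n + 1) - w n : ℝ) : ℂ) *
      ∑ i ∈ Finset.range (n + 1), z i‖ ≤ W * C := by
    refine (norm_sum_le_of_le (n := fun n => (w (n + 1) - w n) * C) _ fun n hn => ?_).trans ?_
    · rw [Finset.mem_range] at hn
      have := hw n (by omega)
      rw [norm_mul, Complex.norm_real, Real.norm_of_nonneg (by linarith)]
      exact mul_le_mul_of_nonneg_left (hz _ (by omega)) (by linarith)
    · rw [← Finset.sum_mul, Finset.sum_range_sub]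
      have := hw0 0 (by omega)
      exact mul_le_mul_of_nonneg_right (by linarith) hC
  refine (norm_sub_le _ _).trans ?_
  linarith

/-! ### The Wiener–Ikehara theorem and the prime number theorem. -/

open Filter Topology MeasureTheory FourierTransform in
/-- If the Laplace transform of a bounded function extends continuously to the imaginary axis, then
its averages against the Fourier transform of a compactly supported function tend to `0`. -/
lemma tendsto_integral_mul_fourier {H : ℝ → ℝ} {C : ℝ} (hH : Measurable H) (hC : ∀ u, |H u| ≤ C)
    {F : ℂ → ℂ} (hF : ContinuousOn F {s | 0 ≤ s.re})
    (hFH : ∀ s : ℂ, 0 < s.re → F s = ∫ u in Set.Ioi (0 : ℝ), (H u : ℂ) * Complex.exp (-s * u))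
    {g : ℝ → ℂ} (hg : Continuous g) (hgs : HasCompactSupport g) (hgi : Integrable (𝓕 g)) :
    Tendsto (fun y : ℝ => ∫ u in Set.Ioi (0 : ℝ), (H u : ℂ) * 𝓕 g (u - y)) atTop (𝓝 0) := by
  -- The line `Re s = σ`, with the factor `2π` of the normalisation of `𝓕`.
  set P : ℝ → ℝ → ℂ := fun σ t => (σ : ℂ) + (2 * Real.pi * t : ℝ) * Complex.I with hP
  have hPc : Continuous (fun p : ℝ × ℝ => P p.1 p.2) := by
    simp only [hP]; fun_prop
  have hPre : ∀ σ t, (P σ t).re = σ := by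
    intro σ t
    simp [hP]
  have hFc : ContinuousOn (fun p : ℝ × ℝ => F (P p.1 p.2)) (Set.Ici 0 ×ˢ Set.univ) := by
    refine hF.comp hPc.continuousOn ?_
    rintro ⟨σ, t⟩ ⟨h1, -⟩
    simpa [hPre] using h1
  have hgI : Integrable g := hg.integrable_of_hasCompactSupport hgs
  obtain ⟨D, hD⟩ : ∃ D, ∀ σ ∈ Set.Icc (0 : ℝ) 1, ∀ t ∈ tsupport g, ‖F (P σ t)‖ ≤ D := by
    have hK : IsCompact (Set.Icc (0 : ℝ) 1 ×ˢ tsupport g) := isCompact_Icc.prod hgs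
    obtain ⟨D, hD⟩ := hK.exists_bound_of_continuousOn
      (hFc.mono (Set.prod_mono (fun x hx => hx.1) (Set.subset_univ _)))
    exact ⟨D, fun σ hσ t ht => hD (σ, t) ⟨hσ, ht⟩⟩
  -- the identity on the right half plane
  have hid : ∀ y σ : ℝ, 0 < σ →
      ∫ t : ℝ, Real.fourierChar (t * y) • (g t * F (P σ t)) =
        ∫ u in Set.Ioi (0 : ℝ), (H u * Real.exp (-σ * u) : ℝ) * 𝓕 g (u - y) := by
    intro y σ hσ
    have hint : Integrable (Function.uncurry fun (t : ℝ) (u : ℝ) =>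
        Real.fourierChar (t * y) • (g t * ((H u : ℂ) * Complex.exp (-(P σ t) * u))))
        (volume.prod (volume.restrict (Set.Ioi 0))) := by
      have h1 : Integrable (fun u : ℝ => C * Real.exp (-σ * u)) (volume.restrict (Set.Ioi 0)) :=
        (integrableOn_exp_mul_Ioi (by linarith) 0).const_mul C
      refine (hgI.norm.mul_prod h1).mono' ?_ ?_
      · refine Measurable.aestronglyMeasurable ?_
        have : Measurable (fun p : ℝ × ℝ => H p.2) := hH.comp measurable_snd
        have h3 : Continuous fun p : ℝ × ℝ => Complex.exp (-(P σ p.1) * p.2) := by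
          simp only [hP]; fun_prop
        have h4 : Continuous fun p : ℝ × ℝ => ((Real.fourierChar (p.1 * y) : Circle) : ℂ) := by
          fun_prop
        simp only [Function.uncurry_def, Circle.smul_def, smul_eq_mul]
        have h5 := h3.measurable
        have h6 := h4.measurable
        have h7 : Measurable fun p : ℝ × ℝ => g p.1 := (hg.comp continuous_fst).measurable
        fun_prop
      · refine Eventually.of_forall ?_
        rintro ⟨t, u⟩
        simp only [Function.uncurry_apply_pair, Circle.norm_smul, norm_mul, Complex.norm_real,
          Complex.norm_exp, Real.norm_eq_abs]
        have : (-(P σ t) * u).re = -σ * u := by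
          simp [hP]
        rw [this]
        exact mul_le_mul_of_nonneg_left
          (mul_le_mul_of_nonneg_right (hC u) (Real.exp_pos _).le) (norm_nonneg _)
    calc ∫ t : ℝ, Real.fourierChar (t * y) • (g t * F (P σ t))
        = ∫ t : ℝ, ∫ u in Set.Ioi (0 : ℝ),
            Real.fourierChar (t * y) • (g t * ((H u : ℂ) * Complex.exp (-(P σ t) * u))) := by
          refine integral_congr_ae (Eventually.of_forall fun t => ?_)
          simp only
          rw [hFH _ (by rw [hPre]; exact hσ)]
          simp only [Circle.smul_def, smul_eq_mul, integral_const_mul]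
      _ = ∫ u in Set.Ioi (0 : ℝ), ∫ t : ℝ,
            Real.fourierChar (t * y) • (g t * ((H u : ℂ) * Complex.exp (-(P σ t) * u))) :=
          integral_integral_swap hint
      _ = _ := by
          refine integral_congr_ae (Eventually.of_forall fun u => ?_)
          simp only
          rw [Real.fourier_real_eq, ← integral_const_mul]
          refine integral_congr_ae (Eventually.of_forall fun t => ?_)
          simp only [Circle.smul_def, smul_eq_mul, Real.fourierChar_apply]
          push_cast
          have : Complex.exp (2 * Real.pi * (t * y) * Complex.I) * Complex.exp (-(P σ t) * u) =
              Complex.exp (-σ * u) * Complex.exp (2 * Real.pi * -(t * (u - y)) * Complex.I) := by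
            rw [← Complex.exp_add, ← Complex.exp_add]
            congr 1
            simp only [hP]
            push_cast
            ring
          linear_combination (g t * H u) * this
  -- Both sides pass to the limit `σ → 0+` by dominated convergence: on the left `F` is bounded on
  -- the compact set over the support of `g`, on the right `|H| ≤ C` and `𝓕 g` is integrable.
  have hlimid : ∀ y : ℝ, ∫ t : ℝ, Real.fourierChar (t * y) • (g t * F (P 0 t)) =
      ∫ u in Set.Ioi (0 : ℝ), (H u : ℂ) * 𝓕 g (u - y) := by
    intro y
    have t1 : Tendsto (fun σ : ℝ => ∫ t : ℝ, Real.fourierChar (t * y) • (g t * F (P σ t)))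
        (𝓝[>] 0) (𝓝 (∫ t : ℝ, Real.fourierChar (t * y) • (g t * F (P 0 t)))) := by
      refine tendsto_integral_filter_of_dominated_convergence (fun t => ‖g t‖ * D) ?_ ?_
        (hgI.norm.mul_const D) ?_
      · filter_upwards [self_mem_nhdsWithin] with σ hσ
        have hc : Continuous fun t => F (P σ t) := by
          rw [← continuousOn_univ]
          exact hFc.comp (f := fun t => (σ, t)) (by fun_prop) (fun t _ =>
            ⟨Set.mem_Ici.mpr (Set.mem_Ioi.mp hσ).le, trivial⟩)
        have h4 : Continuous fun t : ℝ => ((Real.fourierChar (t * y) : Circle) : ℂ) := by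
          fun_prop
        simp only [Circle.smul_def, smul_eq_mul]
        exact (h4.mul (hg.mul hc)).aestronglyMeasurable
      · filter_upwards [Ioo_mem_nhdsGT (show (0 : ℝ) < 1 by norm_num)] with σ hσ
        refine Eventually.of_forall fun t => ?_
        rw [Circle.norm_smul, norm_mul]
        by_cases ht : t ∈ tsupport g
        · exact mul_le_mul_of_nonneg_left (hD σ ⟨hσ.1.le, hσ.2.le⟩ t ht) (norm_nonneg _)
        · rw [image_eq_zero_of_notMem_tsupport ht]; simp
      · refine Eventually.of_forall fun t => ?_
        have h1 : Tendsto (fun σ => F (P σ t)) (𝓝[>] 0) (𝓝 (F (P 0 t))) := by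
          have h2 := (hFc (0, t) ⟨Set.mem_Ici.mpr le_rfl, trivial⟩).tendsto
          refine h2.comp (f := fun σ : ℝ => (σ, t)) ?_
          refine tendsto_nhdsWithin_iff.mpr ⟨?_, ?_⟩
          · exact Tendsto.mono_left (by
              have : Continuous fun σ : ℝ => (σ, t) := by fun_prop
              exact this.tendsto 0) nhdsWithin_le_nhds
          · filter_upwards [self_mem_nhdsWithin] with σ hσ
            exact ⟨Set.mem_Ici.mpr (Set.mem_Ioi.mp hσ).le, trivial⟩
        exact (h1.const_mul (g t)).const_smul _
    have t2 : Tendsto (fun σ : ℝ =>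
        ∫ u in Set.Ioi (0 : ℝ), (H u * Real.exp (-σ * u) : ℝ) * 𝓕 g (u - y))
        (𝓝[>] 0) (𝓝 (∫ u in Set.Ioi (0 : ℝ), (H u : ℂ) * 𝓕 g (u - y))) := by
      have hgi' : Integrable (fun u => 𝓕 g (u - y)) := hgi.comp_sub_right y
      refine tendsto_integral_filter_of_dominated_convergence (fun u => C * ‖𝓕 g (u - y)‖) ?_ ?_
        ((hgi'.norm.const_mul C).restrict) ?_
      · refine Eventually.of_forall fun σ => ?_
        refine AEStronglyMeasurable.mul ?_ hgi'.restrict.aestronglyMeasurable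
        exact (Complex.measurable_ofReal.comp
          (hH.mul (by fun_prop : Measurable fun u : ℝ => Real.exp (-σ * u)))).aestronglyMeasurable
      · filter_upwards [self_mem_nhdsWithin] with σ hσ
        filter_upwards [ae_restrict_mem measurableSet_Ioi] with u hu
        rw [norm_mul, Complex.norm_real, norm_mul, Real.norm_of_nonneg (Real.exp_pos _).le]
        refine mul_le_mul_of_nonneg_right ?_ (norm_nonneg _)
        have h1 : Real.exp (-σ * u) ≤ 1 := by
          rw [Real.exp_le_one_iff]
          have : 0 < σ * u := mul_pos hσ hu
          linarith
        exact (mul_le_of_le_one_right (norm_nonneg _) h1).trans (hC u)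
      · refine Eventually.of_forall fun u => ?_
        refine Tendsto.mul_const _ ?_
        refine (Complex.continuous_ofReal.tendsto _).comp ?_
        have : Continuous fun σ : ℝ => H u * Real.exp (-σ * u) := by fun_prop
        have h2 := (this.tendsto 0).mono_left (nhdsWithin_le_nhds (s := Set.Ioi 0))
        simpa using h2
    refine tendsto_nhds_unique t1 (t2.congr' ?_)
    filter_upwards [self_mem_nhdsWithin] with σ hσ
    exact (hid y σ hσ).symm
  -- The Riemann–Lebesgue lemma on the boundary line.
  have hRL := (Real.tendsto_integral_exp_smul_cocompact (fun t => g t * F (P 0 t))).comp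
    (tendsto_neg_atTop_atBot.mono_right (atBot_le_cocompact (α := ℝ)))
  refine hRL.congr fun y => ?_
  rw [← hlimid y]
  simp

open MeasureTheory FourierTransform ComplexConjugate in
lemma fourier_ofReal_eq_re_of_even {η : ℝ → ℝ} (heven : ∀ x, η (-x) = η x) (ξ : ℝ) :
    𝓕 (fun x => (η x : ℂ)) ξ = ((𝓕 (fun x => (η x : ℂ)) ξ).re : ℂ) := by
  have h : conj (𝓕 (fun x => (η x : ℂ)) ξ) = 𝓕 (fun x => (η x : ℂ)) ξ := by
    rw [Real.fourier_real_eq, ← integral_conj, ← integral_neg_eq_self]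
    refine integral_congr_ae (Filter.Eventually.of_forall fun v => ?_)
    simp only [Circle.smul_def, smul_eq_mul, map_mul, Complex.conj_ofReal, heven]
    congr 1
    rw [← Circle.coe_inv_eq_conj, ← AddChar.map_neg_eq_inv]
    congr 2
    ring
  exact (Complex.conj_eq_iff_re.mp h).symm

open MeasureTheory FourierTransform Convolution in
/-- A nonnegative integrable kernel of mass `1` which is the Fourier transform of a continuous
compactly supported function. -/
lemma exists_bandlimited_kernel : ∃ (g : ℝ → ℂ) (k : ℝ → ℝ), Continuous g ∧ HasCompactSupport g ∧
    (∀ u, 0 ≤ k u) ∧ Integrable k ∧ ∫ u, k u = 1 ∧ ∀ u, 𝓕 g u = (k u : ℂ) := by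
  let b : ContDiffBump (0 : ℝ) := ⟨1, 2, one_pos, one_lt_two⟩
  set η : ℝ → ℂ := fun x => (b x : ℂ) with hη
  have hηc : Continuous η := Complex.continuous_ofReal.comp b.continuous
  have hηs : HasCompactSupport η := b.hasCompactSupport.comp_left (g := fun x : ℝ => (x : ℂ)) rfl
  have hηd : ContDiff ℝ ((⊤ : ℕ∞) : WithTop ℕ∞) η :=
    Complex.ofRealCLM.contDiff.comp b.contDiff
  have hηI : Integrable η := hηc.integrable_of_hasCompactSupport hηs
  set r : ℝ → ℝ := fun u => (𝓕 η u).re with hr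
  have hreal : ∀ u, 𝓕 η u = (r u : ℂ) := fun u =>
    fourier_ofReal_eq_re_of_even (η := b) (fun x => b.neg x) u
  set S : SchwartzMap ℝ ℂ := hηs.toSchwartzMap hηd with hS
  have hSη : ∀ u, (𝓕 S) u = 𝓕 η u := fun u => rfl
  have hhatI : Integrable (𝓕 η) := (𝓕 S).integrable
  have hhatc : Continuous (𝓕 η) := (𝓕 S).continuous
  have hrc : Continuous r := Complex.continuous_re.comp hhatc
  have hrI : Integrable r := hhatI.re
  obtain ⟨D, hD⟩ : ∃ D, ∀ u, ‖r u‖ ≤ D := by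
    refine ⟨∫ v, ‖η v‖, fun u => ?_⟩
    have h1 : ‖𝓕 η u‖ ≤ ∫ v, ‖η v‖ := by
      rw [Real.fourier_real_eq]
      refine (norm_integral_le_integral_norm _).trans_eq ?_
      simp [Circle.norm_smul]
    exact (Complex.abs_re_le_norm _).trans h1
  have hr2I : Integrable (fun u => r u * r u) :=
    hrI.bdd_mul hrc.aestronglyMeasurable (Filter.Eventually.of_forall hD)
  have hr0 : r 0 ≠ 0 := by
    have h1 : 𝓕 η 0 = ((∫ x, b x : ℝ) : ℂ) := by
      rw [Real.fourier_real_eq, ← integral_complex_ofReal]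
      simp [hη]
    have h2 : r 0 = ∫ x, b x := by
      simp only [hr, h1, Complex.ofReal_re]
    rw [h2]
    exact b.integral_pos.ne'
  have hpos : 0 < ∫ u, r u * r u := by
    rw [integral_pos_iff_support_of_nonneg (fun u => mul_self_nonneg _) hr2I]
    refine ((hrc.mul hrc).isOpen_support).measure_pos _ ⟨0, ?_⟩
    simp [hr0]
  set J := ∫ u, r u * r u with hJ
  -- The transform `r` of the even bump `η` is real, so its square is nonnegative; and `r²` is the
  -- transform of `η ⋆ η`, still compactly supported.
  obtain ⟨G, hGc, hGs, hGr⟩ : ∃ G : ℝ → ℂ, Continuous G ∧ HasCompactSupport G ∧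
      ∀ u, 𝓕 G u = (r u * r u : ℂ) := by
    refine ⟨convolution η η (ContinuousLinearMap.mul ℂ ℂ) volume, ?_, ?_, ?_⟩
    · exact hηs.continuous_convolution_right _ hηI.locallyIntegrable hηc
    · exact hηs.convolution _ hηs
    · intro u
      rw [Real.fourier_mul_convolution_eq hηI hηI u, hreal]
  refine ⟨fun t => (J⁻¹ : ℂ) * G t, fun u => J⁻¹ * (r u * r u),
    hGc.const_mul _, hGs.mul_left, ?_, hr2I.const_mul _, ?_, ?_⟩
  · intro u
    exact mul_nonneg (inv_nonneg.mpr hpos.le) (mul_self_nonneg _)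
  · rw [integral_const_mul, inv_mul_cancel₀ hpos.ne']
  · intro u
    have h1 := hGr u
    rw [Real.fourier_real_eq] at h1 ⊢
    simp only [Circle.smul_def, smul_eq_mul] at h1 ⊢
    push_cast
    rw [← h1, ← integral_const_mul]
    refine integral_congr_ae (Filter.Eventually.of_forall fun t => ?_)
    simp only
    ring

open MeasureTheory FourierTransform in
/-- Bandlimited nonnegative kernels of mass `1` concentrated near the origin. -/
lemma exists_bandlimited_kernel_concentrated {a ε : ℝ} (ha : 0 < a) (hε : 0 < ε) :
    ∃ (g : ℝ → ℂ) (k : ℝ → ℝ), Continuous g ∧ HasCompactSupport g ∧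
    (∀ u, 0 ≤ k u) ∧ Integrable k ∧ ∫ u, k u = 1 ∧ (∀ u, 𝓕 g u = (k u : ℂ)) ∧
    1 - ε ≤ ∫ u in Set.Icc (-a) a, k u := by
  obtain ⟨g, k, hgc, hgs, hk0, hkI, hk1, hgk⟩ := exists_bandlimited_kernel
  have hlim := intervalIntegral_tendsto_integral hkI
    (Filter.tendsto_neg_atTop_atBot (G := ℝ)) Filter.tendsto_id
  rw [hk1] at hlim
  obtain ⟨T, hT, hT0⟩ := ((hlim.eventually (eventually_ge_nhds (show 1 - ε < 1 by linarith))).and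
    (Filter.eventually_gt_atTop 0)).exists
  simp only [id] at hT
  -- The kernel has mass at least `1 - ε` on `[-T, T]`; dilation by `R` moves that mass into `[-a,
  -- a]` and only rescales the compact support of `g`.
  set R := T / a with hR
  have hRpos : 0 < R := div_pos hT0 ha
  refine ⟨fun t => g (R⁻¹ * t), fun u => R * k (R * u), by fun_prop, ?_, fun u => by
    have := hk0 (R * u); positivity, (hkI.comp_mul_left' hRpos.ne').const_mul R, ?_, ?_, ?_⟩
  · exact hgs.comp_homeomorph (Homeomorph.mulLeft₀ R⁻¹ (inv_ne_zero hRpos.ne'))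
  · rw [integral_const_mul, Measure.integral_comp_mul_left, hk1, abs_of_pos (inv_pos.mpr hRpos),
      smul_eq_mul, mul_one, mul_inv_cancel₀ hRpos.ne']
  · intro u
    have h1 := hgk (R * u)
    push_cast
    rw [← h1, Real.fourier_real_eq, Real.fourier_real_eq]
    have h2 := Measure.integral_comp_mul_left
      (fun v => Real.fourierChar (-(v * (R * u))) • g v) R⁻¹
    rw [inv_inv, abs_of_pos hRpos] at h2
    rw [show ((R : ℂ) * ∫ v, Real.fourierChar (-(v * (R * u))) • g v) =
      R • ∫ v, Real.fourierChar (-(v * (R * u))) • g v from (Complex.real_smul).symm, ← h2]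
    refine integral_congr_ae (Filter.Eventually.of_forall fun v => ?_)
    simp only
    rw [show R⁻¹ * v * (R * u) = v * u by field_simp]
  · rw [integral_Icc_eq_integral_Ioc, ← intervalIntegral.integral_of_le (by linarith),
      intervalIntegral.integral_const_mul, intervalIntegral.integral_comp_mul_left _ hRpos.ne',
      show R * a = T by rw [hR]; field_simp, show R * -a = -T by rw [hR]; field_simp, smul_eq_mul,
      ← mul_assoc, mul_inv_cancel₀ hRpos.ne', one_mul]
    exact hT

open Filter Topology MeasureTheory FourierTransform in
/-- The Wiener–Ikehara theorem, in Laplace transform form. -/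
theorem tendsto_one_of_laplace_continuousOn {B : ℝ → ℝ} {C : ℝ} (hB : Measurable B)
    (hB0 : ∀ u, 0 ≤ B u) (hBC : ∀ u, B u ≤ C)
    (hmono : ∀ u v, 0 < u → u ≤ v → B u * Real.exp u ≤ B v * Real.exp v)
    {F : ℂ → ℂ} (hF : ContinuousOn F {s | 0 ≤ s.re})
    (hFB : ∀ s : ℂ, 0 < s.re →
      F s = ∫ u in Set.Ioi (0 : ℝ), ((B u - 1 : ℝ) : ℂ) * Complex.exp (-s * u)) :
    Tendsto B atTop (𝓝 1) := by
  have hC0 : 0 ≤ C := (hB0 0).trans (hBC 0)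
  have hmul : ∀ {k : ℝ → ℝ}, Integrable k → ∀ y, Integrable (fun u => B u * k (u - y)) := by
    intro k hk y
    refine (hk.comp_sub_right y).bdd_mul (c := C) hB.aestronglyMeasurable ?_
    exact Eventually.of_forall fun u => by rw [Real.norm_of_nonneg (hB0 u)]; exact hBC u
  -- Averages of `B - 1` against the translated kernel vanish in the limit, and the mass of the
  -- translated kernel on `(0, ∞)` tends to `1`.
  have hker : ∀ {g : ℝ → ℂ} {k : ℝ → ℝ}, Continuous g → HasCompactSupport g → Integrable k →
      ∫ u, k u = 1 → (∀ u, 𝓕 g u = (k u : ℂ)) →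
      Tendsto (fun y => ∫ u in Set.Ioi (0 : ℝ), B u * k (u - y)) atTop (𝓝 1) := by
    intro g k hg hgs hk hk1 hgk
    have hgI : Integrable (𝓕 g) := by
      rw [show 𝓕 g = fun u => (k u : ℂ) from funext hgk]
      exact hk.ofReal
    have h1 := tendsto_integral_mul_fourier (H := fun u => B u - 1) (C := C + 1)
      (hB.sub_const 1) (fun u => by
        rw [abs_le]; constructor <;> linarith [hB0 u, hBC u]) hF hFB hg hgs hgI
    have h2 : Tendsto (fun y => ∫ u in Set.Ioi (0 : ℝ), (B u - 1) * k (u - y)) atTop (𝓝 0) := by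
      have h3 := (Complex.continuous_re.tendsto _).comp h1
      refine h3.congr fun y => ?_
      simp only [Function.comp, hgk, ← Complex.ofReal_mul]
      rw [integral_complex_ofReal, Complex.ofReal_re]
    have h4 : Tendsto (fun y => ∫ u in Set.Ioi (0 : ℝ), k (u - y)) atTop (𝓝 1) := by
      rw [← hk1]
      refine ((aecover_Ioi (μ := volume)
        tendsto_neg_atTop_atBot).integral_tendsto_of_countably_generated hk).congr fun y => ?_
      rw [← integral_indicator measurableSet_Ioi, ← integral_indicator measurableSet_Ioi,
        ← integral_sub_right_eq_self _ y]
      refine integral_congr_ae (Eventually.of_forall fun u => ?_)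
      simp only [Set.indicator_apply, Set.mem_Ioi, neg_lt_sub_iff_lt_add, lt_add_iff_pos_right]
    have h5 := h2.add h4
    rw [zero_add] at h5
    refine h5.congr fun y => ?_
    rw [← integral_add]
    · refine integral_congr_ae (Eventually.of_forall fun u => ?_)
      simp only
      ring
    · refine Integrable.restrict ?_
      refine ((hmul hk y).sub (hk.comp_sub_right y)).congr (Eventually.of_forall fun u => ?_)
      simp only [Pi.sub_apply]
      ring
    · exact (hk.comp_sub_right y).restrict
  -- Tauberian step, upper bound. The kernel is centred at `y + x`, so its mass lies mostly on `[y,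
  -- y + 2x]`, where monotonicity of `B u * exp u` gives `B u ≥ B y * exp (-2x)`.
  have hup : ∀ x : ℝ, 0 < x → ∀ᶠ y in atTop, B y * (1 - x) ≤ Real.exp (2 * x) * (1 + x) := by
    intro x hx
    obtain ⟨g, k, hgc, hgs, hk0, hkI, hk1, hgk, hconc⟩ :=
      exists_bandlimited_kernel_concentrated hx hx
    have hI := (hker hgc hgs hkI hk1 hgk).comp (tendsto_atTop_add_const_right atTop x tendsto_id)
    filter_upwards [hI.eventually (eventually_le_nhds (show (1 : ℝ) < 1 + x by linarith)),
      eventually_gt_atTop 0] with y hy hy0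
    simp only [Function.comp, id] at hy
    have h1 : ∫ u in Set.Icc y (y + 2 * x), B y * Real.exp (-(2 * x)) * k (u - (y + x)) ≤
        ∫ u in Set.Ioi 0, B u * k (u - (y + x)) := by
      refine le_trans (setIntegral_mono_on
        (((hkI.comp_sub_right (y + x)).const_mul _).integrableOn)
        ((hmul hkI (y + x)).integrableOn) measurableSet_Icc fun u hu => ?_)
        (setIntegral_mono_set ((hmul hkI (y + x)).integrableOn)
          (Eventually.of_forall fun u => mul_nonneg (hB0 u) (hk0 _))
          (LE.le.eventuallyLE fun u hu => lt_of_lt_of_le hy0 hu.1))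
      refine mul_le_mul_of_nonneg_right ?_ (hk0 _)
      have h2 := hmono y u hy0 hu.1
      have h3 : Real.exp u ≤ Real.exp (2 * x) * Real.exp y := by
        rw [← Real.exp_add, Real.exp_le_exp]; linarith [hu.2]
      have h4 : B y * Real.exp y ≤ B u * (Real.exp (2 * x) * Real.exp y) :=
        h2.trans (mul_le_mul_of_nonneg_left h3 (hB0 u))
      rw [Real.exp_neg, ← div_eq_mul_inv, div_le_iff₀ (Real.exp_pos _)]
      refine le_of_mul_le_mul_right ?_ (Real.exp_pos y)
      linarith
    have h2 : ∫ u in Set.Icc y (y + 2 * x), k (u - (y + x)) = ∫ u in Set.Icc (-x) x, k u := by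
      rw [integral_Icc_eq_integral_Ioc, integral_Icc_eq_integral_Ioc,
        ← intervalIntegral.integral_of_le (by linarith),
        ← intervalIntegral.integral_of_le (by linarith), intervalIntegral.integral_comp_sub_right]
      congr 1 <;> ring
    rw [integral_const_mul, h2] at h1
    have h3 := h1.trans hy
    have h4 : B y * Real.exp (-(2 * x)) * (1 - x) ≤ 1 + x :=
      (mul_le_mul_of_nonneg_left hconc (mul_nonneg (hB0 y) (Real.exp_pos _).le)).trans h3
    rw [Real.exp_neg] at h4
    have h5 := Real.exp_pos (2 * x)
    have h6 := mul_le_mul_of_nonneg_left h4 h5.le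
    have h7 : Real.exp (2 * x) * (B y * (Real.exp (2 * x))⁻¹ * (1 - x)) = B y * (1 - x) := by
      field_simp
    linarith
  -- Lower bound: centred at `y - x`, the kernel mostly sees `[y - 2x, y]`, where `B u ≤ B y * exp
  -- (2x)`; the remaining mass, at most `x`, is weighted by `B ≤ C`.
  have hlo : ∀ x : ℝ, 0 < x →
      ∀ᶠ y in atTop, 1 - x - C * x ≤ B y * Real.exp (2 * x) := by
    intro x hx
    obtain ⟨g, k, hgc, hgs, hk0, hkI, hk1, hgk, hconc⟩ :=
      exists_bandlimited_kernel_concentrated hx hx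
    have hI := (hker hgc hgs hkI hk1 hgk).comp (tendsto_atTop_add_const_right atTop (-x) tendsto_id)
    filter_upwards [hI.eventually (eventually_ge_nhds (show 1 - x < (1 : ℝ) by linarith)),
      eventually_gt_atTop (2 * x)] with y hy hy0
    simp only [Function.comp, id] at hy
    set z := y + -x with hz
    have hkz : Integrable (fun u => k (u - z)) := hkI.comp_sub_right z
    have hindI : Integrable (fun u => (Set.Icc (-x) x)ᶜ.indicator k (u - z)) :=
      (hkI.indicator measurableSet_Icc.compl).comp_sub_right z
    have h1 : ∫ u in Set.Ioi 0, B u * k (u - z) ≤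
        ∫ u, (B y * Real.exp (2 * x) * k (u - z) +
          C * (Set.Icc (-x) x)ᶜ.indicator k (u - z)) := by
      rw [← integral_indicator measurableSet_Ioi]
      refine integral_mono ((hmul hkI z).indicator measurableSet_Ioi)
        ((hkz.const_mul _).add (hindI.const_mul C)) fun u => ?_
      have e1 : 0 ≤ B y * Real.exp (2 * x) * k (u - z) :=
        mul_nonneg (mul_nonneg (hB0 y) (Real.exp_pos _).le) (hk0 _)
      have e2 : 0 ≤ C * (Set.Icc (-x) x)ᶜ.indicator k (u - z) :=
        mul_nonneg hC0 (Set.indicator_nonneg (fun _ _ => hk0 _) _)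
      by_cases hu : u ∈ Set.Ioi (0 : ℝ)
      · simp only [Set.indicator_of_mem hu]
        by_cases hu2 : u - z ∈ Set.Icc (-x) x
        · have h3 := hmono u y hu (by linarith [hu2.2])
          have h4 : Real.exp y ≤ Real.exp (2 * x) * Real.exp u := by
            rw [← Real.exp_add, Real.exp_le_exp]; linarith [hu2.1]
          have h5 : B u * Real.exp u ≤ B y * (Real.exp (2 * x) * Real.exp u) :=
            h3.trans (mul_le_mul_of_nonneg_left h4 (hB0 y))
          have h6 : B u ≤ B y * Real.exp (2 * x) := by
            refine le_of_mul_le_mul_right ?_ (Real.exp_pos u)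
            linarith
          have := mul_le_mul_of_nonneg_right h6 (hk0 (u - z))
          linarith
        · rw [Set.indicator_of_mem (show u - z ∈ (Set.Icc (-x) x)ᶜ from hu2)]
          have := mul_le_mul_of_nonneg_right (hBC u) (hk0 (u - z))
          linarith
      · rw [Set.indicator_of_notMem hu]
        linarith
    rw [integral_add (hkz.const_mul _) (hindI.const_mul C), integral_const_mul, integral_const_mul,
      integral_sub_right_eq_self k z, hk1,
      integral_sub_right_eq_self ((Set.Icc (-x) x)ᶜ.indicator k) z,
      integral_indicator measurableSet_Icc.compl] at h1
    have h2 := integral_add_compl (measurableSet_Icc (a := -x) (b := x)) hkI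
    rw [hk1] at h2
    have h3 : ∫ u in (Set.Icc (-x) x)ᶜ, k u ≤ x := by linarith
    have := mul_le_mul_of_nonneg_left h3 hC0
    linarith
  rw [tendsto_order]
  constructor
  · intro l hl
    have hc : Tendsto (fun x : ℝ => 1 - x - C * x - l * Real.exp (2 * x)) (𝓝[>] 0)
        (𝓝 (1 - l)) := by
      have : Continuous fun x : ℝ => 1 - x - C * x - l * Real.exp (2 * x) := by fun_prop
      have h := (this.tendsto 0).mono_left (nhdsWithin_le_nhds (s := Set.Ioi 0))
      simpa using h
    obtain ⟨x, hx, hx0⟩ := ((hc.eventually (lt_mem_nhds (show 0 < 1 - l by linarith))).and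
      self_mem_nhdsWithin).exists
    filter_upwards [hlo x hx0] with y hy
    have h5 := Real.exp_pos (2 * x)
    refine lt_of_mul_lt_mul_right ?_ h5.le
    linarith
  · intro l hl
    have hc : Tendsto (fun x : ℝ => l * (1 - x) - Real.exp (2 * x) * (1 + x)) (𝓝[>] 0)
        (𝓝 (l - 1)) := by
      have : Continuous fun x : ℝ => l * (1 - x) - Real.exp (2 * x) * (1 + x) := by fun_prop
      have h := (this.tendsto 0).mono_left (nhdsWithin_le_nhds (s := Set.Ioi 0))
      simpa using h
    obtain ⟨x, ⟨hx, hx0⟩, hx1⟩ := (((hc.eventually (lt_mem_nhds (show 0 < l - 1 by linarith))).and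
      self_mem_nhdsWithin).and (Ioo_mem_nhdsGT (show (0 : ℝ) < 1 by norm_num))).exists
    filter_upwards [hup x hx0] with y hy
    have h5 : 0 < 1 - x := by linarith [hx1.2]
    refine lt_of_mul_lt_mul_right ?_ h5.le
    linarith

open Filter Topology MeasureTheory ArithmeticFunction in
/-- The prime number theorem: `ψ(x) ∼ x`. -/
theorem tendsto_psi_div_self : Tendsto (fun x => Chebyshev.psi x / x) atTop (𝓝 1) := by
  set B : ℝ → ℝ := fun u => Chebyshev.psi (Real.exp u) * Real.exp (-u) with hB
  have hpsim : Measurable Chebyshev.psi := Chebyshev.psi_mono.measurable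
  have hBm : Measurable B := by fun_prop
  have hB0 : ∀ u, 0 ≤ B u := fun u => mul_nonneg (Chebyshev.psi_nonneg _) (Real.exp_pos _).le
  have hBC : ∀ u, B u ≤ Real.log 4 + 4 := by
    intro u
    have := Chebyshev.psi_le_const_mul_self (Real.exp_pos u).le
    simp only [hB]
    rw [Real.exp_neg, ← div_eq_mul_inv, div_le_iff₀ (Real.exp_pos u)]
    exact this
  have hmono : ∀ u v, 0 < u → u ≤ v → B u * Real.exp u ≤ B v * Real.exp v := by
    intro u v _ huv
    simp only [hB, mul_assoc, ← Real.exp_add, neg_add_cancel, Real.exp_zero, mul_one]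
    exact Chebyshev.psi_mono (Real.exp_le_exp.mpr huv)
  -- For modulus `1` this is `-ζ'/ζ(s)` with its pole at `s = 1` subtracted. Its continuity on `Re s
  -- ≥ 1` carries the nonvanishing of `ζ` on that line.
  set A : ℂ → ℂ := vonMangoldt.LFunctionResidueClassAux (1 : ZMod 1) with hA
  have hAc : ContinuousOn A {s | 1 ≤ s.re} :=
    vonMangoldt.continuousOn_LFunctionResidueClassAux (1 : ZMod 1)
  -- The Laplace transform of `B` is `(-ζ'/ζ)(1 + s) / (1 + s)` and that of `1` is `1 / s`; with
  -- `-ζ'/ζ (1 + s) = A (1 + s) + 1 / s` the difference simplifies to this.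
  set F : ℂ → ℂ := fun s => (A (1 + s) - 1) / (1 + s) with hFdef
  have hF : ContinuousOn F {s | 0 ≤ s.re} := by
    refine ContinuousOn.div ?_ (by fun_prop) ?_
    · refine (hAc.comp (by fun_prop) ?_).sub continuousOn_const
      intro s hs
      simpa using hs
    · intro s hs h0
      have h1 := congrArg Complex.re h0
      have h2 : 0 ≤ s.re := hs
      simp at h1
      linarith
  have hres : vonMangoldt.residueClass (1 : ZMod 1) = fun n => Λ n := by
    funext n
    simp [vonMangoldt.residueClass, Subsingleton.elim (n : ZMod 1) 1]
  have hFB : ∀ s : ℂ, 0 < s.re →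
      F s = ∫ u in Set.Ioi (0 : ℝ), ((B u - 1 : ℝ) : ℂ) * Complex.exp (-s * u) := by
    intro s hs
    have hs0 : s ≠ 0 := by rintro rfl; simp at hs
    have hs1 : (1 + s) ≠ 0 := by
      intro h0
      have h1 := congrArg Complex.re h0
      simp at h1
      linarith
    have hs' : 1 < (1 + s).re := by simpa using hs
    have h1 := vonMangoldt.eqOn_LFunctionResidueClassAux (q := 1) (a := 1) isUnit_one hs'
    simp only [Nat.totient_one, Nat.cast_one, inv_one, add_sub_cancel_left, hres] at h1
    have h2 : LSeries (fun n => ((Λ n : ℝ) : ℂ)) (1 + s) = (1 + s) *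
        ∫ t in Set.Ioi (1 : ℝ), (∑ k ∈ Finset.Icc 1 ⌊t⌋₊, ((Λ k : ℝ) : ℂ)) *
          (t : ℂ) ^ (-((1 + s) + 1)) := by
      refine LSeries_eq_mul_integral_of_nonneg (fun n => Λ n) zero_le_one hs' ?_
        fun n => vonMangoldt_nonneg
      refine Asymptotics.IsBigO.of_bound (Real.log 4 + 4) (Eventually.of_forall fun n => ?_)
      have h3 := Chebyshev.psi_le_const_mul_self (Nat.cast_nonneg (α := ℝ) n)
      have h4 := Chebyshev.psi_nonneg (n : ℝ)
      rw [Chebyshev.psi, Nat.floor_natCast] at h3 h4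
      rw [show Finset.Icc 1 n = Finset.Ioc 0 n from rfl, Real.norm_of_nonneg h4, Real.rpow_one,
        Real.norm_of_nonneg (Nat.cast_nonneg n)]
      exact h3
    have h5 : ∫ t in Set.Ioi (1 : ℝ), (∑ k ∈ Finset.Icc 1 ⌊t⌋₊, ((Λ k : ℝ) : ℂ)) *
          (t : ℂ) ^ (-((1 + s) + 1)) =
        ∫ u in Set.Ioi (0 : ℝ), (B u : ℂ) * Complex.exp (-s * u) := by
      have himg : Real.exp '' Set.Ioi 0 = Set.Ioi 1 := by
        ext t
        constructor
        · rintro ⟨u, hu, rfl⟩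
          exact Real.one_lt_exp_iff.mpr hu
        · intro ht
          have ht' : (1 : ℝ) < t := ht
          exact ⟨Real.log t, Real.log_pos ht, Real.exp_log (by linarith)⟩
      rw [← himg, integral_image_eq_integral_abs_deriv_smul measurableSet_Ioi
        (fun x _ => (Real.hasDerivAt_exp x).hasDerivWithinAt) Real.exp_injective.injOn]
      refine integral_congr_ae (Eventually.of_forall fun u => ?_)
      simp only [hB, Chebyshev.psi, abs_of_pos (Real.exp_pos u), Complex.real_smul]
      rw [show Finset.Icc 1 ⌊Real.exp u⌋₊ = Finset.Ioc 0 ⌊Real.exp u⌋₊ from rfl]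
      have h6 : ((Real.exp u : ℝ) : ℂ) ^ (-((1 + s) + 1)) =
          Complex.exp (-(u : ℂ)) * Complex.exp (-(u : ℂ)) * Complex.exp (-s * u) := by
        rw [Complex.cpow_def_of_ne_zero (by exact_mod_cast (Real.exp_pos u).ne'),
          ← Complex.ofReal_log (Real.exp_pos u).le, Real.log_exp, ← Complex.exp_add,
          ← Complex.exp_add]
        congr 1
        ring
      have h7 : (Real.exp u : ℂ) * Complex.exp (-(u : ℂ)) = 1 := by
        rw [Complex.ofReal_exp, ← Complex.exp_add, add_neg_cancel, Complex.exp_zero]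
      rw [h6]
      push_cast at h7 ⊢
      linear_combination (∑ k ∈ Finset.Ioc 0 ⌊Real.exp u⌋₊, ((Λ k : ℝ) : ℂ)) *
        Complex.exp (-(u : ℂ)) * Complex.exp (-s * u) * h7
    have hexpI : IntegrableOn (fun u : ℝ => Complex.exp (-s * u)) (Set.Ioi 0) :=
      integrableOn_exp_mul_complex_Ioi (by simpa using hs) 0
    have h8 := integral_exp_mul_complex_Ioi (a := -s) (by simpa using hs) 0
    have h9 : ∫ u in Set.Ioi (0 : ℝ), ((B u - 1 : ℝ) : ℂ) * Complex.exp (-s * u) =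
        (∫ u in Set.Ioi (0 : ℝ), (B u : ℂ) * Complex.exp (-s * u)) -
          ∫ u in Set.Ioi (0 : ℝ), Complex.exp (-s * u) := by
      rw [← integral_sub]
      · refine integral_congr_ae (Eventually.of_forall fun u => ?_)
        simp only
        push_cast
        ring
      · refine hexpI.bdd_mul (c := Real.log 4 + 4)
          (Complex.measurable_ofReal.comp hBm).aestronglyMeasurable
          (Eventually.of_forall fun u => ?_)
        rw [Complex.norm_real, Real.norm_of_nonneg (hB0 u)]
        exact hBC u
      · exact hexpI
    rw [h9, h8, ← h5]
    have h10 : A (1 + s) = LSeries (fun n => ((Λ n : ℝ) : ℂ)) (1 + s) - 1 / s := h1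
    simp only [hFdef, h10, h2]
    simp
    field_simp
    ring
  have hlim := tendsto_one_of_laplace_continuousOn hBm hB0 hBC hmono hF hFB
  refine (hlim.comp Real.tendsto_log_atTop).congr' ?_
  filter_upwards [eventually_gt_atTop 0] with x hx
  simp only [Function.comp, hB]
  rw [Real.exp_neg, Real.exp_log hx, div_eq_mul_inv]

/-! ### Regularly varying functions, their inverses, and the derivatives of the inverses. -/

lemma hasDerivAt_exp_integral_of_continuousOn {ϑ L : ℝ → ℝ} (hϑ : ContinuousOn ϑ (Set.Ici 1))
    (hL : HasKaramataForm L ϑ) :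
    ContinuousOn L (Set.Ici 1) ∧ ∀ x, 1 < x → HasDerivAt L (L x * (ϑ x / x)) x := by
  -- Only the values of `ϑ` on `[1, ∞)` are controlled; this continuous extension to the line makes
  -- the fundamental theorem of calculus available at every point.
  set f : ℝ → ℝ := fun t => ϑ (max t 1) / max t 1 with hf
  have hfc : Continuous f := by
    refine Continuous.div ?_ (by fun_prop) fun t => by
      have := le_max_right t 1
      positivity
    exact hϑ.comp_continuous (by fun_prop) fun t => le_max_right t 1
  have hd : ∀ x, HasDerivAt (fun u => ∫ t in (1 : ℝ)..u, f t) (f x) x := fun x =>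
    intervalIntegral.integral_hasDerivAt_right (hfc.intervalIntegrable _ _)
      hfc.stronglyMeasurable.stronglyMeasurableAtFilter hfc.continuousAt
  have heq : ∀ x, 1 ≤ x → L x = Real.exp (∫ t in (1 : ℝ)..x, f t) := by
    intro x hx
    rw [hL x hx]
    congr 1
    refine intervalIntegral.integral_congr fun t ht => ?_
    rw [Set.uIcc_of_le hx] at ht
    simp only [hf, max_eq_left ht.1]
  constructor
  · have : Continuous fun x => Real.exp (∫ t in (1 : ℝ)..x, f t) :=
      Real.continuous_exp.comp (continuous_iff_continuousAt.mpr fun x => (hd x).continuousAt)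
    exact this.continuousOn.congr heq
  · intro x hx
    have h1 := (hd x).exp
    have h2 : f x = ϑ x / x := by simp only [hf, max_eq_left hx.le]
    rw [← heq x hx.le, h2] at h1
    refine h1.congr_of_eventuallyEq ?_
    filter_upwards [Ioi_mem_nhds hx] with y hy
    exact heq y (le_of_lt hy)

lemma hasDerivAt_iteratedDeriv_of_contDiffOn {ϑ : ℝ → ℝ}
    (hϑ : ContDiffOn ℝ ((⊤ : ℕ∞) : WithTop ℕ∞) ϑ (Set.Ici 1)) (n : ℕ) :
    ∀ x, 1 < x → HasDerivAt (iteratedDeriv n ϑ) (iteratedDeriv (n + 1) ϑ x) x := by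
  have h : ∀ n : ℕ, ContDiffOn ℝ ((⊤ : ℕ∞) : WithTop ℕ∞) (iteratedDeriv n ϑ) (Set.Ioi 1) := by
    intro n
    induction n with
    | zero => simpa using hϑ.mono Set.Ioi_subset_Ici_self
    | succ n ih =>
      rw [iteratedDeriv_succ]
      exact ih.deriv_of_isOpen isOpen_Ioi (by simp)
  intro x hx
  rw [iteratedDeriv_succ]
  exact (((h n).differentiableOn (by simp)) x hx).differentiableAt (Ioi_mem_nhds hx)|>.hasDerivAt

open Filter Topology in
/-- A member of `𝓡_c` satisfies `x h'(x) = (1 + τ(x)) h(x)`, with `τ → c - 1` varying slowly. -/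
lemma InClassR.exists_index {c : ℝ} {h : ℝ → ℝ} (hc : 1 ≤ c) (hh : InClassR c h) :
    ∃ τ τ₁ τ₂ : ℝ → ℝ, ContinuousOn h (Set.Ici 1) ∧ h 1 = 1 ∧
      (∀ x, 1 < x → HasDerivAt h (h x * (1 + τ x) / x) x) ∧
      (∀ᶠ x in atTop, 0 < τ x) ∧ Tendsto τ atTop (𝓝 (c - 1)) ∧
      (∀ x, 1 < x → HasDerivAt τ (τ₁ x) x) ∧ (∀ x, 1 < x → HasDerivAt τ₁ (τ₂ x) x) ∧
      Tendsto (fun x => x * τ₁ x / τ x) atTop (𝓝 0) ∧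
      Tendsto (fun x => x ^ 2 * τ₂ x / τ x) atTop (𝓝 0) := by
  obtain ⟨-, -, -, L, hL, h1, h2⟩ := hh
  -- The two classes are unified by `τ = c - 1 + ϑ`. For `c = 1` the defining decay is already
  -- relative to `ϑ = τ`; for `c > 1` the denominator tends to `c - 1 > 0`.
  obtain ⟨ϑ, hs, hK, hϑ0, hpos, hder⟩ : ∃ ϑ : ℝ → ℝ,
      ContDiffOn ℝ ((⊤ : ℕ∞) : WithTop ℕ∞) ϑ (Set.Ici 1) ∧ HasKaramataForm L ϑ ∧
      Tendsto ϑ atTop (𝓝 0) ∧ (∀ᶠ x in atTop, 0 < c - 1 + ϑ x) ∧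
      ∀ n : ℕ, 1 ≤ n →
        Tendsto (fun x => x ^ n * iteratedDeriv n ϑ x / (c - 1 + ϑ x)) atTop (𝓝 0) := by
    by_cases hc1 : c = 1
    · obtain ⟨-, -, ϑ, hs, hK, hpos, -, hϑ0, hder, -⟩ := h1 hc1
      refine ⟨ϑ, hs, hK, hϑ0, ?_, ?_⟩
      · filter_upwards [eventually_ge_atTop 1] with x hx
        rw [hc1, sub_self, zero_add]
        exact hpos x hx
      · simpa only [hc1, sub_self, zero_add] using hder
    · obtain ⟨-, ϑ, hs, hK, hϑ0, hder⟩ := h2 hc1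
      have hlim : Tendsto (fun x => c - 1 + ϑ x) atTop (𝓝 (c - 1)) := by
        simpa using hϑ0.const_add (c - 1)
      have hcpos : 0 < c - 1 := sub_pos.mpr (lt_of_le_of_ne hc (Ne.symm hc1))
      refine ⟨ϑ, hs, hK, hϑ0, hlim.eventually (lt_mem_nhds hcpos), fun n hn => ?_⟩
      have := (hder n hn).div hlim hcpos.ne'
      rwa [zero_div] at this
  obtain ⟨hLc, hLd⟩ := hasDerivAt_exp_integral_of_continuousOn hs.continuousOn hK
  have hd := hasDerivAt_iteratedDeriv_of_contDiffOn hs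
  refine ⟨fun x => c - 1 + ϑ x, iteratedDeriv 1 ϑ, iteratedDeriv 2 ϑ, ?_, ?_, ?_, hpos, ?_, ?_,
    hd 1, ?_, ?_⟩
  · refine ContinuousOn.congr ?_ hL
    refine ContinuousOn.mul (fun x hx => ?_) hLc
    exact (Real.continuousAt_rpow_const x c (Or.inr (by linarith))).continuousWithinAt
  · rw [hL 1 le_rfl, hK 1 le_rfl]
    simp
  · intro x hx
    have hx0 : x ≠ 0 := by linarith
    have h3 := (Real.hasDerivAt_rpow_const (x := x) (p := c) (Or.inl hx0)).mul (hLd x hx)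
    have h4 : h x * (1 + (c - 1 + ϑ x)) / x =
        c * x ^ (c - 1) * L x + x ^ c * (L x * (ϑ x / x)) := by
      rw [hL x hx.le, Real.rpow_sub_one hx0]
      ring
    rw [h4]
    refine h3.congr_of_eventuallyEq ?_
    filter_upwards [Ioi_mem_nhds hx] with y hy
    exact hL y (le_of_lt hy)
  · simpa using hϑ0.const_add (c - 1)
  · intro x hx
    have := hd 0 x hx
    rw [iteratedDeriv_zero] at this
    exact this.const_add _
  · simpa using hder 1 le_rfl
  · exact hder 2 (by norm_num)

-- The function `f y * y ^ (-(κ - ε / 2))` is eventually increasing, hence bounded below by a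
-- positive constant, and the spare factor `y ^ (-ε / 2)` falls below that constant.
open Filter Topology in
lemma eventually_rpow_le_of_log_deriv {f a : ℝ → ℝ} {κ ε : ℝ} (hε : 0 < ε)
    (hf : ∀ᶠ y in atTop, 0 < f y) (hd : ∀ᶠ y in atTop, HasDerivAt f (f y * a y / y) y)
    (ha : Tendsto a atTop (𝓝 κ)) : ∀ᶠ y in atTop, y ^ (κ - ε) ≤ f y := by
  obtain ⟨y₀, hy₀⟩ := eventually_atTop.mp (((hf.and hd).and
    (ha.eventually (lt_mem_nhds (show κ - ε / 2 < κ by linarith)))).and (eventually_gt_atTop 0))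
  set g : ℝ → ℝ := fun y => f y * y ^ (-(κ - ε / 2)) with hg
  have hgd : ∀ y, y₀ ≤ y → HasDerivAt g (g y * (a y - (κ - ε / 2)) / y) y := by
    intro y hy
    obtain ⟨⟨⟨h1, h2⟩, -⟩, h3⟩ := hy₀ y hy
    have h4 := h2.mul (Real.hasDerivAt_rpow_const (x := y) (p := -(κ - ε / 2)) (Or.inl h3.ne'))
    refine h4.congr_deriv ?_
    rw [Real.rpow_sub_one h3.ne']
    simp only [hg]
    ring
  have hmono : MonotoneOn g (Set.Ici y₀) := by
    refine monotoneOn_of_hasDerivWithinAt_nonneg (convex_Ici _)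
      (f' := fun y => g y * (a y - (κ - ε / 2)) / y)
      (fun y hy => (hgd y hy).continuousAt.continuousWithinAt) ?_ ?_
    · intro y hy
      exact (hgd y (interior_subset hy)).hasDerivWithinAt
    · intro y hy
      obtain ⟨⟨⟨h1, h2⟩, h4⟩, h3⟩ := hy₀ y (interior_subset hy)
      have : 0 < g y := mul_pos h1 (Real.rpow_pos_of_pos h3 _)
      exact div_nonneg (mul_nonneg this.le (by linarith)) h3.le
  have hm : 0 < g y₀ := by
    obtain ⟨⟨⟨h1, h2⟩, h4⟩, h3⟩ := hy₀ y₀ le_rfl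
    exact mul_pos h1 (Real.rpow_pos_of_pos h3 _)
  have hlim := tendsto_rpow_neg_atTop (show 0 < ε / 2 by linarith)
  filter_upwards [hlim.eventually (gt_mem_nhds hm), eventually_ge_atTop y₀] with y hy1 hy2
  have h3 := (hy₀ y hy2).2
  have h4 := hmono (Set.mem_Ici.mpr le_rfl) hy2 hy2
  have h5 : y ^ (-(ε / 2)) ≤ f y * y ^ (-(κ - ε / 2)) := hy1.le.trans h4
  calc y ^ (κ - ε) = y ^ (-(ε / 2)) * y ^ (κ - ε / 2) := by
        rw [← Real.rpow_add h3]; congr 1; ring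
    _ ≤ f y * y ^ (-(κ - ε / 2)) * y ^ (κ - ε / 2) :=
        mul_le_mul_of_nonneg_right h5 (Real.rpow_nonneg h3.le _)
    _ = f y := by rw [mul_assoc, ← Real.rpow_add h3]; simp

open Filter Topology in
/-- A function whose logarithmic derivative is `∼ κ / y` is `y ^ (κ + o(1))`. -/
lemma eventually_mem_Icc_rpow_of_log_deriv {f a : ℝ → ℝ} {κ ε : ℝ} (hε : 0 < ε)
    (hf : ∀ᶠ y in atTop, 0 < f y) (hd : ∀ᶠ y in atTop, HasDerivAt f (f y * a y / y) y)
    (ha : Tendsto a atTop (𝓝 κ)) :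
    ∀ᶠ y in atTop, f y ∈ Set.Icc (y ^ (κ - ε)) (y ^ (κ + ε)) := by
  have h1 := eventually_rpow_le_of_log_deriv hε hf hd ha
  have h2 := eventually_rpow_le_of_log_deriv (f := fun y => (f y)⁻¹) (a := fun y => -a y) hε
    (hf.mono fun y hy => inv_pos.mpr hy)
    (by
      filter_upwards [hf, hd] with y hy1 hy2
      refine (hy2.inv hy1.ne').congr_deriv ?_
      field_simp) ha.neg
  filter_upwards [h1, h2, hf, eventually_gt_atTop 0] with y hy1 hy2 hy3 hy4
  refine ⟨hy1, ?_⟩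
  rw [show -κ - ε = -(κ + ε) by ring, Real.rpow_neg hy4.le] at hy2
  exact (inv_le_inv₀ (Real.rpow_pos_of_pos hy4 _) hy3).mp hy2

-- Convexity keeps `h` above the line through its values at `1` and `2` from there on, so `h → ∞`;
-- together with `h 1 = 1` and continuity, `h` maps `[1, ∞)` onto itself. The inverse is strictly
-- increasing with image containing a neighbourhood of each `φ y`, hence continuous.
open Filter Topology in
lemma InClassR.inverse_spec {c : ℝ} {h : ℝ → ℝ} (hc : 1 ≤ c) (hh : InClassR c h) :
    (∀ y, 1 ≤ y → 1 ≤ inverseOnIciOne h y ∧ h (inverseOnIciOne h y) = y) ∧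
      StrictMonoOn (inverseOnIciOne h) (Set.Ici 1) ∧ Tendsto (inverseOnIciOne h) atTop atTop ∧
      ∀ y, 1 < y → ContinuousAt (inverseOnIciOne h) y := by
  obtain ⟨τ, τ₁, τ₂, hcont, h1, hd, hpos, -, -⟩ := hh.exists_index hc
  have hmono := hh.2.1
  have hmaps := hh.1
  have hconv := hh.2.2.1
  set φ := inverseOnIciOne h with hφ
  have htop : Tendsto h atTop atTop := by
    have h2 : h 1 < h 2 := hmono (by simp) (by simp) (by norm_num)
    have h3 : Tendsto (fun x : ℝ => h 1 + (x - 1) * (h 2 - h 1)) atTop atTop := by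
      refine tendsto_atTop_add_const_left _ _ ?_
      refine Tendsto.atTop_mul_const (by linarith) ?_
      exact tendsto_atTop_add_const_right _ (-1) tendsto_id
    refine tendsto_atTop_mono' _ ?_ h3
    filter_upwards [eventually_gt_atTop 2] with x hx
    have h4 := hconv.2 (show (1 : ℝ) ∈ Set.Ici 1 by simp)
      (show x ∈ Set.Ici (1 : ℝ) from by simp; linarith)
      (show 0 ≤ 1 - 1 / (x - 1) by
        rw [sub_nonneg, div_le_one (by linarith)]; linarith)
      (show 0 ≤ 1 / (x - 1) by apply one_div_nonneg.mpr; linarith) (by ring)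
    have hx1 : x - 1 ≠ 0 := by linarith
    simp only [smul_eq_mul] at h4
    rw [show (1 - 1 / (x - 1)) * 1 + 1 / (x - 1) * x = 2 by field_simp; ring] at h4
    have h5 := mul_le_mul_of_nonneg_left h4 (show 0 ≤ x - 1 by linarith)
    have h6 : (x - 1) * ((1 - 1 / (x - 1)) * h 1 + 1 / (x - 1) * h x) =
        (x - 1) * h 1 - h 1 + h x := by field_simp
    linarith
  have hsurj : ∀ y, 1 ≤ y → ∃ x ∈ Set.Ici (1 : ℝ), h x = y := by
    intro y hy
    have := intermediate_value_Ici hcont htop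
    rw [h1] at this
    exact this hy
  have hspec : ∀ y, 1 ≤ y → 1 ≤ φ y ∧ h (φ y) = y := fun y hy =>
    ⟨Function.invFunOn_mem (hsurj y hy), Function.invFunOn_eq (hsurj y hy)⟩
  have hφmono : StrictMonoOn φ (Set.Ici 1) := by
    intro y hy z hz hyz
    by_contra hcon
    push Not at hcon
    have := hmono.monotoneOn (hspec z hz).1 (hspec y hy).1 hcon
    rw [(hspec z hz).2, (hspec y hy).2] at this
    linarith
  have hφsurj : ∀ x, 1 ≤ x → φ (h x) = x := by
    intro x hx
    exact hmono.injOn (hspec (h x) (hmaps hx)).1 hx (hspec (h x) (hmaps hx)).2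
  refine ⟨hspec, hφmono, ?_, ?_⟩
  · rw [tendsto_atTop]
    intro b
    filter_upwards [eventually_ge_atTop (h (max b 1))] with y hy
    have hb : (1 : ℝ) ≤ max b 1 := le_max_right _ _
    have h2 := hφmono.monotoneOn (hmaps hb) (le_trans (hmaps hb) hy : (1 : ℝ) ≤ y) hy
    rw [hφsurj _ hb] at h2
    exact (le_max_left _ _).trans h2
  · intro y hy
    refine hφmono.continuousAt_of_image_mem_nhds (Ici_mem_nhds hy) ?_
    have h2 : 1 < φ y := by
      have := hφmono (Set.mem_Ici.mpr le_rfl) (Set.mem_Ici.mpr hy.le) hy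
      exact lt_of_le_of_lt (hspec 1 le_rfl).1 this
    refine mem_of_superset (Ici_mem_nhds h2) ?_
    intro x hx
    exact ⟨h x, hmaps hx, hφsurj x hx⟩

open Filter Topology in
/-- The first three derivatives of the inverse of a member of `𝓡_c`, up to factors tending to
positive constants. -/
lemma InClassR.inverse_derivatives {c : ℝ} {h : ℝ → ℝ} (hc : 1 ≤ c) (hh : InClassR c h) :
    ∃ a b e T f₂ g₁ : ℝ → ℝ,
      Tendsto a atTop (𝓝 (1 / c)) ∧ Tendsto b atTop (𝓝 ((1 / c) ^ 2)) ∧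
      Tendsto e atTop (𝓝 ((1 / c) ^ 3)) ∧
      (∀ᶠ y in atTop, y ^ 2 * f₂ y = -(inverseOnIciOne h y * T y * b y)) ∧
      (∀ᶠ y in atTop, y * g₁ y = -(inverseOnIciOne h y * T y * e y)) ∧
      (∀ᶠ y in atTop, HasDerivAt (inverseOnIciOne h) (inverseOnIciOne h y * a y / y) y) ∧
      (∀ᶠ y in atTop, HasDerivAt (fun y => inverseOnIciOne h y * a y / y) (f₂ y) y) ∧
      (∀ᶠ y in atTop, HasDerivAt (fun y => y ^ 2 * f₂ y) (g₁ y) y) ∧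
      (∀ ε : ℝ, 0 < ε → ∀ᶠ y in atTop, T y ∈ Set.Icc (y ^ (-ε)) (y ^ ε)) := by
  obtain ⟨τ, τ₁, τ₂, -, -, hd, hpos, hlim, hd1, hd2, hl1, hl2⟩ := hh.exists_index hc
  obtain ⟨hspec, hφmono, hφtop, hφc⟩ := hh.inverse_spec hc
  have hmaps := hh.1
  set φ := inverseOnIciOne h with hφ
  have hc0 : c ≠ 0 := by positivity
  -- `T` is kept as a separate factor because it tends to `0` when `c = 1`: there `φ''` is of
  -- smaller order than `φ / y²`. The relation `y φ' = φ / (1 + T)` yields all the derivatives, with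
  -- `P`, `Q`, `S` negligible compared with `T`.
  set T : ℝ → ℝ := fun y => τ (φ y) with hT
  set α : ℝ → ℝ := fun y => 1 / (1 + T y) with hα
  set P : ℝ → ℝ := fun y => φ y * τ₁ (φ y) with hP
  set Q : ℝ → ℝ := fun y => φ y * τ₁ (φ y) + φ y ^ 2 * τ₂ (φ y) with hQ
  set S : ℝ → ℝ := fun y => P y * α y with hS
  have hTlim : Tendsto T atTop (𝓝 (c - 1)) := hlim.comp hφtop
  have hTpos : ∀ᶠ y in atTop, 0 < T y := hφtop.eventually hpos
  have hαlim : Tendsto α atTop (𝓝 (1 / c)) := by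
    have h1 : Tendsto (fun y => 1 + T y) atTop (𝓝 c) := by
      simpa using hTlim.const_add 1
    have := (tendsto_const_nhds (x := (1 : ℝ))).div h1 hc0
    exact this
  have hPT : Tendsto (fun y => P y / T y) atTop (𝓝 0) := hl1.comp hφtop
  have hQT : Tendsto (fun y => Q y / T y) atTop (𝓝 0) := by
    have := (hl1.comp hφtop).add (hl2.comp hφtop)
    rw [zero_add] at this
    refine this.congr fun y => ?_
    simp only [Function.comp, hQ, hT]
    ring
  have hST : Tendsto (fun y => S y / T y) atTop (𝓝 0) := by
    have := hPT.mul hαlim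
    rw [zero_mul] at this
    refine this.congr fun y => ?_
    simp only [hS]
    ring
  have hP0 : Tendsto P atTop (𝓝 0) := by
    have := hPT.mul hTlim
    rw [zero_mul] at this
    refine this.congr' ?_
    filter_upwards [hTpos] with y hy
    field_simp
  have hS0 : Tendsto S atTop (𝓝 0) := by
    have := hP0.mul hαlim
    rw [zero_mul] at this
    exact this
  have hgood : ∀ᶠ y in atTop, 0 < T y ∧ 1 < φ y ∧ 1 < y :=
    hTpos.and ((hφtop.eventually (eventually_gt_atTop 1)).and (eventually_gt_atTop 1))
  have hφd : ∀ y, (0 < T y ∧ 1 < φ y ∧ 1 < y) → HasDerivAt φ (φ y * α y / y) y := by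
    rintro y ⟨h1, h2, h3⟩
    have h4 := hd (φ y) h2
    rw [(hspec y h3.le).2] at h4
    have h5 : y * (1 + τ (φ y)) / φ y ≠ 0 := by
      have : 0 < 1 + τ (φ y) := by simp only [hT] at h1; linarith
      positivity
    have h6 := HasDerivAt.of_local_left_inverse (hφc y h3) h4 h5 (by
      filter_upwards [Ioi_mem_nhds h3] with z hz
      exact (hspec z (le_of_lt hz)).2)
    refine h6.congr_deriv ?_
    have h7 : 1 + τ (φ y) ≠ 0 := by simp only [hT] at h1; linarith
    simp only [hα, hT]
    field_simp
  have hTd : ∀ y, (0 < T y ∧ 1 < φ y ∧ 1 < y) → HasDerivAt T (S y / y) y := by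
    rintro y hy
    refine ((hd1 (φ y) hy.2.1).comp y (hφd y hy)).congr_deriv ?_
    simp only [hS, hP]
    ring
  have hPd : ∀ y, (0 < T y ∧ 1 < φ y ∧ 1 < y) → HasDerivAt P (Q y * α y / y) y := by
    rintro y hy
    refine ((hφd y hy).mul ((hd2 (φ y) hy.2.1).comp y (hφd y hy))).congr_deriv ?_
    simp only [hQ, Function.comp]
    ring
  have hαd : ∀ y, (0 < T y ∧ 1 < φ y ∧ 1 < y) → HasDerivAt α (-(α y ^ 2 * S y / y)) y := by
    rintro y hy
    have h1 : 1 + T y ≠ 0 := by linarith [hy.1]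
    have h2 := ((hTd y hy).const_add 1).inv h1
    simp only [hα, one_div]
    refine h2.congr_deriv ?_
    field_simp
  set f₂ : ℝ → ℝ := fun y => -(φ y * α y ^ 2 * (T y + S y) / y ^ 2) with hf₂
  -- Obtained by differentiating `y² φ'' = -φ α² (T + S)`; its leading term is `α³ T`.
  set E : ℝ → ℝ := fun y => α y ^ 2 * (α y * (T y + S y) - 2 * α y * S y * (T y + S y) + S y +
    α y ^ 2 * Q y - α y ^ 2 * P y * S y) with hE
  have hT1 : Tendsto (fun y => (T y + S y) / T y) atTop (𝓝 1) := by
    have h1 := hST.const_add 1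
    rw [add_zero] at h1
    refine h1.congr' ?_
    filter_upwards [hTpos] with y hy
    field_simp
  refine ⟨α, fun y => α y ^ 2 * ((T y + S y) / T y), fun y => E y / T y, T, f₂,
    fun y => -(φ y / y) * E y, hαlim, ?_, ?_, ?_, ?_, ?_, ?_, ?_, ?_⟩
  · simpa using (hαlim.pow 2).mul hT1
  · have h1 := (hαlim.pow 2).mul (((((hαlim.mul hT1).sub
      (((hαlim.const_mul 2).mul hS0).mul hT1)).add hST).add ((hαlim.pow 2).mul hQT)).sub
      (((hαlim.pow 2).mul hP0).mul hST))
    have h2 : (1 / c) ^ 2 * (1 / c * 1 - 2 * (1 / c) * 0 * 1 + 0 + (1 / c) ^ 2 * 0 -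
        (1 / c) ^ 2 * 0 * 0) = (1 / c) ^ 3 := by ring
    rw [h2] at h1
    refine h1.congr fun y => ?_
    simp only [hE]
    ring
  · filter_upwards [hgood] with y hy
    have h1 := hy.1
    have h2 : y ≠ 0 := by linarith [hy.2.2]
    simp only [hf₂]
    field_simp
  · filter_upwards [hgood] with y hy
    have h1 := hy.1
    have h2 : y ≠ 0 := by linarith [hy.2.2]
    field_simp
  · filter_upwards [hgood] with y hy using hφd y hy
  · filter_upwards [hgood] with y hy
    have h2 : y ≠ 0 := by linarith [hy.2.2]
    refine (((hφd y hy).mul (hαd y hy)).div (hasDerivAt_id y) h2).congr_deriv ?_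
    have h3 : α y * (1 + T y) = 1 := by
      have : 1 + T y ≠ 0 := by linarith [hy.1]
      simp only [hα]
      field_simp
    simp only [hf₂, id, Pi.mul_apply]
    field_simp
    linear_combination (φ y * α y) * h3
  · obtain ⟨y₀, hy₀⟩ := eventually_atTop.mp hgood
    filter_upwards [eventually_gt_atTop y₀] with y hyy
    have hy := hy₀ y hyy.le
    have hyn : ∀ᶠ z in 𝓝 y, 0 < T z ∧ 1 < φ z ∧ 1 < z := by
      filter_upwards [Ioi_mem_nhds hyy] with z hz using hy₀ z (le_of_lt hz)
    have h2 : y ≠ 0 := by linarith [hy.2.2]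
    have hSd : HasDerivAt S (Q y * α y / y * α y + P y * (-(α y ^ 2 * S y / y))) y :=
      (hPd y hy).mul (hαd y hy)
    have h3 := (((hφd y hy).mul ((hαd y hy).pow 2)).mul ((hTd y hy).add hSd)).neg
    refine (h3.congr_deriv ?_).congr_of_eventuallyEq ?_
    · simp only [hE, Pi.mul_apply, Pi.pow_apply, Pi.add_apply]
      field_simp
      ring
    · filter_upwards [hyn] with z hz
      have h4 : z ≠ 0 := by linarith [hz.2.2]
      simp only [hf₂, Pi.neg_apply, Pi.mul_apply, Pi.pow_apply, Pi.add_apply]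
      field_simp
  -- The logarithmic derivative satisfies `y T' / T = S / T → 0`, so `T = y ^ o(1)`.
  · intro ε hε
    have h1 := eventually_mem_Icc_rpow_of_log_deriv (f := T) (a := fun y => S y / T y) (κ := 0)
      hε hTpos (by
        filter_upwards [hgood] with y hy
        refine (hTd y hy).congr_deriv ?_
        have := hy.1
        field_simp) hST
    simpa using h1

/-- A phase whose second derivative is `-y ^ (γ - 2 + o(1))` and for which `(y² φ''(y))'` is
`-y ^ (γ - 1 + o(1))`. -/
structure RegularPhase (γ : ℝ) (φ f₁ f₂ g₁ : ℝ → ℝ) : Prop where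
  hasDerivAt : ∀ᶠ y in Filter.atTop, HasDerivAt φ (f₁ y) y
  hasDerivAt_deriv : ∀ᶠ y in Filter.atTop, HasDerivAt f₁ (f₂ y) y
  hasDerivAt_sq_mul : ∀ᶠ y in Filter.atTop, HasDerivAt (fun y => y ^ 2 * f₂ y) (g₁ y) y
  second_mem : ∀ ε : ℝ, 0 < ε →
    ∀ᶠ y in Filter.atTop, f₂ y ∈ Set.Icc (-y ^ (γ - 2 + ε)) (-y ^ (γ - 2 - ε))
  third_mem : ∀ ε : ℝ, 0 < ε →
    ∀ᶠ y in Filter.atTop, g₁ y ∈ Set.Icc (-y ^ (γ - 1 + ε)) (-y ^ (γ - 1 - ε))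

open Filter Topology in
lemma eventually_mem_Icc_of_mul {u v w : ℝ → ℝ} {κ ℓ : ℝ} (hℓ : 0 < ℓ)
    (hu : ∀ ε : ℝ, 0 < ε → ∀ᶠ y in atTop, u y ∈ Set.Icc (y ^ (κ - ε)) (y ^ (κ + ε)))
    (hv : ∀ ε : ℝ, 0 < ε → ∀ᶠ y in atTop, v y ∈ Set.Icc (y ^ (-ε)) (y ^ ε))
    (hw : Tendsto w atTop (𝓝 ℓ)) {ε : ℝ} (hε : 0 < ε) :
    ∀ᶠ y in atTop, u y * v y * w y ∈ Set.Icc (y ^ (κ - ε)) (y ^ (κ + ε)) := by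
  have h1 := (tendsto_rpow_neg_atTop (show 0 < ε / 3 by linarith)).eventually
    (gt_mem_nhds (show 0 < ℓ / 2 by linarith))
  have h2 := (tendsto_rpow_atTop (show 0 < ε / 3 by linarith)).eventually_gt_atTop (2 * ℓ)
  filter_upwards [hu (ε / 3) (by linarith), hv (ε / 3) (by linarith), h1, h2,
    hw.eventually (lt_mem_nhds (show ℓ / 2 < ℓ by linarith)),
    hw.eventually (gt_mem_nhds (show ℓ < 2 * ℓ by linarith)), eventually_gt_atTop 0] with
    y hu hv h1 h2 h3 h4 hy
  have e1 : y ^ (κ - ε) = y ^ (κ - ε / 3) * y ^ (-(ε / 3)) * y ^ (-(ε / 3)) := by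
    rw [← Real.rpow_add hy, ← Real.rpow_add hy]; congr 1; ring
  have e2 : y ^ (κ + ε) = y ^ (κ + ε / 3) * y ^ (ε / 3) * y ^ (ε / 3) := by
    rw [← Real.rpow_add hy, ← Real.rpow_add hy]; congr 1; ring
  have p1 := Real.rpow_pos_of_pos hy (κ - ε / 3)
  have p2 := Real.rpow_pos_of_pos hy (-(ε / 3))
  have hu0 : 0 < u y := p1.trans_le hu.1
  have hv0 : 0 < v y := p2.trans_le hv.1
  rw [e1, e2]
  constructor
  · exact mul_le_mul (mul_le_mul hu.1 hv.1 p2.le hu0.le) (h1.le.trans h3.le) p2.le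
      (mul_pos hu0 hv0).le
  · exact mul_le_mul (mul_le_mul hu.2 hv.2 hv0.le (hu0.le.trans hu.2)) (h4.le.trans h2.le)
      (by linarith) (mul_nonneg (hu0.le.trans hu.2) (hv0.le.trans hv.2))

open Filter Topology in
lemma InClassR.inverse_growth {c : ℝ} {h : ℝ → ℝ} (hc : 1 ≤ c) (hh : InClassR c h) (ε : ℝ)
    (hε : 0 < ε) : ∀ᶠ y in atTop,
      inverseOnIciOne h y ∈ Set.Icc (y ^ (1 / c - ε)) (y ^ (1 / c + ε)) := by
  obtain ⟨a, b, e, T, f₂, g₁, ha, hb, he, h2, h3, d1, d2, d3, hT⟩ := hh.inverse_derivatives hc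
  refine eventually_mem_Icc_rpow_of_log_deriv hε ?_ d1 ha
  exact (hh.inverse_spec hc).2.2.1.eventually (eventually_gt_atTop 0)

open Filter Topology in
lemma InClassR.exists_regularPhase {c : ℝ} {h : ℝ → ℝ} (hc : 1 ≤ c) (hh : InClassR c h) :
    ∃ f₁ f₂ g₁, RegularPhase (1 / c) (inverseOnIciOne h) f₁ f₂ g₁ := by
  obtain ⟨a, b, e, T, f₂, g₁, ha, hb, he, h2, h3, d1, d2, d3, hT⟩ := hh.inverse_derivatives hc
  have hc0 : 0 < 1 / c := by positivity
  refine ⟨_, f₂, g₁, d1, d2, d3, fun ε hε => ?_, fun ε hε => ?_⟩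
  · filter_upwards [eventually_mem_Icc_of_mul (pow_pos hc0 2) (hh.inverse_growth hc) hT hb hε, h2,
      eventually_gt_atTop 0] with y hy h2 hy0
    have e1 : y ^ (1 / c - 2 + ε) * y ^ 2 = y ^ (1 / c + ε) := by
      rw [← Real.rpow_natCast, ← Real.rpow_add hy0]; congr 1; push_cast; ring
    have e2 : y ^ (1 / c - 2 - ε) * y ^ 2 = y ^ (1 / c - ε) := by
      rw [← Real.rpow_natCast, ← Real.rpow_add hy0]; congr 1; push_cast; ring
    rw [← e1, ← e2] at hy
    have hy2 : 0 < y ^ 2 := by positivity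
    constructor
    · refine le_of_mul_le_mul_right ?_ hy2
      linarith [hy.2]
    · refine le_of_mul_le_mul_right ?_ hy2
      linarith [hy.1]
  · filter_upwards [eventually_mem_Icc_of_mul (pow_pos hc0 3) (hh.inverse_growth hc) hT he hε, h3,
      eventually_gt_atTop 0] with y hy h2 hy0
    have e1 : y ^ (1 / c - 1 + ε) * y = y ^ (1 / c + ε) := by
      rw [← Real.rpow_add_one hy0.ne']; congr 1; ring
    have e2 : y ^ (1 / c - 1 - ε) * y = y ^ (1 / c - ε) := by
      rw [← Real.rpow_add_one hy0.ne']; congr 1; ring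
    rw [← e1, ← e2] at hy
    constructor
    · refine le_of_mul_le_mul_right ?_ hy0
      linarith [hy.2]
    · refine le_of_mul_le_mul_right ?_ hy0
      linarith [hy.1]

/-! ### Bilinear exponential sums of Type I and Type II. -/

lemma norm_sum_addExp_mul_phase_le {φ f₁ f₂ : ℝ → ℝ} {N : ℕ} {A h m : ℝ} (hA : 0 < A) (hh : 1 ≤ h)
    (hm : 0 < m) (hd₁ : ∀ y ∈ Set.Icc (N : ℝ) (2 * N), HasDerivAt φ (f₁ y) y)
    (hd₂ : ∀ y ∈ Set.Icc (N : ℝ) (2 * N), HasDerivAt f₁ (f₂ y) y)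
    (h₂ : ∀ y ∈ Set.Icc (N : ℝ) (2 * N), f₂ y ∈ Set.Icc (-(h * A)) (-A))
    {k p q : ℕ} (hk : 1 ≤ k) (hpq : p ≤ q) (hp : N ≤ k * (p + 1)) (hq : k * q ≤ 2 * N) :
    ‖∑ l ∈ Finset.Ioc p q, addExp (m * φ ((k : ℝ) * l))‖ ≤
      14 * (h * ((q : ℝ) - p) * (m * k ^ 2 * A) + 1) * (1 / √(m * k ^ 2 * A) + 1) := by
  have hk0 : (0 : ℝ) < k := by exact_mod_cast hk
  have hmem : ∀ y ∈ Set.Icc (p + 1 : ℝ) q, (k : ℝ) * y ∈ Set.Icc (N : ℝ) (2 * N) := by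
    intro y hy
    have h1 : (N : ℝ) ≤ k * (p + 1) := by exact_mod_cast hp
    have h2 : (k : ℝ) * q ≤ 2 * N := by exact_mod_cast hq
    exact ⟨h1.trans (mul_le_mul_of_nonneg_left hy.1 hk0.le),
      (mul_le_mul_of_nonneg_left hy.2 hk0.le).trans h2⟩
  refine norm_sum_Ioc_addExp_le (f := fun y => m * φ (k * y)) (f' := fun y => m * (f₁ (k * y) * k))
    (f'' := fun y => m * (f₂ (k * y) * k * k)) hpq (by positivity) hh ?_ ?_ ?_
  · intro y hy
    have hid : HasDerivAt (fun y : ℝ => (k : ℝ) * y) k y := by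
      simpa using (hasDerivAt_id y).const_mul (k : ℝ)
    exact ((hd₁ _ (hmem y hy)).comp y hid).const_mul m
  · intro y hy
    have hid : HasDerivAt (fun y : ℝ => (k : ℝ) * y) k y := by
      simpa using (hasDerivAt_id y).const_mul (k : ℝ)
    exact (((hd₂ _ (hmem y hy)).comp y hid).mul_const (k : ℝ)).const_mul m
  · intro y hy
    have h3 := h₂ _ (hmem y hy)
    have h4 : 0 < m * k * k := by positivity
    constructor
    · have := mul_le_mul_of_nonneg_left h3.1 h4.le
      linarith
    · have := mul_le_mul_of_nonneg_left h3.2 h4.le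
      linarith

/-- The second derivative in `k` is `m / k²` times the increment of `Y ↦ Y² φ''(Y)` between `k l₂`
and `k l₁`, so by the mean value theorem it equals `m (l₁ - l₂) / k · g₁(k ξ)`. This is why the
phase must control `(y² φ'')'` and not only `φ''`. -/
lemma norm_sum_addExp_phase_sub_le {φ f₁ f₂ g₁ : ℝ → ℝ} {N : ℕ} {B h m : ℝ} (hB : 0 < B)
    (hh : 1 ≤ h) (hm : 0 < m) (hN : 1 ≤ N)
    (hd₁ : ∀ y ∈ Set.Icc (N : ℝ) (2 * N), HasDerivAt φ (f₁ y) y)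
    (hd₂ : ∀ y ∈ Set.Icc (N : ℝ) (2 * N), HasDerivAt f₁ (f₂ y) y)
    (hd₃ : ∀ y ∈ Set.Icc (N : ℝ) (2 * N), HasDerivAt (fun y => y ^ 2 * f₂ y) (g₁ y) y)
    (h₃ : ∀ y ∈ Set.Icc (N : ℝ) (2 * N), g₁ y ∈ Set.Icc (-(h * B)) (-B))
    {l₀ l₁ l₂ p q : ℕ} (hl₀ : 1 ≤ l₀) (h02 : l₀ ≤ l₂) (h21 : l₂ < l₁) (h10 : l₁ ≤ 2 * l₀)
    (hpq : p ≤ q) (hp : N ≤ (p + 1) * l₂) (hq : q * l₁ ≤ 2 * N) :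
    ‖∑ k ∈ Finset.Ioc p q, addExp (m * φ ((k : ℝ) * l₁) - m * φ ((k : ℝ) * l₂))‖ ≤
      14 * (4 * h * ((q : ℝ) - p) * (m * ((l₁ : ℝ) - l₂) * l₀ * B / (2 * N)) + 1) *
        (1 / √(m * ((l₁ : ℝ) - l₂) * l₀ * B / (2 * N)) + 1) := by
  have hN0 : (0 : ℝ) < N := by exact_mod_cast hN
  have hl₀' : (0 : ℝ) < l₀ := by exact_mod_cast hl₀
  have h02' : (l₀ : ℝ) ≤ l₂ := by exact_mod_cast h02
  have h21' : (l₂ : ℝ) < l₁ := by exact_mod_cast h21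
  have h10' : (l₁ : ℝ) ≤ 2 * l₀ := by exact_mod_cast h10
  have hp' : (N : ℝ) ≤ (p + 1) * l₂ := by exact_mod_cast hp
  have hq' : (q : ℝ) * l₁ ≤ 2 * N := by exact_mod_cast hq
  have hl₂ : (0 : ℝ) < l₂ := by linarith
  have hl₁ : (0 : ℝ) < l₁ := by linarith
  have hd : 0 < (l₁ : ℝ) - l₂ := by linarith
  have hp1 : (0 : ℝ) < p + 1 := by positivity
  have hmem : ∀ y ∈ Set.Icc (p + 1 : ℝ) q, ∀ l ∈ Set.Icc (l₂ : ℝ) l₁,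
      y * l ∈ Set.Icc (N : ℝ) (2 * N) := by
    intro y hy l hl
    have hy0 : 0 < y := lt_of_lt_of_le hp1 hy.1
    exact ⟨hp'.trans (mul_le_mul hy.1 hl.1 hl₂.le hy0.le),
      (mul_le_mul hy.2 hl.2 (hl₂.le.trans hl.1) (Nat.cast_nonneg q)).trans hq'⟩
  have hm2 : (l₂ : ℝ) ∈ Set.Icc (l₂ : ℝ) l₁ := ⟨le_rfl, h21'.le⟩
  have hm1 : (l₁ : ℝ) ∈ Set.Icc (l₂ : ℝ) l₁ := ⟨h21'.le, le_rfl⟩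
  have hid : ∀ l y : ℝ, HasDerivAt (fun y : ℝ => y * l) l y := fun l y => by
    simpa using (hasDerivAt_id y).mul_const l
  refine norm_sum_Ioc_addExp_le (f := fun y => m * φ (y * l₁) - m * φ (y * l₂))
    (f' := fun y => m * (f₁ (y * l₁) * l₁) - m * (f₁ (y * l₂) * l₂))
    (f'' := fun y => m * (f₂ (y * l₁) * l₁ * l₁) - m * (f₂ (y * l₂) * l₂ * l₂))
    hpq (by positivity) (by linarith) ?_ ?_ ?_
  · intro y hy
    exact (((hd₁ _ (hmem y hy _ hm1)).comp y (hid l₁ y)).const_mul m).sub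
      (((hd₁ _ (hmem y hy _ hm2)).comp y (hid l₂ y)).const_mul m)
  · intro y hy
    exact ((((hd₂ _ (hmem y hy _ hm1)).comp y (hid l₁ y)).mul_const (l₁ : ℝ)).const_mul m).sub
      ((((hd₂ _ (hmem y hy _ hm2)).comp y (hid l₂ y)).mul_const (l₂ : ℝ)).const_mul m)
  · intro y hy
    have hy0 : 0 < y := lt_of_lt_of_le hp1 hy.1
    obtain ⟨ξ, hξ, h1⟩ := exists_hasDerivAt_eq_slope (fun l : ℝ => (y * l) ^ 2 * f₂ (y * l))
      (fun l => g₁ (y * l) * y) h21'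
      (fun l hl => by
        have hid' : HasDerivAt (fun l : ℝ => y * l) y l := by
          simpa using (hasDerivAt_id l).const_mul y
        exact ((hd₃ _ (hmem y hy _ hl)).comp l hid').continuousAt.continuousWithinAt)
      (fun l hl => by
        have hid' : HasDerivAt (fun l : ℝ => y * l) y l := by
          simpa using (hasDerivAt_id l).const_mul y
        exact (hd₃ _ (hmem y hy _ (Set.Ioo_subset_Icc_self hl))).comp l hid')
    have h2 : m * (f₂ (y * l₁) * l₁ * l₁) - m * (f₂ (y * l₂) * l₂ * l₂) =
        m * ((l₁ : ℝ) - l₂) / y * g₁ (y * ξ) := by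
      rw [eq_div_iff hd.ne'] at h1
      have h2 : g₁ (y * ξ) * (l₁ - l₂) =
          y * (l₁ ^ 2 * f₂ (y * l₁) - l₂ ^ 2 * f₂ (y * l₂)) :=
        mul_left_cancel₀ hy0.ne' (by linear_combination h1)
      field_simp
      linear_combination -h2
    have h3 := h₃ _ (hmem y hy _ (Set.Ioo_subset_Icc_self hξ))
    rw [h2]
    have hc : 0 < m * ((l₁ : ℝ) - l₂) := by positivity
    -- From `y l₁ ≤ 2N`, `y l₂ ≥ N` and `l₀ ≤ l₂ < l₁ ≤ 2 l₀`, the factor `1 / y` is known up to a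
    -- factor `4`, whence the ratio `4 h`.
    have hlow : l₀ / (2 * N : ℝ) ≤ 1 / y := by
      rw [div_le_div_iff₀ (by positivity) hy0]
      have := (hmem y hy _ hm1).2
      nlinarith
    have hupp : 1 / y ≤ 4 * (l₀ / (2 * N : ℝ)) := by
      have := (hmem y hy _ hm2).1
      rw [← mul_div_assoc, div_le_div_iff₀ hy0 (by positivity)]
      nlinarith
    have e0 : m * ((l₁ : ℝ) - l₂) / y * g₁ (y * ξ) =
        -(m * ((l₁ : ℝ) - l₂) * ((1 / y) * -g₁ (y * ξ))) := by ring
    have e1 : m * ((l₁ : ℝ) - l₂) * l₀ * B / (2 * N) =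
        m * ((l₁ : ℝ) - l₂) * (l₀ / (2 * N) * B) := by ring
    have e2 : 4 * h * (m * ((l₁ : ℝ) - l₂) * l₀ * B / (2 * N)) =
        m * ((l₁ : ℝ) - l₂) * (4 * (l₀ / (2 * N)) * (h * B)) := by ring
    rw [e2, e1, e0]
    constructor
    · refine neg_le_neg (mul_le_mul_of_nonneg_left ?_ hc.le)
      exact mul_le_mul hupp (by linarith [h3.1]) (by linarith [h3.2]) (by positivity)
    · refine neg_le_neg (mul_le_mul_of_nonneg_left ?_ hc.le)
      exact mul_le_mul hlow (by linarith [h3.2]) hB.le (by positivity)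

/-- Cauchy's inequality for a bilinear form, with the square expanded. -/
lemma norm_bilinear_sq_le (s t : Finset ℕ) {α β : ℕ → ℂ} {A B : ℝ}
    (hα : ∀ k ∈ t, ‖α k‖ ≤ A) (hβ : ∀ l ∈ s, ‖β l‖ ≤ B) (z : ℕ → ℕ → ℂ) :
    ‖∑ l ∈ s, ∑ k ∈ t, β l * α k * z k l‖ ^ 2 ≤
      A ^ 2 * t.card * (B ^ 2 * ∑ l₁ ∈ s, ∑ l₂ ∈ s,
        ‖∑ k ∈ t, z k l₁ * (starRingEnd ℂ) (z k l₂)‖) := by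
  rw [Finset.sum_comm]
  have h1 : ‖∑ k ∈ t, ∑ l ∈ s, β l * α k * z k l‖ ≤ ∑ k ∈ t, ‖α k‖ * ‖∑ l ∈ s, β l * z k l‖ := by
    refine norm_sum_le_of_le _ fun k _ => ?_
    rw [← norm_mul, Finset.mul_sum]
    refine le_of_eq ?_
    congr 1
    exact Finset.sum_congr rfl fun l _ => by ring
  have h2 : ∑ k ∈ t, ‖α k‖ ^ 2 ≤ A ^ 2 * t.card := by
    rw [mul_comm, ← nsmul_eq_mul]
    exact Finset.sum_le_card_nsmul _ _ _ fun k hk => pow_le_pow_left₀ (norm_nonneg _) (hα k hk) 2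
  have h3 : ∑ k ∈ t, ‖∑ l ∈ s, β l * z k l‖ ^ 2 ≤ B ^ 2 * ∑ l₁ ∈ s, ∑ l₂ ∈ s,
        ‖∑ k ∈ t, z k l₁ * (starRingEnd ℂ) (z k l₂)‖ := by
    have h4 : ((∑ k ∈ t, ‖∑ l ∈ s, β l * z k l‖ ^ 2 : ℝ) : ℂ) =
        ∑ l₁ ∈ s, ∑ l₂ ∈ s, β l₁ * (starRingEnd ℂ) (β l₂) *
          ∑ k ∈ t, z k l₁ * (starRingEnd ℂ) (z k l₂) := by
      push_cast
      simp_rw [← Complex.mul_conj', map_sum, Finset.sum_mul_sum, map_mul]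
      rw [Finset.sum_comm]
      refine Finset.sum_congr rfl fun l₁ _ => ?_
      rw [Finset.sum_comm]
      refine Finset.sum_congr rfl fun l₂ _ => ?_
      rw [Finset.mul_sum]
      exact Finset.sum_congr rfl fun k _ => by ring
    have h5 : ∑ k ∈ t, ‖∑ l ∈ s, β l * z k l‖ ^ 2 =
        ‖((∑ k ∈ t, ‖∑ l ∈ s, β l * z k l‖ ^ 2 : ℝ) : ℂ)‖ := by
      rw [Complex.norm_real, Real.norm_of_nonneg (Finset.sum_nonneg fun _ _ => by positivity)]
    rw [h5, h4, Finset.mul_sum]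
    refine norm_sum_le_of_le _ fun l₁ hl₁ => ?_
    rw [Finset.mul_sum]
    refine norm_sum_le_of_le _ fun l₂ hl₂ => ?_
    rw [norm_mul, norm_mul, Complex.norm_conj, pow_two]
    refine mul_le_mul_of_nonneg_right ?_ (norm_nonneg _)
    exact mul_le_mul (hβ l₁ hl₁) (hβ l₂ hl₂) (norm_nonneg _) ((norm_nonneg _).trans (hβ l₁ hl₁))
  calc ‖∑ k ∈ t, ∑ l ∈ s, β l * α k * z k l‖ ^ 2
      ≤ (∑ k ∈ t, ‖α k‖ * ‖∑ l ∈ s, β l * z k l‖) ^ 2 := pow_le_pow_left₀ (norm_nonneg _) h1 2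
    _ ≤ (∑ k ∈ t, ‖α k‖ ^ 2) * ∑ k ∈ t, ‖∑ l ∈ s, β l * z k l‖ ^ 2 :=
        Finset.sum_mul_sq_le_sq_mul_sq _ _ _
    _ ≤ _ := mul_le_mul h2 h3 (Finset.sum_nonneg fun _ _ => by positivity) (by positivity)

lemma card_filter_dist_lt_le (s : Finset ℕ) (l H : ℕ) (hH : 1 ≤ H) :
    (s.filter (fun l' => l < l' + H ∧ l' < l + H)).card ≤ 2 * H := by
  have h1 : s.filter (fun l' => l < l' + H ∧ l' < l + H) ⊆ Finset.Ico (l + 1 - H) (l + H) := by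
    intro x hx
    rw [Finset.mem_filter] at hx
    rw [Finset.mem_Ico]
    omega
  refine (Finset.card_le_card h1).trans ?_
  rw [Nat.card_Ico]
  omega

/-- Since `lam ≤ 1`, the last factor is at most `2 / √lam`, and the product becomes `2 h K √lam + 2
/ √lam`. The first term is worst at `hi`, the second at `lo`. -/
lemma vdc_factor_le {h K lam lo hi : ℝ} (hh : 1 ≤ h) (hK : 0 ≤ K) (hlo : 0 < lo) (h1 : lo ≤ lam)
    (h2 : lam ≤ hi) (h3 : hi ≤ 1) :
    (h * K * lam + 1) * (1 / √lam + 1) ≤ 2 * h * K * √hi + 2 / √lo := by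
  have hlam : 0 < lam := hlo.trans_le h1
  have hs : 0 < √lam := Real.sqrt_pos.mpr hlam
  have hs1 : √lam ≤ 1 := Real.sqrt_le_one.mpr (h2.trans h3)
  have h4 : 1 ≤ 1 / √lam := by rw [le_div_iff₀ hs]; linarith
  have h5 : 0 ≤ h * K * lam := by positivity
  have h6 : (h * K * lam + 1) * (1 / √lam + 1) ≤ (h * K * lam + 1) * (2 / √lam) := by
    refine mul_le_mul_of_nonneg_left ?_ (by linarith)
    have : 2 / √lam = 1 / √lam + 1 / √lam := by ring
    linarith
  have h7 : (h * K * lam + 1) * (2 / √lam) = 2 * h * K * √lam + 2 / √lam := by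
    have : lam = √lam * √lam := (Real.mul_self_sqrt hlam.le).symm
    have h8 : h * K * lam * (2 / √lam) = 2 * h * K * √lam := by
      nth_rewrite 1 [this]
      field_simp
    rw [add_mul, h8, one_mul]
  rw [h7] at h6
  refine h6.trans (add_le_add ?_ ?_)
  · exact mul_le_mul_of_nonneg_left (Real.sqrt_le_sqrt h2) (by positivity)
  · exact div_le_div_of_nonneg_left (by norm_num) (Real.sqrt_pos.mpr hlo) (Real.sqrt_le_sqrt h1)

/-- The bilinear sum over a short block of the outer variable. -/
lemma norm_block_sum_sq_le {φ f₁ f₂ g₁ : ℝ → ℝ} {N : ℕ} {B h m : ℝ} (hB : 0 < B)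
    (hh : 1 ≤ h) (hm : 0 < m) (hN : 1 ≤ N)
    (hd₁ : ∀ y ∈ Set.Icc (N : ℝ) (2 * N), HasDerivAt φ (f₁ y) y)
    (hd₂ : ∀ y ∈ Set.Icc (N : ℝ) (2 * N), HasDerivAt f₁ (f₂ y) y)
    (hd₃ : ∀ y ∈ Set.Icc (N : ℝ) (2 * N), HasDerivAt (fun y => y ^ 2 * f₂ y) (g₁ y) y)
    (h₃ : ∀ y ∈ Set.Icc (N : ℝ) (2 * N), g₁ y ∈ Set.Icc (-(h * B)) (-B))
    {N' l₀ R H : ℕ} (hN' : N' ≤ 2 * N) (hR : 1 ≤ R) (hH : 1 ≤ H) (hRl : R ≤ l₀)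
    (hlam : m * R * l₀ * B / (2 * N) ≤ 1) {α β : ℕ → ℂ} {A D : ℝ}
    (hα : ∀ k ∈ Finset.Ioc 0 (2 * N), ‖α k‖ ≤ A) (hβ : ∀ l, ‖β l‖ ≤ D) :
    ‖∑ l ∈ Finset.Ioc l₀ (l₀ + R), ∑ k ∈ Finset.Ioc (N / l) (N' / l),
      β l * α k * addExp (m * φ ((k : ℝ) * l))‖ ^ 2 ≤
    A ^ 2 * (2 * N / l₀) * (D ^ 2 * (R * (2 * H * (2 * N / l₀)) + R ^ 2 *
      (14 * (2 * (4 * h) * (2 * N / l₀) * √(m * R * l₀ * B / (2 * N)) +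
        2 / √(m * H * l₀ * B / (2 * N)))))) := by
  have hl₀ : 1 ≤ l₀ := hR.trans hRl
  have hl₀' : (0 : ℝ) < l₀ := by exact_mod_cast hl₀
  have hN0 : (0 : ℝ) < N := by exact_mod_cast hN
  have hR0 : (0 : ℝ) < R := by exact_mod_cast hR
  have hH0 : (0 : ℝ) < H := by exact_mod_cast hH
  set K : ℝ := 2 * N / l₀ with hK
  have hK0 : 0 < K := by positivity
  set M : ℝ := 14 * (2 * (4 * h) * K * √(m * R * l₀ * B / (2 * N)) +
        2 / √(m * H * l₀ * B / (2 * N))) with hM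
  have hM0 : 0 ≤ M := by positivity
  set s := Finset.Ioc l₀ (l₀ + R) with hs
  set t := Finset.Ioc 0 (2 * N / l₀) with ht
  -- Moving the cutoff into `z` makes the range of `k` independent of `l`, so Cauchy's inequality
  -- applies. For a pair `l₂ < l₁` the two cutoffs leave the interval `(N / l₂, N' / l₁]`; pairs
  -- closer than `H` are bounded trivially by `K`.
  set z : ℕ → ℕ → ℂ := fun k l =>
    if k ∈ Finset.Ioc (N / l) (N' / l) then addExp (m * φ ((k : ℝ) * l)) else 0 with hz
  have hqt : ∀ l ∈ s, N' / l ≤ 2 * N / l₀ := by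
    intro l hl
    rw [hs, Finset.mem_Ioc] at hl
    exact (Nat.div_le_div_right hN').trans (Nat.div_le_div_left hl.1.le hl₀)
  have htcard : (t.card : ℝ) ≤ K := by
    rw [ht, Nat.card_Ioc, Nat.sub_zero, hK]
    have := Nat.cast_div_le (α := ℝ) (m := 2 * N) (n := l₀)
    push_cast at this
    exact this
  have hsum : ∑ l ∈ s, ∑ k ∈ Finset.Ioc (N / l) (N' / l),
      β l * α k * addExp (m * φ ((k : ℝ) * l)) = ∑ l ∈ s, ∑ k ∈ t, β l * α k * z k l := by
    refine Finset.sum_congr rfl fun l hl => ?_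
    have hsub : Finset.Ioc (N / l) (N' / l) ⊆ t := by
      intro k hk
      rw [Finset.mem_Ioc] at hk
      rw [ht, Finset.mem_Ioc]
      exact ⟨lt_of_le_of_lt (Nat.zero_le _) hk.1, hk.2.trans (hqt l hl)⟩
    rw [← Finset.sum_subset hsub]
    · refine Finset.sum_congr rfl fun k hk => ?_
      simp only [hz, if_pos hk]
    · intro k _ hk
      simp only [hz, if_neg hk, mul_zero]
  have hsc : (s.card : ℝ) = R := by rw [hs, Nat.card_Ioc]; simp
  have hz1 : ∀ k l, ‖z k l‖ ≤ 1 := by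
    intro k l
    simp only [hz]
    split_ifs
    · exact (norm_addExp _).le
    · simp
  have htriv : ∀ l₁ l₂, ‖∑ k ∈ t, z k l₁ * (starRingEnd ℂ) (z k l₂)‖ ≤ K := by
    intro l₁ l₂
    refine (norm_sum_le_of_le (n := fun _ => 1) _ fun k _ => ?_).trans ?_
    · rw [norm_mul, Complex.norm_conj]
      exact mul_le_one₀ (hz1 _ _) (norm_nonneg _) (hz1 _ _)
    · simpa using htcard
  have hfar0 : ∀ l₁ ∈ s, ∀ l₂ ∈ s, l₂ + H ≤ l₁ →
      ‖∑ k ∈ t, z k l₁ * (starRingEnd ℂ) (z k l₂)‖ ≤ M := by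
    intro l₁ hl₁ l₂ hl₂ hfar
    have hl₁' := hl₁
    have hl₂' := hl₂
    rw [hs, Finset.mem_Ioc] at hl₁' hl₂'
    have h1 : ∑ k ∈ t, z k l₁ * (starRingEnd ℂ) (z k l₂) =
        ∑ k ∈ Finset.Ioc (N / l₂) (N' / l₁),
          addExp (m * φ ((k : ℝ) * l₁) - m * φ ((k : ℝ) * l₂)) := by
      have hsub : Finset.Ioc (N / l₂) (N' / l₁) ⊆ t := by
        intro k hk
        rw [Finset.mem_Ioc] at hk
        rw [ht, Finset.mem_Ioc]
        exact ⟨lt_of_le_of_lt (Nat.zero_le _) hk.1, hk.2.trans (hqt l₁ hl₁)⟩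
      have e1 : N / l₁ ≤ N / l₂ := Nat.div_le_div_left (by omega) (by omega)
      have e2 : N' / l₁ ≤ N' / l₂ := Nat.div_le_div_left (by omega) (by omega)
      rw [← Finset.sum_subset hsub]
      · refine Finset.sum_congr rfl fun k hk => ?_
        rw [Finset.mem_Ioc] at hk
        simp only [hz]
        rw [if_pos (Finset.mem_Ioc.mpr ⟨by omega, by omega⟩),
          if_pos (Finset.mem_Ioc.mpr ⟨by omega, by omega⟩), addExp_sub]
      · intro k _ hk
        simp only [hz]
        by_cases c1 : k ∈ Finset.Ioc (N / l₁) (N' / l₁)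
        · rw [Finset.mem_Ioc] at hk c1
          rw [if_neg (c := k ∈ Finset.Ioc (N / l₂) (N' / l₂))]
          · simp
          · rw [Finset.mem_Ioc]; omega
        · rw [if_neg c1, zero_mul]
    rw [h1]
    rcases Nat.lt_or_ge (N' / l₁) (N / l₂) with hlt | hge
    · rw [Finset.Ioc_eq_empty (by omega)]
      simpa using hM0
    have hp : N ≤ (N / l₂ + 1) * l₂ := by
      have := Nat.div_add_mod N l₂
      have := Nat.mod_lt N (show l₂ > 0 by omega)
      nlinarith
    have hq : N' / l₁ * l₁ ≤ 2 * N := (Nat.div_mul_le_self _ _).trans hN'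
    have h2 := norm_sum_addExp_phase_sub_le hB hh hm hN hd₁ hd₂ hd₃ h₃ hl₀ hl₂'.1.le
      (by omega : l₂ < l₁) (by omega) hge hp hq
    have hl12 : (l₂ : ℝ) + H ≤ l₁ := by exact_mod_cast hfar
    have hl12' : (l₁ : ℝ) ≤ l₀ + R := by exact_mod_cast hl₁'.2
    have hl2' : (l₀ : ℝ) ≤ l₂ := by exact_mod_cast hl₂'.1.le
    set lam := m * ((l₁ : ℝ) - l₂) * l₀ * B / (2 * N) with hlamdef
    have b1 : m * H * l₀ * B / (2 * N) ≤ lam := by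
      rw [hlamdef]
      gcongr
      linarith
    have b2 : lam ≤ m * R * l₀ * B / (2 * N) := by
      rw [hlamdef]
      gcongr
      linarith
    have b3 := vdc_factor_le (h := 4 * h) (K := K) (by linarith) hK0.le
      (show 0 < m * H * l₀ * B / (2 * N) by positivity) b1 b2 hlam
    have hqK : ((N' / l₁ : ℕ) : ℝ) - ((N / l₂ : ℕ) : ℝ) ≤ K := by
      have e1 : N' / l₁ ≤ 2 * N / l₀ := hqt l₁ hl₁
      have e2 : ((N' / l₁ : ℕ) : ℝ) ≤ ((2 * N / l₀ : ℕ) : ℝ) := by exact_mod_cast e1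
      have e3 := Nat.cast_div_le (α := ℝ) (m := 2 * N) (n := l₀)
      push_cast at e3
      have e4 : (0 : ℝ) ≤ ((N / l₂ : ℕ) : ℝ) := Nat.cast_nonneg _
      rw [hK]
      linarith
    have hlam0 : 0 < lam := lt_of_lt_of_le (by positivity) b1
    refine h2.trans ?_
    rw [mul_assoc, hM]
    refine mul_le_mul_of_nonneg_left (le_trans ?_ b3) (by norm_num)
    gcongr
  have hfar : ∀ l₁ ∈ s, ∀ l₂ ∈ s, ¬ (l₁ < l₂ + H ∧ l₂ < l₁ + H) →
      ‖∑ k ∈ t, z k l₁ * (starRingEnd ℂ) (z k l₂)‖ ≤ M := by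
    intro l₁ hl₁ l₂ hl₂ hn
    by_cases hc : l₂ + H ≤ l₁
    · exact hfar0 l₁ hl₁ l₂ hl₂ hc
    · have h1 := hfar0 l₂ hl₂ l₁ hl₁ (by omega)
      rw [← Complex.norm_conj] at h1
      simpa [map_sum, mul_comm] using h1
  have hinner : ∀ l₁ ∈ s, ∑ l₂ ∈ s, ‖∑ k ∈ t, z k l₁ * (starRingEnd ℂ) (z k l₂)‖ ≤
      2 * H * K + R * M := by
    intro l₁ hl₁
    rw [← Finset.sum_filter_add_sum_filter_not s (fun l₂ => l₁ < l₂ + H ∧ l₂ < l₁ + H)]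
    refine add_le_add ?_ ?_
    · refine (Finset.sum_le_card_nsmul _ _ _ fun l₂ _ => htriv l₁ l₂).trans ?_
      rw [nsmul_eq_mul]
      refine mul_le_mul_of_nonneg_right ?_ hK0.le
      exact_mod_cast card_filter_dist_lt_le s l₁ H hH
    · refine (Finset.sum_le_card_nsmul _ _ M fun l₂ hl₂ => ?_).trans ?_
      · rw [Finset.mem_filter] at hl₂
        exact hfar l₁ hl₁ l₂ hl₂.1 hl₂.2
      · rw [nsmul_eq_mul, ← hsc]
        refine mul_le_mul_of_nonneg_right ?_ hM0
        exact_mod_cast Finset.card_filter_le _ _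
  rw [hsum]
  have hαt : ∀ k ∈ t, ‖α k‖ ≤ A := by
    intro k hk
    rw [ht, Finset.mem_Ioc] at hk
    exact hα k (Finset.mem_Ioc.mpr ⟨hk.1, hk.2.trans (Nat.div_le_self _ _)⟩)
  refine (norm_bilinear_sq_le s t hαt (fun l _ => hβ l) z).trans ?_
  have hfin : ∑ l₁ ∈ s, ∑ l₂ ∈ s, ‖∑ k ∈ t, z k l₁ * (starRingEnd ℂ) (z k l₂)‖ ≤
      R * (2 * H * K) + R ^ 2 * M := by
    refine (Finset.sum_le_card_nsmul _ _ _ hinner).trans (le_of_eq ?_)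
    rw [nsmul_eq_mul, hsc]
    ring
  gcongr

lemma sum_Ioc_mul_eq_sum_blocks (R J : ℕ) (F : ℕ → ℂ) :
    ∑ l ∈ Finset.Ioc R ((J + 1) * R), F l =
      ∑ j ∈ Finset.Ioc 0 J, ∑ l ∈ Finset.Ioc (j * R) (j * R + R), F l := by
  induction J with
  | zero => simp
  | succ J ih =>
    rw [Finset.sum_Ioc_succ_top (Nat.zero_le J), ← ih,
      ← Finset.sum_Ioc_consecutive F (show R ≤ (J + 1) * R by nlinarith)
        (show (J + 1) * R ≤ (J + 1 + 1) * R by nlinarith)]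
    congr 2
    ring_nf

/-- Type II sums: the outer variable runs over `(V, Y]`. -/
lemma norm_typeII_sum_le {φ f₁ f₂ g₁ : ℝ → ℝ} {N : ℕ} {B h m : ℝ} (hB : 0 < B)
    (hh : 1 ≤ h) (hm : 0 < m) (hN : 1 ≤ N)
    (hd₁ : ∀ y ∈ Set.Icc (N : ℝ) (2 * N), HasDerivAt φ (f₁ y) y)
    (hd₂ : ∀ y ∈ Set.Icc (N : ℝ) (2 * N), HasDerivAt f₁ (f₂ y) y)
    (hd₃ : ∀ y ∈ Set.Icc (N : ℝ) (2 * N), HasDerivAt (fun y => y ^ 2 * f₂ y) (g₁ y) y)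
    (h₃ : ∀ y ∈ Set.Icc (N : ℝ) (2 * N), g₁ y ∈ Set.Icc (-(h * B)) (-B))
    {N' V Y R H : ℕ} (hN' : N' ≤ 2 * N) (hR : 1 ≤ R) (hH : 1 ≤ H) (hRV : R ≤ V) (hVY : V ≤ Y)
    (hlam : m * R * Y * B / (2 * N) ≤ 1) {α β : ℕ → ℂ} {A D : ℝ} (hA : 0 ≤ A) (hD : 0 ≤ D)
    (hα : ∀ k ∈ Finset.Ioc 0 (2 * N), ‖α k‖ ≤ A) (hβ : ∀ l ∈ Finset.Ioc V Y, ‖β l‖ ≤ D) :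
    ‖∑ l ∈ Finset.Ioc V Y, ∑ k ∈ Finset.Ioc (N / l) (N' / l),
      β l * α k * addExp (m * φ ((k : ℝ) * l))‖ ≤
    2 * N * (A * D) * √(2 * H / R + 14 * (8 * h * √(m * R * Y * B / (2 * N)) +
      √(2 * Y / (N * m * H * B)))) * (1 + Real.log Y) := by
  have hY : 1 ≤ Y := hR.trans (hRV.trans hVY)
  have hN0 : (0 : ℝ) < N := by exact_mod_cast hN
  have hR0 : (0 : ℝ) < R := by exact_mod_cast hR
  have hH0 : (0 : ℝ) < H := by exact_mod_cast hH
  have hY0 : (0 : ℝ) < Y := by exact_mod_cast hY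
  set δ := √(2 * H / R + 14 * (8 * h * √(m * R * Y * B / (2 * N)) +
      √(2 * Y / (N * m * H * B)))) with hδ
  -- Extension by zero lets full blocks of length `R` overrun `(V, Y]` at both ends.
  set β' : ℕ → ℂ := fun l => if l ∈ Finset.Ioc V Y then β l else 0 with hβ'
  have hβ'D : ∀ l, ‖β' l‖ ≤ D := by
    intro l
    simp only [hβ']
    split_ifs with hl
    · exact hβ l hl
    · simpa using hD
  set F : ℕ → ℂ := fun l => ∑ k ∈ Finset.Ioc (N / l) (N' / l),
      β' l * α k * addExp (m * φ ((k : ℝ) * l)) with hF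
  set J := Y / R with hJ
  have hYJ : Y ≤ (J + 1) * R := by
    have := Nat.div_add_mod Y R
    have := Nat.mod_lt Y (show R > 0 by omega)
    rw [hJ]
    nlinarith
  have h1 : ∑ l ∈ Finset.Ioc V Y, ∑ k ∈ Finset.Ioc (N / l) (N' / l),
      β l * α k * addExp (m * φ ((k : ℝ) * l)) = ∑ l ∈ Finset.Ioc R ((J + 1) * R), F l := by
    rw [← Finset.sum_subset (Finset.Ioc_subset_Ioc hRV hYJ)]
    · refine Finset.sum_congr rfl fun l hl => ?_
      simp only [hF, hβ', if_pos hl]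
    · intro l _ hl
      simp only [hF, hβ', if_neg hl, zero_mul, Finset.sum_const_zero]
  -- Blocks start at `j = 1`, which is possible because `R ≤ V` and guarantees `R ≤ l₀ = j R`. A
  -- block has `K R = 2N / j`, so its bound is `1 / j` times a quantity free of `j`, and the
  -- harmonic sum costs one logarithm.
  have hblock : ∀ j ∈ Finset.Ioc 0 J,
      ‖∑ l ∈ Finset.Ioc (j * R) (j * R + R), F l‖ ≤ 2 * N * (A * D) * δ * (j : ℝ)⁻¹ := by
    intro j hj
    rw [Finset.mem_Ioc] at hj
    have hjY : j * R ≤ Y := (Nat.mul_le_mul_right R hj.2).trans (Nat.div_mul_le_self Y R)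
    have hjY' : ((j * R : ℕ) : ℝ) ≤ Y := by exact_mod_cast hjY
    have hj0 : (0 : ℝ) < j := by exact_mod_cast hj.1
    have hl0 : (0 : ℝ) < ((j * R : ℕ) : ℝ) := by push_cast; positivity
    have hlam' : m * R * ((j * R : ℕ) : ℝ) * B / (2 * N) ≤ m * R * Y * B / (2 * N) := by gcongr
    have h2 := norm_block_sum_sq_le hB hh hm hN hd₁ hd₂ hd₃ h₃ hN' hR hH
      (show R ≤ j * R by nlinarith [hj.1]) (hlam'.trans hlam) hα hβ'D
    refine le_of_sq_le_sq ?_ (by positivity)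
    refine h2.trans ?_
    have e1 : 2 / √(m * H * ((j * R : ℕ) : ℝ) * B / (2 * N)) ≤
        (2 * N / ((j * R : ℕ) : ℝ)) * √(2 * Y / (N * m * H * B)) := by
      have e2 : √(2 * ((j * R : ℕ) : ℝ) / (N * m * H * B)) ≤ √(2 * Y / (N * m * H * B)) := by
        apply Real.sqrt_le_sqrt
        gcongr
      refine le_trans (le_of_eq ?_) (mul_le_mul_of_nonneg_left e2 (by positivity))
      set l₀ := ((j * R : ℕ) : ℝ)
      have e3 : 2 * l₀ / (N * m * H * B) = (l₀ / N) ^ 2 / (m * H * l₀ * B / (2 * N)) := by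
        field_simp
      rw [e3, Real.sqrt_div (by positivity : 0 ≤ (l₀ / N) ^ 2), Real.sqrt_sq (by positivity)]
      field_simp
    have hδsq : δ ^ 2 = 2 * H / R + 14 * (8 * h * √(m * R * Y * B / (2 * N)) +
      √(2 * Y / (N * m * H * B))) := Real.sq_sqrt (by positivity)
    have e4 := Real.sqrt_le_sqrt hlam'
    set K := 2 * N / ((j * R : ℕ) : ℝ) with hK
    have hK0 : 0 < K := by positivity
    have hKR : K * R = 2 * N * (j : ℝ)⁻¹ := by
      rw [hK]; push_cast; field_simp
    calc A ^ 2 * K * (D ^ 2 * (R * (2 * H * K) + R ^ 2 *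
          (14 * (2 * (4 * h) * K * √(m * R * ((j * R : ℕ) : ℝ) * B / (2 * N)) +
          2 / √(m * H * ((j * R : ℕ) : ℝ) * B / (2 * N))))))
        ≤ A ^ 2 * K * (D ^ 2 * (R * (2 * H * K) + R ^ 2 *
          (14 * (2 * (4 * h) * K * √(m * R * Y * B / (2 * N)) +
            K * √(2 * Y / (N * m * H * B)))))) := by gcongr
      _ = (A * D * (K * R)) ^ 2 * (2 * H / R + 14 * (8 * h * √(m * R * Y * B / (2 * N)) +
            √(2 * Y / (N * m * H * B)))) := by field_simp; ring
      _ = (2 * N * (A * D) * δ * (j : ℝ)⁻¹) ^ 2 := by rw [← hδsq, hKR]; ring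
  rw [h1, sum_Ioc_mul_eq_sum_blocks]
  refine (norm_sum_le_of_le _ hblock).trans ?_
  rw [← Finset.mul_sum]
  refine mul_le_mul_of_nonneg_left ?_ (by positivity)
  have h3 := harmonic_le_one_add_log J
  rw [harmonic_eq_sum_Icc] at h3
  push_cast at h3
  rw [show Finset.Ioc 0 J = Finset.Icc 1 J from rfl]
  refine h3.trans ?_
  rcases Nat.eq_zero_or_pos J with h0 | h0
  · rw [h0]
    simpa using Real.log_natCast_nonneg Y
  · have hJY : (J : ℝ) ≤ Y := by exact_mod_cast Nat.div_le_self Y R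
    have := Real.log_le_log (by exact_mod_cast h0) hJY
    linarith

/-- Type I sums. -/
lemma norm_typeI_sum_le {φ f₁ f₂ : ℝ → ℝ} {N : ℕ} {A h m : ℝ} (hA : 0 < A) (hh : 1 ≤ h)
    (hm : 0 < m) (hN : 1 ≤ N) (hd₁ : ∀ y ∈ Set.Icc (N : ℝ) (2 * N), HasDerivAt φ (f₁ y) y)
    (hd₂ : ∀ y ∈ Set.Icc (N : ℝ) (2 * N), HasDerivAt f₁ (f₂ y) y)
    (h₂ : ∀ y ∈ Set.Icc (N : ℝ) (2 * N), f₂ y ∈ Set.Icc (-(h * A)) (-A))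
    {N' K : ℕ} (hNN' : N ≤ N') (hN' : N' ≤ 2 * N) (hlam : m * K ^ 2 * A ≤ 1) {c : ℕ → ℂ} {C : ℝ}
    (hC : 0 ≤ C) (hc : ∀ k ∈ Finset.Ioc 0 K, ‖c k‖ ≤ C) {w : ℕ → ℝ} {W : ℝ}
    (hw0 : ∀ l, 0 ≤ w l) (hw : Monotone w) (hwW : ∀ l ≤ 2 * N, w l ≤ W) :
    ‖∑ k ∈ Finset.Ioc 0 K, c k * ∑ l ∈ Finset.Ioc (N / k) (N' / k),
      (w l : ℂ) * addExp (m * φ ((k : ℝ) * l))‖ ≤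
    56 * (C * W) * (2 * h * N * K * √(m * A) + 1 / √(m * A) * (1 + Real.log K)) := by
  have hW : 0 ≤ W := (hw0 0).trans (hwW 0 (Nat.zero_le _))
  have hmA : 0 < √(m * A) := Real.sqrt_pos.mpr (by positivity)
  have hin : ∀ k ∈ Finset.Ioc 0 K, ‖c k * ∑ l ∈ Finset.Ioc (N / k) (N' / k),
      (w l : ℂ) * addExp (m * φ ((k : ℝ) * l))‖ ≤
      56 * (C * W) * (2 * h * N * √(m * A) + 1 / √(m * A) * (k : ℝ)⁻¹) := by
    intro k hk
    have hk' := hk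
    rw [Finset.mem_Ioc] at hk'
    have hk0 : (0 : ℝ) < k := by exact_mod_cast hk'.1
    have hkK : (k : ℝ) ≤ K := by exact_mod_cast hk'.2
    have hpart : ∀ q, N / k ≤ q → q ≤ N' / k →
        ‖∑ l ∈ Finset.Ioc (N / k) q, addExp (m * φ ((k : ℝ) * l))‖ ≤
        28 * (2 * h * N * √(m * A) + 1 / √(m * A) * (k : ℝ)⁻¹) := by
      intro q hq1 hq2
      have hp : N ≤ k * (N / k + 1) := by
        have := Nat.div_add_mod N k
        have := Nat.mod_lt N hk'.1
        nlinarith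
      have hq : k * q ≤ 2 * N :=
        (Nat.mul_le_mul_left k hq2).trans ((Nat.mul_div_le _ _).trans hN')
      have h1 := norm_sum_addExp_mul_phase_le hA hh hm hd₁ hd₂ h₂ hk'.1 hq1 hp hq
      have hlamk : m * (k : ℝ) ^ 2 * A ≤ 1 := le_trans (by gcongr) hlam
      have hlam0 : 0 < m * (k : ℝ) ^ 2 * A := by positivity
      have hqK : (q : ℝ) - ((N / k : ℕ) : ℝ) ≤ 2 * N / k := by
        have e1 : (k : ℝ) * q ≤ 2 * N := by exact_mod_cast hq
        have e2 : (q : ℝ) ≤ 2 * N / k := by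
          rw [le_div_iff₀ hk0]; linarith
        have e4 : (0 : ℝ) ≤ ((N / k : ℕ) : ℝ) := Nat.cast_nonneg _
        linarith
      have h2 := vdc_factor_le (h := h) (K := 2 * N / k) hh (by positivity) hlam0 le_rfl le_rfl
        hlamk
      have h3 : √(m * (k : ℝ) ^ 2 * A) = k * √(m * A) := by
        rw [show m * (k : ℝ) ^ 2 * A = (k : ℝ) ^ 2 * (m * A) by ring, Real.sqrt_mul (by positivity),
          Real.sqrt_sq hk0.le]
      have h4 : (h * ((q : ℝ) - ((N / k : ℕ) : ℝ)) * (m * k ^ 2 * A) + 1) *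
          (1 / √(m * k ^ 2 * A) + 1) ≤
          (h * (2 * N / k) * (m * k ^ 2 * A) + 1) * (1 / √(m * k ^ 2 * A) + 1) := by gcongr
      refine h1.trans ?_
      rw [mul_assoc]
      have h5 : 2 * h * (2 * N / k) * (k * √(m * A)) + 2 / (k * √(m * A)) =
          2 * (2 * h * N * √(m * A) + 1 / √(m * A) * (k : ℝ)⁻¹) := by
        field_simp
      rw [h3] at h2 h4 ⊢
      linarith
    -- The partial sums are bounded uniformly, so Abel's inequality restores the monotone weight `w`
    -- (it will be `1` or `log`) at the cost of `2 W`; hence `56 = 2 · 28`.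
    have hN1 : N / k ≤ N' / k := Nat.div_le_div_right hNN'
    have habel : ‖∑ l ∈ Finset.Ioc (N / k) (N' / k),
        (w l : ℂ) * addExp (m * φ ((k : ℝ) * l))‖ ≤
        2 * W * (28 * (2 * h * N * √(m * A) + 1 / √(m * A) * (k : ℝ)⁻¹)) := by
      have hshift : ∀ (G : ℕ → ℂ) (n : ℕ), ∑ l ∈ Finset.Ioc (N / k) (N / k + n), G l =
          ∑ i ∈ Finset.range n, G (N / k + 1 + i) := by
        intro G n
        rw [show Finset.Ioc (N / k) (N / k + n) = Finset.Ico (N / k + 1) (N / k + 1 + n) by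
          ext; simp only [Finset.mem_Ioc, Finset.mem_Ico]; omega, Finset.sum_Ico_eq_sum_range]
        simp
      have e1 : N' / k = N / k + (N' / k - N / k) := by omega
      rw [e1, hshift]
      refine norm_sum_range_mul_le (w := fun i => w (N / k + 1 + i))
        (z := fun i => addExp (m * φ ((k : ℝ) * ((N / k + 1 + i : ℕ) : ℝ)))) hW
        (fun n _ => hw0 _) (fun n hn => hwW _ ?_) (fun n _ => hw (by omega)) ?_
      · have := Nat.div_le_self N' k
        omega
      · intro n hn
        have := hpart (N / k + n) (by omega) (by omega)
        rwa [hshift] at this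
    rw [norm_mul]
    have e2 : 0 ≤ 28 * (2 * h * N * √(m * A) + 1 / √(m * A) * (k : ℝ)⁻¹) := by positivity
    calc _ ≤ C * (2 * W * (28 * (2 * h * N * √(m * A) + 1 / √(m * A) * (k : ℝ)⁻¹))) :=
          mul_le_mul (hc k hk) habel (norm_nonneg _) hC
      _ = _ := by ring
  refine (norm_sum_le_of_le _ hin).trans ?_
  rw [← Finset.mul_sum, Finset.sum_add_distrib, Finset.sum_const, Nat.card_Ioc,
    Nat.sub_zero, nsmul_eq_mul, ← Finset.mul_sum]
  refine mul_le_mul_of_nonneg_left ?_ (by positivity)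
  have h3 := harmonic_le_one_add_log K
  rw [harmonic_eq_sum_Icc] at h3
  push_cast at h3
  rw [show Finset.Ioc 0 K = Finset.Icc 1 K from rfl]
  have h4 := mul_le_mul_of_nonneg_left h3 (show 0 ≤ 1 / √(m * A) by positivity)
  linarith

/-! ### Vaughan's identity. -/

lemma mem_Ioc_div_iff {N N' k l : ℕ} (hk : 0 < k) :
    l ∈ Finset.Ioc (N / k) (N' / k) ↔ k * l ∈ Finset.Ioc N N' := by
  rw [Finset.mem_Ioc, Finset.mem_Ioc, Nat.div_lt_iff_lt_mul hk, Nat.le_div_iff_mul_le hk,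
    mul_comm l k]

lemma sum_Ioc_divisorsAntidiagonal (N N' : ℕ) (G : ℕ → ℕ → ℂ) :
    ∑ n ∈ Finset.Ioc N N', ∑ x ∈ n.divisorsAntidiagonal, G x.1 x.2 =
      ∑ k ∈ Finset.Ioc 0 N', ∑ l ∈ Finset.Ioc (N / k) (N' / k), G k l := by
  rw [Finset.sum_sigma', Finset.sum_sigma']
  refine Finset.sum_nbij' (fun x => ⟨x.2.1, x.2.2⟩) (fun y => ⟨y.1 * y.2, (y.1, y.2)⟩) ?_ ?_ ?_ ?_ ?_
  · rintro ⟨n, k, l⟩ h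
    simp only [Finset.mem_sigma, Nat.mem_divisorsAntidiagonal] at h ⊢
    obtain ⟨h1, rfl, h3⟩ := h
    have hk : 0 < k := Nat.pos_of_ne_zero (left_ne_zero_of_mul h3)
    have hl : 0 < l := Nat.pos_of_ne_zero (right_ne_zero_of_mul h3)
    rw [mem_Ioc_div_iff hk]
    refine ⟨?_, h1⟩
    rw [Finset.mem_Ioc] at h1 ⊢
    exact ⟨hk, (Nat.le_mul_of_pos_right k hl).trans h1.2⟩
  · rintro ⟨k, l⟩ h
    simp only [Finset.mem_sigma, Nat.mem_divisorsAntidiagonal] at h ⊢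
    have hk : 0 < k := (Finset.mem_Ioc.mp h.1).1
    have h2 := (mem_Ioc_div_iff hk).mp h.2
    refine ⟨h2, trivial, ?_⟩
    have := (Finset.mem_Ioc.mp h2).1
    omega
  · rintro ⟨n, k, l⟩ h
    simp only [Finset.mem_sigma, Nat.mem_divisorsAntidiagonal] at h
    obtain ⟨h1, rfl, h3⟩ := h
    rfl
  · rintro ⟨k, l⟩ _
    rfl
  · rintro ⟨n, k, l⟩ _
    rfl

lemma sum_Ioc_div_eq_of_support {N N' K M : ℕ} {G : ℕ → ℕ → ℂ} (hM : N' ≤ M)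
    (hG : ∀ k, K < k → ∀ l, G k l = 0) :
    ∑ k ∈ Finset.Ioc 0 M, ∑ l ∈ Finset.Ioc (N / k) (N' / k), G k l =
      ∑ k ∈ Finset.Ioc 0 K, ∑ l ∈ Finset.Ioc (N / k) (N' / k), G k l := by
  have h1 : ∑ k ∈ Finset.Ioc 0 M, ∑ l ∈ Finset.Ioc (N / k) (N' / k), G k l =
      ∑ k ∈ Finset.Ioc 0 (max M K), ∑ l ∈ Finset.Ioc (N / k) (N' / k), G k l := by
    refine Finset.sum_subset (Finset.Ioc_subset_Ioc_right (le_max_left _ _)) fun k _ hk2 => ?_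
    rw [Nat.div_eq_of_lt (a := N') (b := k), Finset.Ioc_eq_empty (by simp), Finset.sum_empty]
    rw [Finset.mem_Ioc] at *
    omega
  rw [h1]
  symm
  refine Finset.sum_subset (Finset.Ioc_subset_Ioc_right (le_max_right _ _)) fun k _ hk2 => ?_
  refine Finset.sum_eq_zero fun l _ => hG k ?_ l
  rw [Finset.mem_Ioc] at *
  omega

lemma sum_Ioc_div_comm (N N' : ℕ) (G : ℕ → ℕ → ℂ) :
    ∑ k ∈ Finset.Ioc 0 N', ∑ l ∈ Finset.Ioc (N / k) (N' / k), G k l =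
      ∑ l ∈ Finset.Ioc 0 N', ∑ k ∈ Finset.Ioc (N / l) (N' / l), G k l := by
  rw [← sum_Ioc_divisorsAntidiagonal, ← sum_Ioc_divisorsAntidiagonal N N' fun l k => G k l]
  refine Finset.sum_congr rfl fun n _ => ?_
  refine Finset.sum_nbij' Prod.swap Prod.swap ?_ ?_ ?_ ?_ ?_ <;> simp +contextual

open ArithmeticFunction in
/-- Vaughan's identity, summed over `(N, N']`. -/
lemma vaughan_identity {N N' V Y : ℕ} (hV : V ≤ N) (hY : N' < (Y + 1) * (Y + 1)) :
    ∃ c b μV bY : ℕ → ℝ, (∀ k, |c k| ≤ Real.log k) ∧ (∀ l, |b l| ≤ Real.log l) ∧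
      (∀ k, |μV k| ≤ 1) ∧ (∀ l, |bY l| ≤ Real.log l) ∧ ∀ E : ℕ → ℂ,
      ∑ n ∈ Finset.Ioc N N', (Λ n : ℂ) * E n =
        ∑ k ∈ Finset.Ioc 0 V, ((moebius k : ℝ) : ℂ) * ∑ l ∈ Finset.Ioc (N / k) (N' / k),
          ((Real.log l : ℝ) : ℂ) * E (k * l)
        - ∑ k ∈ Finset.Ioc 0 (V * V), (c k : ℂ) * ∑ l ∈ Finset.Ioc (N / k) (N' / k),
          ((1 : ℝ) : ℂ) * E (k * l)
        + ∑ l ∈ Finset.Ioc V Y, ∑ k ∈ Finset.Ioc (N / l) (N' / l),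
          (b l : ℂ) * (μV k : ℂ) * E (k * l)
        + ∑ k ∈ Finset.Ioc V Y, ∑ l ∈ Finset.Ioc (N / k) (N' / k),
          ((moebius k : ℝ) : ℂ) * (bY l : ℂ) * E (k * l) := by
  set μR : ArithmeticFunction ℝ := (moebius : ArithmeticFunction ℝ) with hμR
  set P : ArithmeticFunction ℝ := ⟨fun n => if n ≤ V then μR n else 0, by simp⟩ with hP
  set A : ArithmeticFunction ℝ := ⟨fun n => if n ≤ V then Λ n else 0, by simp⟩ with hA
  set Q : ArithmeticFunction ℝ := μR - P with hQ
  set B : ArithmeticFunction ℝ := Λ - A with hB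
  set z : ArithmeticFunction ℝ := (zeta : ArithmeticFunction ℝ) with hz
  have hPa : ∀ n, P n = if n ≤ V then μR n else 0 := fun n => rfl
  have hAa : ∀ n, A n = if n ≤ V then Λ n else 0 := fun n => rfl
  have hQa : ∀ n, Q n = if n ≤ V then 0 else μR n := by
    intro n
    have : Q n = μR n - P n := rfl
    rw [this, hPa]
    split_ifs <;> simp
  have hBa : ∀ n, B n = if n ≤ V then 0 else Λ n := by
    intro n
    have : B n = Λ n - A n := rfl
    rw [this, hAa]
    split_ifs <;> simp
  have hμ1 : ∀ n, |μR n| ≤ 1 := by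
    intro n
    have := abs_moebius_le_one (n := n)
    have h2 : |((moebius n : ℤ) : ℝ)| ≤ 1 := by exact_mod_cast this
    simpa [hμR] using h2
  have hlog : ∀ n : ℕ, ∑ x ∈ n.divisorsAntidiagonal, Λ x.2 = Real.log n := by
    intro n
    rw [← vonMangoldt_sum, Nat.sum_divisorsAntidiagonal' (f := fun _ y => Λ y)]
  -- `P` and `A` are `μ` and `Λ` truncated at `V`, `Q` and `B` the tails. Expanding with `log = Λ *
  -- z`, everything cancels to `A + μ * z * B`, and `μ * z = 1`.
  have hid : (Λ : ArithmeticFunction ℝ) = A + P * log - P * A * z + Q * (B * z) := by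
    rw [← vonMangoldt_mul_zeta, hQ, hB]
    have h1 : μR * z = 1 := coe_moebius_mul_coe_zeta
    linear_combination (A - Λ) * h1
  have hz1 : ∀ n, n ≠ 0 → z n = 1 := by
    intro n hn
    simp [hz, natCoe_apply, zeta_apply, hn]
  have hcb : ∀ k, |(P * A) k| ≤ Real.log k := by
    intro k
    rw [mul_apply, ← hlog]
    refine (Finset.abs_sum_le_sum_abs _ _).trans (Finset.sum_le_sum fun x _ => ?_)
    rw [abs_mul, hPa, hAa]
    have h0 : 0 ≤ Λ x.2 := vonMangoldt_nonneg
    have h2 := hμ1 x.1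
    split_ifs
    · rw [abs_of_nonneg h0]
      exact mul_le_of_le_one_left h0 h2
    · simp [h0]
    · simp [h0]
    · simp [h0]
  have hbsum : ∀ l, (B * z) l = ∑ x ∈ l.divisorsAntidiagonal, B x.1 := by
    intro l
    rw [mul_apply]
    refine Finset.sum_congr rfl fun x hx => ?_
    rw [Nat.mem_divisorsAntidiagonal] at hx
    rw [hz1 x.2 (by rintro h0; rw [h0] at hx; omega), mul_one]
  have hbb : ∀ l, |(B * z) l| ≤ Real.log l := by
    intro l
    rw [hbsum, ← vonMangoldt_sum, ← Nat.sum_divisorsAntidiagonal (f := fun x _ => Λ x)]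
    refine (Finset.abs_sum_le_sum_abs _ _).trans (Finset.sum_le_sum fun x _ => ?_)
    have h0 : 0 ≤ Λ x.1 := vonMangoldt_nonneg
    rw [hBa]
    split_ifs
    · simp [h0]
    · rw [abs_of_nonneg h0]
  have hb0 : ∀ l, l ≤ V → (B * z) l = 0 := by
    intro l hl
    rw [hbsum]
    refine Finset.sum_eq_zero fun x hx => ?_
    rw [hBa, if_pos]
    rw [Nat.mem_divisorsAntidiagonal] at hx
    exact (Nat.le_of_dvd (Nat.pos_of_ne_zero hx.2) ⟨_, hx.1.symm⟩).trans hl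
  have hconv : ∀ (f g : ArithmeticFunction ℝ) (E : ℕ → ℂ),
      ∑ n ∈ Finset.Ioc N N', (((f * g) n : ℝ) : ℂ) * E n =
        ∑ k ∈ Finset.Ioc 0 N', ∑ l ∈ Finset.Ioc (N / k) (N' / k),
          (f k : ℂ) * (g l : ℂ) * E (k * l) := by
    intro f g E
    rw [← sum_Ioc_divisorsAntidiagonal N N' fun k l => (f k : ℂ) * (g l : ℂ) * E (k * l)]
    refine Finset.sum_congr rfl fun n _ => ?_
    rw [mul_apply]
    push_cast
    rw [Finset.sum_mul]
    refine Finset.sum_congr rfl fun x hx => ?_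
    rw [Nat.mem_divisorsAntidiagonal] at hx
    rw [hx.1]
  refine ⟨fun k => (P * A) k, fun l => (B * z) l, fun k => Q k,
    fun l => if l ≤ Y then 0 else (B * z) l, hcb, hbb, ?_, ?_, ?_⟩
  · intro k
    show |Q k| ≤ 1
    rw [hQa]
    split_ifs
    · simp
    · exact hμ1 k
  · intro l
    beta_reduce
    split_ifs
    · simp [Real.log_natCast_nonneg l]
    · exact hbb l
  intro E
  have e0 : ∑ n ∈ Finset.Ioc N N', (Λ n : ℂ) * E n =
      ∑ n ∈ Finset.Ioc N N', (((P * log) n : ℝ) : ℂ) * E n -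
      ∑ n ∈ Finset.Ioc N N', (((P * A * z) n : ℝ) : ℂ) * E n +
      ∑ n ∈ Finset.Ioc N N', (((Q * (B * z)) n : ℝ) : ℂ) * E n := by
    rw [← Finset.sum_sub_distrib, ← Finset.sum_add_distrib]
    refine Finset.sum_congr rfl fun n hn => ?_
    have hn' := (Finset.mem_Ioc.mp hn).1
    have h1 : Λ n = A n + (P * log) n - (P * A * z) n + (Q * (B * z)) n := by
      conv_lhs => rw [hid]
      rfl
    rw [hAa, if_neg (by omega), zero_add] at h1
    rw [h1]
    push_cast
    ring
  have e1 : ∑ n ∈ Finset.Ioc N N', (((P * log) n : ℝ) : ℂ) * E n =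
      ∑ k ∈ Finset.Ioc 0 V, ((moebius k : ℝ) : ℂ) * ∑ l ∈ Finset.Ioc (N / k) (N' / k),
          ((Real.log l : ℝ) : ℂ) * E (k * l) := by
    rw [hconv, sum_Ioc_div_eq_of_support le_rfl (K := V)]
    · refine Finset.sum_congr rfl fun k hk => ?_
      rw [Finset.mul_sum]
      refine Finset.sum_congr rfl fun l _ => ?_
      rw [hPa, if_pos (Finset.mem_Ioc.mp hk).2]
      simp only [hμR, intCoe_apply, log_apply]
      ring
    · intro k hk l
      rw [hPa, if_neg (by omega)]
      simp
  have e2 : ∑ n ∈ Finset.Ioc N N', (((P * A * z) n : ℝ) : ℂ) * E n =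
      ∑ k ∈ Finset.Ioc 0 (V * V), (((P * A) k : ℝ) : ℂ) * ∑ l ∈ Finset.Ioc (N / k) (N' / k),
          ((1 : ℝ) : ℂ) * E (k * l) := by
    rw [hconv, sum_Ioc_div_eq_of_support le_rfl (K := V * V)]
    · refine Finset.sum_congr rfl fun k hk => ?_
      rw [Finset.mul_sum]
      refine Finset.sum_congr rfl fun l hl => ?_
      rw [hz1 l (Nat.zero_lt_of_lt (Finset.mem_Ioc.mp hl).1).ne']
      ring
    · intro k hk l
      have : (P * A) k = 0 := by
        rw [mul_apply]
        refine Finset.sum_eq_zero fun x hx => ?_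
        rw [Nat.mem_divisorsAntidiagonal] at hx
        rw [hPa, hAa]
        by_cases h1 : x.1 ≤ V
        · by_cases h2 : x.2 ≤ V
          · have := Nat.mul_le_mul h1 h2
            omega
          · rw [if_neg h2, mul_zero]
        · rw [if_neg h1, zero_mul]
      rw [this]
      simp
  -- Both variables exceed `V` on the support. Splitting at `l ≤ Y` lets whichever variable is at
  -- most `Y` be the outer one.
  have e3 : ∑ n ∈ Finset.Ioc N N', (((Q * (B * z)) n : ℝ) : ℂ) * E n =
      ∑ k ∈ Finset.Ioc 0 N', ∑ l ∈ Finset.Ioc (N / k) (N' / k),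
          (if l ≤ Y then ((B * z) l : ℂ) * (Q k : ℂ) * E (k * l) else 0) +
      ∑ k ∈ Finset.Ioc 0 N', ∑ l ∈ Finset.Ioc (N / k) (N' / k),
          (if l ≤ Y then 0 else (Q k : ℂ) * ((B * z) l : ℂ) * E (k * l)) := by
    rw [hconv, ← Finset.sum_add_distrib]
    refine Finset.sum_congr rfl fun k _ => ?_
    rw [← Finset.sum_add_distrib]
    refine Finset.sum_congr rfl fun l _ => ?_
    split_ifs
    · ring
    · ring
  have e4 : ∑ k ∈ Finset.Ioc 0 N', ∑ l ∈ Finset.Ioc (N / k) (N' / k),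
          (if l ≤ Y then ((B * z) l : ℂ) * (Q k : ℂ) * E (k * l) else 0) =
      ∑ l ∈ Finset.Ioc V Y, ∑ k ∈ Finset.Ioc (N / l) (N' / l),
          ((B * z) l : ℂ) * (Q k : ℂ) * E (k * l) := by
    rw [sum_Ioc_div_comm, sum_Ioc_div_eq_of_support (G := fun l k =>
      if l ≤ Y then ((B * z) l : ℂ) * (Q k : ℂ) * E (k * l) else 0) le_rfl (K := Y)
      (fun l hl k => if_neg (by omega))]
    symm
    rw [← Finset.sum_subset (Finset.Ioc_subset_Ioc_left (Nat.zero_le V))]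
    · refine Finset.sum_congr rfl fun l hl => Finset.sum_congr rfl fun k _ => ?_
      rw [if_pos (Finset.mem_Ioc.mp hl).2]
    · intro l hl hl2
      refine Finset.sum_eq_zero fun k _ => ?_
      rw [Finset.mem_Ioc] at hl hl2
      rw [hb0 l (by omega)]
      simp
  have e5 : ∑ k ∈ Finset.Ioc 0 N', ∑ l ∈ Finset.Ioc (N / k) (N' / k),
          (if l ≤ Y then 0 else (Q k : ℂ) * ((B * z) l : ℂ) * E (k * l)) =
      ∑ k ∈ Finset.Ioc V Y, ∑ l ∈ Finset.Ioc (N / k) (N' / k),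
          ((moebius k : ℝ) : ℂ) * ((if l ≤ Y then 0 else (B * z) l : ℝ) : ℂ) * E (k * l) := by
    -- When `l > Y`, a term with `k > Y` would have `k l ≥ (Y + 1)² > N'`, and one with `k ≤ V` has
    -- `Q k = 0`.
    have hk0 : ∀ k ∈ Finset.Ioc 0 (max N' Y), k ∉ Finset.Ioc V Y →
        ∑ l ∈ Finset.Ioc (N / k) (N' / k),
          (if l ≤ Y then 0 else (Q k : ℂ) * ((B * z) l : ℂ) * E (k * l)) = 0 := by
      intro k hk hk2
      refine Finset.sum_eq_zero fun l hl => ?_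
      rw [mem_Ioc_div_iff (Finset.mem_Ioc.mp hk).1, Finset.mem_Ioc] at hl
      rw [Finset.mem_Ioc] at hk2
      split_ifs with hlY
      · rfl
      · by_cases hkV : k ≤ V
        · rw [hQa, if_pos hkV]; simp
        · exfalso
          have : (Y + 1) * (Y + 1) ≤ k * l := Nat.mul_le_mul (by omega) (by omega)
          omega
    have h1 : ∑ k ∈ Finset.Ioc 0 N', ∑ l ∈ Finset.Ioc (N / k) (N' / k),
          (if l ≤ Y then 0 else (Q k : ℂ) * ((B * z) l : ℂ) * E (k * l)) =
        ∑ k ∈ Finset.Ioc 0 (max N' Y), ∑ l ∈ Finset.Ioc (N / k) (N' / k),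
          (if l ≤ Y then 0 else (Q k : ℂ) * ((B * z) l : ℂ) * E (k * l)) := by
      refine Finset.sum_subset (Finset.Ioc_subset_Ioc_right (le_max_left _ _)) fun k _ hk2 => ?_
      rw [Nat.div_eq_of_lt (a := N') (b := k), Finset.Ioc_eq_empty (by simp), Finset.sum_empty]
      rw [Finset.mem_Ioc] at *
      omega
    rw [h1]
    symm
    rw [← Finset.sum_subset (Finset.Ioc_subset_Ioc (Nat.zero_le V) (le_max_right N' Y)) hk0]
    refine Finset.sum_congr rfl fun k hk => Finset.sum_congr rfl fun l _ => ?_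
    rw [Finset.mem_Ioc] at hk
    have hQk : Q k = μR k := by rw [hQa]; exact if_neg (by omega)
    rw [hQk]
    split_ifs
    · simp
    · simp only [hμR, intCoe_apply]
  rw [e0, e1, e2, e3, e4, e5]
  push_cast
  ring

/-! ### Exponent bookkeeping and the exponential sum over primes. -/

lemma Real.sqrt_rpow_eq {x : ℝ} (hx : 0 ≤ x) (a : ℝ) : √(x ^ a) = x ^ (a / 2) := by
  rw [Real.sqrt_eq_rpow, ← Real.rpow_mul hx]
  congr 1
  ring

/-- Both summands are reduced to `x ^ (1 - t - 2ε)`; one `x ^ ε` pays for logarithms and the other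
for the constants `168 = 56 · 3` and `4`, the latter because four such bounds are added. -/
lemma typeI_bound_le_rpow {x ε t a k Q K L m A : ℝ} (hx : 1 ≤ x) (hε : 168 * 4 ≤ x ^ ε)
    (hQ : Q ≤ x ^ ε) (hK0 : 0 ≤ K) (hK : K ≤ x ^ k) (hL0 : 0 ≤ L)
    (hL : L ≤ x ^ ε) (hm : 1 ≤ m) (hmt : m ≤ x ^ t) (hA : A = x ^ a)
    (h₁ : 4 * ε + 1 + k + (t + a) / 2 ≤ 1 - t - 2 * ε) (h₂ : -(a / 2) + ε ≤ 1 - t - 2 * ε) :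
    56 * Q * (2 * x ^ (4 * ε) * x * K * √(m * A) + 1 / √(m * A) * L) ≤ x ^ (1 - t) / 4 := by
  have hx0 : 0 < x := by linarith
  have hA0 : 0 < A := hA ▸ Real.rpow_pos_of_pos hx0 a
  have s1 : √(m * A) ≤ x ^ ((t + a) / 2) := by
    rw [← Real.sqrt_rpow_eq hx0.le, Real.rpow_add hx0, ← hA]
    exact Real.sqrt_le_sqrt (mul_le_mul_of_nonneg_right hmt hA0.le)
  have s2 : x ^ (a / 2) ≤ √(m * A) := by
    rw [← Real.sqrt_rpow_eq hx0.le, ← hA]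
    exact Real.sqrt_le_sqrt (le_mul_of_one_le_left hA0.le hm)
  have s3 : 1 / √(m * A) * L ≤ x ^ (1 - t - 2 * ε) := by
    have h := one_div_le_one_div_of_le (Real.rpow_pos_of_pos hx0 _) s2
    rw [one_div (x ^ (a / 2)), ← Real.rpow_neg hx0.le] at h
    calc 1 / √(m * A) * L ≤ 1 / √(m * A) * x ^ ε := by gcongr
      _ ≤ x ^ (-(a / 2)) * x ^ ε := by gcongr
      _ = x ^ (-(a / 2) + ε) := (Real.rpow_add hx0 _ _).symm
      _ ≤ _ := Real.rpow_le_rpow_of_exponent_le hx h₂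
  have s4 : 2 * x ^ (4 * ε) * x * K * √(m * A) ≤ 2 * x ^ (1 - t - 2 * ε) := by
    calc 2 * x ^ (4 * ε) * x * K * √(m * A)
        ≤ 2 * x ^ (4 * ε) * x * x ^ k * x ^ ((t + a) / 2) := by gcongr
      _ = 2 * x ^ (4 * ε + 1 + k + (t + a) / 2) := by
        rw [Real.rpow_add hx0, Real.rpow_add hx0, Real.rpow_add hx0, Real.rpow_one]; ring
      _ ≤ _ := by gcongr
  have hE : x ^ (1 - t) = x ^ ε * x ^ ε * x ^ (1 - t - 2 * ε) := by
    rw [← Real.rpow_add hx0, ← Real.rpow_add hx0]; congr 1; ring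
  calc 56 * Q * (2 * x ^ (4 * ε) * x * K * √(m * A) + 1 / √(m * A) * L)
      ≤ 56 * x ^ ε * (2 * x ^ (1 - t - 2 * ε) + x ^ (1 - t - 2 * ε)) := by gcongr
    _ = 168 * (x ^ ε * x ^ (1 - t - 2 * ε)) := by ring
    _ ≤ x ^ ε / 4 * (x ^ ε * x ^ (1 - t - 2 * ε)) := by gcongr; linarith
    _ = _ := by rw [hE]; ring

/-- The three hypotheses bound the near-diagonal term and the two van der Corput terms by a constant
times `x ^ (-2t - 7ε)`. The outer root then saves `x ^ (-t - 3ε)`, leaving `3ε` for two logarithms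
and the constants. -/
lemma typeII_bound_le_rpow {x ε t b p q D H R Y L m B : ℝ} (hx : 1 ≤ x) (hε : 168 * 4 ≤ x ^ ε)
    (hD : D ≤ x ^ ε) (hL0 : 0 ≤ L) (hL : L ≤ x ^ ε) (hH₁ : x ^ p / 2 ≤ H)
    (hH₂ : H ≤ x ^ p) (hR₁ : x ^ q / 2 ≤ R) (hR₂ : R ≤ x ^ q) (hY0 : 0 ≤ Y)
    (hY : Y ≤ 2 * x ^ (1 / 2 : ℝ)) (hm : 1 ≤ m) (hmt : m ≤ x ^ t) (hB : B = x ^ b)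
    (h₁ : p - q ≤ -2 * t - 7 * ε) (h₂ : 4 * ε + (t + q + b - 1 / 2) / 2 ≤ -2 * t - 7 * ε)
    (h₃ : (-1 / 2 - p - b) / 2 ≤ -2 * t - 7 * ε) :
    2 * x * D * √(2 * H / R + 14 * (8 * x ^ (4 * ε) * √(m * R * Y * B / (2 * x)) +
      √(2 * Y / (x * m * H * B)))) * L ≤ x ^ (1 - t) / 4 := by
  have hx0 : 0 < x := by linarith
  have hp := Real.rpow_pos_of_pos hx0 p
  have hq := Real.rpow_pos_of_pos hx0 q
  have hb := Real.rpow_pos_of_pos hx0 b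
  have hh := Real.rpow_pos_of_pos hx0 (1 / 2)
  have hR0 : 0 < R := by linarith
  set e := -2 * t - 7 * ε with he
  have s1 : 2 * H / R ≤ 4 * x ^ e := by
    calc 2 * H / R ≤ 2 * x ^ p / (x ^ q / 2) := by gcongr
      _ = 4 * x ^ (p - q) := by rw [Real.rpow_sub hx0]; field_simp; ring
      _ ≤ _ := by gcongr
  have s2 : √(m * R * Y * B / (2 * x)) ≤ x ^ ((t + q + b - 1 / 2) / 2) := by
    rw [← Real.sqrt_rpow_eq hx0.le]
    apply Real.sqrt_le_sqrt
    calc m * R * Y * B / (2 * x) ≤ x ^ t * x ^ q * (2 * x ^ (1 / 2 : ℝ)) * x ^ b / (2 * x) := by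
          rw [hB]; gcongr
      _ = x ^ (t + q + (1 / 2 : ℝ) + b - 1) := by
        rw [Real.rpow_sub hx0, Real.rpow_add hx0, Real.rpow_add hx0, Real.rpow_add hx0,
          Real.rpow_one]
        field_simp
      _ = _ := by congr 1; ring
  have s3 : √(2 * Y / (x * m * H * B)) ≤ 3 * x ^ ((-1 / 2 - p - b) / 2) := by
    rw [← Real.sqrt_rpow_eq hx0.le]
    have : (3 : ℝ) = √9 := by
      rw [show (9 : ℝ) = 3 ^ 2 by norm_num, Real.sqrt_sq (by norm_num)]
    rw [this, ← Real.sqrt_mul (by norm_num)]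
    apply Real.sqrt_le_sqrt
    calc 2 * Y / (x * m * H * B) ≤ 2 * (2 * x ^ (1 / 2 : ℝ)) / (x * 1 * (x ^ p / 2) * x ^ b) := by
          rw [hB]; gcongr
      _ = 8 * x ^ ((1 / 2 : ℝ) - 1 - p - b) := by
        rw [Real.rpow_sub hx0, Real.rpow_sub hx0, Real.rpow_sub hx0, Real.rpow_one]
        field_simp
        ring
      _ ≤ 9 * x ^ ((1 / 2 : ℝ) - 1 - p - b) := by gcongr; norm_num
      _ = _ := by congr 2; ring
  have s4 : x ^ (4 * ε) * x ^ ((t + q + b - 1 / 2) / 2) ≤ x ^ e := by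
    rw [← Real.rpow_add hx0]
    exact Real.rpow_le_rpow_of_exponent_le hx h₂
  have s5 : x ^ ((-1 / 2 - p - b) / 2) ≤ x ^ e := Real.rpow_le_rpow_of_exponent_le hx h₃
  have s6 : 8 * x ^ (4 * ε) * √(m * R * Y * B / (2 * x)) ≤ 8 * x ^ e := by
    calc 8 * x ^ (4 * ε) * √(m * R * Y * B / (2 * x))
        ≤ 8 * x ^ (4 * ε) * x ^ ((t + q + b - 1 / 2) / 2) := by gcongr
      _ = 8 * (x ^ (4 * ε) * x ^ ((t + q + b - 1 / 2) / 2)) := by ring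
      _ ≤ _ := by gcongr
  have s7 : √(2 * H / R + 14 * (8 * x ^ (4 * ε) * √(m * R * Y * B / (2 * x)) +
      √(2 * Y / (x * m * H * B)))) ≤ x ^ ((e + ε) / 2) := by
    rw [← Real.sqrt_rpow_eq hx0.le, Real.rpow_add hx0]
    apply Real.sqrt_le_sqrt
    have := Real.rpow_pos_of_pos hx0 e
    nlinarith
  have hE : x ^ (1 - t) = x ^ ε * (x * x ^ ε * x ^ ((e + ε) / 2) * x ^ ε) := by
    nth_rewrite 3 [← Real.rpow_one x]
    rw [← Real.rpow_add hx0, ← Real.rpow_add hx0, ← Real.rpow_add hx0, ← Real.rpow_add hx0]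
    congr 1
    rw [he]; ring
  calc _ ≤ 2 * x * x ^ ε * x ^ ((e + ε) / 2) * x ^ ε := by gcongr
    _ = 2 * (x * x ^ ε * x ^ ((e + ε) / 2) * x ^ ε) := by ring
    _ ≤ x ^ ε / 4 * (x * x ^ ε * x ^ ((e + ε) / 2) * x ^ ε) := by gcongr; linarith
    _ = _ := by rw [hE]; ring

open Filter in
lemma eventually_rpow_mem_dyadic (κ : ℝ) {ε : ℝ} (hε : 0 < ε) :
    ∀ᶠ x : ℝ in atTop, ∀ y ∈ Set.Icc x (2 * x), y ^ κ ∈ Set.Icc (x ^ (κ - ε)) (x ^ (κ + ε)) := by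
  filter_upwards [eventually_ge_atTop 1,
    (tendsto_rpow_atTop hε).eventually_ge_atTop ((2 : ℝ) ^ |κ|)] with x hx hx2 y hy
  have hx0 : 0 < x := by linarith
  have hy0 : 0 < y := hx0.trans_le hy.1
  have hr1 : 1 ≤ y / x := (one_le_div hx0).mpr hy.1
  have hr2 : y / x ≤ 2 := (div_le_iff₀ hx0).mpr hy.2
  have hyx : y ^ κ = (y / x) ^ κ * x ^ κ := by
    rw [← Real.mul_rpow (by positivity) hx0.le, div_mul_cancel₀ _ hx0.ne']
  have h1 : (y / x) ^ |κ| ≤ x ^ ε :=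
    (Real.rpow_le_rpow (by positivity) hr2 (abs_nonneg κ)).trans hx2
  have hκ := Real.rpow_pos_of_pos hx0 κ
  constructor
  · rw [hyx, sub_eq_neg_add, Real.rpow_add hx0]
    gcongr
    calc x ^ (-ε) ≤ (y / x) ^ (-|κ|) := by
          rw [Real.rpow_neg hx0.le, Real.rpow_neg (by positivity)]
          exact inv_anti₀ (by positivity) h1
      _ ≤ (y / x) ^ κ := Real.rpow_le_rpow_of_exponent_le hr1 (neg_abs_le κ)
  · rw [hyx, add_comm, Real.rpow_add hx0]
    gcongr
    exact (Real.rpow_le_rpow_of_exponent_le hr1 (le_abs_self κ)).trans h1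

-- Powers of `y` become powers of the left endpoint; the price is a ratio `x ^ (4ε)` between the two
-- bounds, which plays the role of `h` in van der Corput's test.
open Filter in
lemma eventually_mem_Icc_dyadic {f : ℝ → ℝ} {κ ε : ℝ} (hε : 0 < ε)
    (hf : ∀ᶠ y in atTop, f y ∈ Set.Icc (-y ^ (κ + ε)) (-y ^ (κ - ε))) :
    ∀ᶠ x : ℝ in atTop, ∀ y ∈ Set.Icc x (2 * x),
      f y ∈ Set.Icc (-(x ^ (4 * ε) * x ^ (κ - 2 * ε))) (-x ^ (κ - 2 * ε)) := by
  have hf' : ∀ᶠ x : ℝ in atTop, ∀ y, x ≤ y → f y ∈ Set.Icc (-y ^ (κ + ε)) (-y ^ (κ - ε)) :=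
    eventually_forall_ge_atTop.mpr hf
  filter_upwards [hf', eventually_rpow_mem_dyadic (κ + ε) hε, eventually_rpow_mem_dyadic (κ - ε) hε,
    eventually_gt_atTop 0] with x h1 h2 h3 hx y hy
  have e1 : x ^ (4 * ε) * x ^ (κ - 2 * ε) = x ^ (κ + ε + ε) := by
    rw [← Real.rpow_add hx]; congr 1; ring
  have e2 : κ - 2 * ε = κ - ε - ε := by ring
  rw [e1, e2]
  have := h1 y hy.1
  exact ⟨(neg_le_neg (h2 y hy).2).trans this.1, this.2.trans (neg_le_neg (h3 y hy).1)⟩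

lemma rpow_div_two_le_floor {x a : ℝ} (hx : 1 ≤ x) (ha : 0 ≤ a) :
    x ^ a / 2 ≤ (⌊x ^ a⌋₊ : ℝ) ∧ (⌊x ^ a⌋₊ : ℝ) ≤ x ^ a ∧ 1 ≤ ⌊x ^ a⌋₊ := by
  have h1 : 1 ≤ x ^ a := Real.one_le_rpow hx ha
  have h2 : 1 ≤ ⌊x ^ a⌋₊ := Nat.one_le_floor_iff _ |>.mpr h1
  have h3 := Nat.lt_floor_add_one (x ^ a)
  have h4 : (1 : ℝ) ≤ (⌊x ^ a⌋₊ : ℝ) := by exact_mod_cast h2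
  exact ⟨by linarith, Nat.floor_le (by linarith), h2⟩

open Filter in
lemma eventually_log_le_rpow {ε : ℝ} (hε : 0 < ε) :
    ∀ᶠ x : ℝ in atTop, 2 * (1 + Real.log (2 * x)) ≤ x ^ ε := by
  have h := (isLittleO_log_rpow_atTop hε).bound (show (0 : ℝ) < 1 / 4 by norm_num)
  filter_upwards [h, eventually_ge_atTop 1,
    (tendsto_rpow_atTop hε).eventually_ge_atTop (4 * (1 + Real.log 2))] with x h1 hx h2
  rw [Real.norm_of_nonneg (Real.log_nonneg hx), Real.norm_of_nonneg (by positivity)] at h1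
  rw [Real.log_mul (by norm_num) (by linarith)]
  linarith

set_option maxHeartbeats 1000000 in
open Filter in
/-- The bound for exponential sums over primes with a regularly varying phase. -/
theorem RegularPhase.eventually_norm_sum_vonMangoldt_le {g t : ℝ} {φ f₁ f₂ g₁ : ℝ → ℝ}
    (hφ : RegularPhase g φ f₁ f₂ g₁) (hg : 1 / 2 < g) (hg1 : g ≤ 1) (ht0 : 0 < t)
    (ht : t < g / 15) :
    ∀ᶠ N : ℕ in atTop, ∀ N' : ℕ, N ≤ N' → N' ≤ 2 * N → ∀ m : ℕ, 1 ≤ m → (m : ℝ) ≤ (N : ℝ) ^ t →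
      ‖∑ n ∈ Finset.Ioc N N', (ArithmeticFunction.vonMangoldt n : ℂ) * addExp (m * φ n)‖ ≤
        (N : ℝ) ^ (1 - t) := by
  obtain ⟨ε, hε, hε1, hε2⟩ : ∃ ε : ℝ, 0 < ε ∧ ε ≤ 1 / 1000 ∧ ε ≤ (g / 15 - t) / 4 :=
    ⟨min (1 / 1000) ((g / 15 - t) / 4), lt_min (by norm_num) (by linarith), min_le_left _ _, min_le_right _ _⟩
  have hd₁ := eventually_forall_ge_atTop.mpr hφ.hasDerivAt
  have hd₂ := eventually_forall_ge_atTop.mpr hφ.hasDerivAt_deriv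
  have hd₃ := eventually_forall_ge_atTop.mpr hφ.hasDerivAt_sq_mul
  have h₂ := eventually_mem_Icc_dyadic hε (hφ.second_mem ε hε)
  have h₃ := eventually_mem_Icc_dyadic hε (hφ.third_mem ε hε)
  have hc := (tendsto_rpow_atTop hε).eventually_ge_atTop (168 * 4)
  have hl := eventually_log_le_rpow hε
  filter_upwards [tendsto_natCast_atTop_atTop.eventually
    (hd₁.and <| hd₂.and <| hd₃.and <| h₂.and <| h₃.and <| hc.and hl), eventually_ge_atTop 1] with
    N ⟨hd₁, hd₂, hd₃, h₂, h₃, hc, hl⟩ hN1 N' hNN' hN' m hm hmt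
  set x : ℝ := (N : ℝ) with hx
  have hx1 : 1 ≤ x := by rw [hx]; exact_mod_cast hN1
  have hx0 : 0 < x := by linarith
  set v := 4 / 15 - 2 * g / 15 + 1 / 30 with hv
  set p := 4 * (1 - g) / 15 with hp
  set q := p + 2 * t + 10 * ε with hq
  clear_value v p q
  obtain ⟨-, hV2, hV1⟩ := rpow_div_two_le_floor hx1 (a := v) (by rw [hv]; linarith)
  obtain ⟨hH1, hH2, hH3⟩ := rpow_div_two_le_floor hx1 (a := p) (by rw [hp]; linarith)
  obtain ⟨hR1, hR2, hR3⟩ := rpow_div_two_le_floor hx1 (a := q) (by rw [hq, hp]; linarith)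
  set V := ⌊x ^ v⌋₊
  set H := ⌊x ^ p⌋₊
  set R := ⌊x ^ q⌋₊
  -- Of two factors with product at most `2N`, one is at most `Y`.
  set Y := Nat.sqrt (2 * N) with hYdef
  have hRV : R ≤ V := Nat.floor_le_floor
    (Real.rpow_le_rpow_of_exponent_le hx1 (by rw [hv, hq, hp]; linarith))
  have hVV : (V : ℝ) * V ≤ x ^ (2 * v) := by
    rw [two_mul, Real.rpow_add hx0]
    gcongr
  have hVN : V * V ≤ N := by
    have h1 : x ^ (2 * v) ≤ x ^ (1 : ℝ) :=
      Real.rpow_le_rpow_of_exponent_le hx1 (by rw [hv]; linarith)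
    rw [Real.rpow_one] at h1
    have h2 := hVV.trans h1
    rw [hx] at h2
    exact_mod_cast h2
  have hVY : V ≤ Y := Nat.le_sqrt.mpr (by omega)
  have hVN' : V ≤ N := (Nat.le_mul_self V).trans hVN
  have hYN : Y * Y ≤ 2 * N := Nat.sqrt_le _
  have hY2N : Y ≤ 2 * N := (Nat.le_mul_self Y).trans hYN
  have hYN2 : 2 * N < (Y + 1) * (Y + 1) := Nat.lt_succ_sqrt _
  have hY1 : 1 ≤ Y := hV1.trans hVY
  have hYx : (Y : ℝ) ≤ 2 * x ^ (1 / 2 : ℝ) := by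
    rw [← Real.sqrt_eq_rpow]
    have h1 : (Y : ℝ) * Y ≤ 2 * x := by rw [hx]; exact_mod_cast hYN
    have h2 := Real.sq_sqrt hx0.le
    refine le_of_sq_le_sq ?_ (by positivity)
    nlinarith
  have hlog0 : 0 ≤ Real.log (2 * x) := Real.log_nonneg (by linarith)
  have hlogle : ∀ n : ℕ, n ≤ 2 * N → Real.log n ≤ Real.log (2 * x) := by
    intro n hn
    rcases Nat.eq_zero_or_pos n with h0 | h0
    · simpa [h0] using hlog0
    · refine Real.log_le_log (by exact_mod_cast h0) ?_
      rw [hx]; exact_mod_cast hn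
  have hLD : Real.log (2 * x) ≤ x ^ ε := by linarith
  have hL1 : ∀ n : ℕ, n ≤ 2 * N → 1 + Real.log n ≤ x ^ ε := by
    intro n hn
    have := hlogle n hn
    linarith
  have hm1 : (1 : ℝ) ≤ m := by exact_mod_cast hm
  have hm0 : (0 : ℝ) < m := by linarith
  have hh : 1 ≤ x ^ (4 * ε) := Real.one_le_rpow hx1 (by linarith)
  have hA0 := Real.rpow_pos_of_pos hx0 (g - 2 - 2 * ε)
  have hB0 := Real.rpow_pos_of_pos hx0 (g - 1 - 2 * ε)
  obtain ⟨c, b, μV, bY, hcb, hbb, hμV, hbY, hsum⟩ := vaughan_identity hVN' (hN'.trans_lt hYN2)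
  rw [hsum fun n => addExp (m * φ n)]
  simp only [Nat.cast_mul]
  have hVV2 : V * V ≤ 2 * N := by omega
  have hKA : ∀ K : ℕ, (K : ℝ) ≤ x ^ (2 * v) → (m : ℝ) * K ^ 2 * x ^ (g - 2 - 2 * ε) ≤ 1 := by
    intro K hK
    calc (m : ℝ) * K ^ 2 * x ^ (g - 2 - 2 * ε)
        ≤ x ^ t * (x ^ (2 * v)) ^ 2 * x ^ (g - 2 - 2 * ε) := by gcongr
      _ = x ^ (t + 2 * v + 2 * v + (g - 2 - 2 * ε)) := by
        rw [Real.rpow_add hx0, Real.rpow_add hx0, Real.rpow_add hx0]; ring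
      _ ≤ 1 := Real.rpow_le_one_of_one_le_of_nonpos hx1 (by rw [hv]; linarith)
  have hVv : (V : ℝ) ≤ x ^ (2 * v) :=
    hV2.trans (Real.rpow_le_rpow_of_exponent_le hx1 (by rw [hv]; linarith))
  have hVVv : ((V * V : ℕ) : ℝ) ≤ x ^ (2 * v) := by push_cast; exact hVV
  have hμ1 : ∀ k : ℕ, ‖((ArithmeticFunction.moebius k : ℝ) : ℂ)‖ ≤ 1 := by
    intro k
    rw [Complex.norm_real, Real.norm_eq_abs]
    exact_mod_cast ArithmeticFunction.abs_moebius_le_one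
  have hlam : (m : ℝ) * R * Y * x ^ (g - 1 - 2 * ε) / (2 * N) ≤ 1 := by
    calc (m : ℝ) * R * Y * x ^ (g - 1 - 2 * ε) / (2 * x)
        ≤ x ^ t * x ^ q * (2 * x ^ (1 / 2 : ℝ)) * x ^ (g - 1 - 2 * ε) / (2 * x) := by gcongr
      _ = x ^ (t + q + 1 / 2 + (g - 1 - 2 * ε) - 1) := by
        rw [Real.rpow_sub hx0 _ 1, Real.rpow_add hx0, Real.rpow_add hx0, Real.rpow_add hx0 t,
          Real.rpow_one, ← mul_div_mul_left _ x two_ne_zero]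
        ring
      _ ≤ 1 := Real.rpow_le_one_of_one_le_of_nonpos hx1 (by rw [hq, hp]; linarith)
  have D₁ : ∀ y ∈ Set.Icc (N : ℝ) (2 * N), HasDerivAt φ (f₁ y) y := fun y hy => hd₁ y hy.1
  have D₂ : ∀ y ∈ Set.Icc (N : ℝ) (2 * N), HasDerivAt f₁ (f₂ y) y := fun y hy => hd₂ y hy.1
  have D₃ : ∀ y ∈ Set.Icc (N : ℝ) (2 * N), HasDerivAt (fun y => y ^ 2 * f₂ y) (g₁ y) y :=
    fun y hy => hd₃ y hy.1
  have hlogmono : Monotone fun n : ℕ => Real.log n := by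
    intro a b hab
    rcases Nat.eq_zero_or_pos a with h0 | h0
    · simp [h0, Real.log_natCast_nonneg]
    · exact Real.log_le_log (by exact_mod_cast h0) (by exact_mod_cast hab)
  have T1 := norm_typeI_sum_le hA0 hh hm0 hN1 D₁ D₂ h₂ hNN' hN' (hKA V hVv)
    (c := fun k => ((ArithmeticFunction.moebius k : ℝ) : ℂ)) zero_le_one (fun k _ => hμ1 k)
    (w := fun l => Real.log l) (fun l => Real.log_natCast_nonneg l) hlogmono hlogle
  have T2 := norm_typeI_sum_le hA0 hh hm0 hN1 D₁ D₂ h₂ hNN' hN' (hKA (V * V) hVVv)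
    (c := fun k => (c k : ℂ)) hlog0 (fun k hk => by
      rw [Complex.norm_real]
      exact (hcb k).trans (hlogle k ((Finset.mem_Ioc.mp hk).2.trans hVV2)))
    (w := fun _ => 1) (fun _ => zero_le_one) monotone_const (fun _ _ => le_rfl)
  have T3 := norm_typeII_sum_le hB0 hh hm0 hN1 D₁ D₂ D₃ h₃ hN' hR3 hH3 hRV hVY hlam
    (α := fun k => (μV k : ℂ)) (β := fun l => (b l : ℂ)) zero_le_one hlog0
    (fun k _ => by rw [Complex.norm_real]; exact hμV k)
    (fun l hl => by
      rw [Complex.norm_real]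
      exact (hbb l).trans (hlogle l ((Finset.mem_Ioc.mp hl).2.trans hY2N)))
  have T4 := norm_typeII_sum_le hB0 hh hm0 hN1 D₁ D₂ D₃ h₃ hN' hR3 hH3 hRV hVY hlam
    (α := fun k => (bY k : ℂ)) (β := fun l => ((ArithmeticFunction.moebius l : ℝ) : ℂ))
    hlog0 zero_le_one
    (fun l hl => by
      rw [Complex.norm_real]
      exact (hbY l).trans (hlogle l (Finset.mem_Ioc.mp hl).2))
    (fun k _ => hμ1 k)
  have hV2N : V ≤ 2 * N := by omega
  have hlogn0 : ∀ n : ℕ, 0 ≤ 1 + Real.log n := by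
    intro n
    have := Real.log_natCast_nonneg n
    linarith
  have N1 := typeI_bound_le_rpow hx1 hc (Q := 1 * Real.log (2 * x)) (by linarith)
    (Nat.cast_nonneg V) hVv (hlogn0 V) (hL1 V hV2N) hm1 hmt rfl
    (by rw [hv]; linarith) (by linarith) (a := g - 2 - 2 * ε)
  have N2 := typeI_bound_le_rpow hx1 hc (Q := Real.log (2 * x) * 1) (by linarith)
    (Nat.cast_nonneg (V * V)) hVVv (hlogn0 (V * V)) (hL1 (V * V) hVV2) hm1 hmt rfl
    (by rw [hv]; linarith) (by linarith) (a := g - 2 - 2 * ε)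
  have N3 := typeII_bound_le_rpow hx1 hc (D := 1 * Real.log (2 * x)) (by linarith)
    (hlogn0 Y) (hL1 Y hY2N) hH1 hH2 hR1 hR2 (Nat.cast_nonneg Y) hYx hm1 hmt rfl
    (by rw [hq]; linarith) (by rw [hq, hp]; linarith) (by rw [hp]; linarith) (b := g - 1 - 2 * ε)
  have E3 : (1 : ℝ) * Real.log (2 * x) = Real.log (2 * x) * 1 := mul_comm _ _
  have N4 := N3
  rw [E3] at N4
  have E4 : ∑ k ∈ Finset.Ioc V Y, ∑ l ∈ Finset.Ioc (N / k) (N' / k),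
      ((ArithmeticFunction.moebius k : ℝ) : ℂ) * (bY l : ℂ) * addExp (m * φ ((k : ℝ) * l)) =
      ∑ k ∈ Finset.Ioc V Y, ∑ l ∈ Finset.Ioc (N / k) (N' / k),
      ((ArithmeticFunction.moebius k : ℝ) : ℂ) * (bY l : ℂ) * addExp (m * φ ((l : ℝ) * k)) := by
    refine Finset.sum_congr rfl fun k _ => Finset.sum_congr rfl fun l _ => ?_
    rw [mul_comm (k : ℝ) l]
  rw [E4]
  refine (norm_add_le _ _).trans ?_
  refine (add_le_add ((norm_add_le _ _).trans (add_le_add (norm_sub_le _ _) le_rfl)) le_rfl).trans ?_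
  refine (add_le_add (add_le_add (add_le_add (T1.trans N1) (T2.trans N2)) (T3.trans N3))
    (T4.trans N4)).trans (le_of_eq ?_)
  ring

/-! ### Poisson summation and equidistribution modulo one. -/

open scoped SchwartzMap FourierTransform in
/-- Poisson summation for the dilate `y ↦ G (y / ρ)`. -/
lemma SchwartzMap.tsum_dilate_eq (G : 𝓢(ℝ, ℂ)) {ρ : ℝ} (hρ : 0 < ρ) (x : ℝ) :
    ∑' k : ℤ, G ((x + k) / ρ) = ∑' m : ℤ, (ρ : ℂ) * 𝓕 G (ρ * m) * addExp (m * x) := by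
  set e : ℝ ≃L[ℝ] ℝ := ContinuousLinearEquiv.unitsEquivAut ℝ (Units.mk0 ρ⁻¹ (by positivity))
  have he : ∀ y : ℝ, e y = ρ⁻¹ * y := fun y => by
    simp [e, ContinuousLinearEquiv.unitsEquivAut, mul_comm]
  set f : 𝓢(ℝ, ℂ) := SchwartzMap.compCLMOfContinuousLinearEquiv ℂ e G
  have hf : ∀ y : ℝ, f y = G (ρ⁻¹ * y) := fun y => by
    rw [← he]; rfl
  have hF : ∀ ξ : ℝ, 𝓕 f ξ = ρ * 𝓕 G (ρ * ξ) := by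
    intro ξ
    rw [SchwartzMap.fourier_coe, SchwartzMap.fourier_coe, Real.fourier_eq', Real.fourier_eq']
    have := MeasureTheory.Measure.integral_comp_inv_mul_left
      (fun v : ℝ => Complex.exp (((-2 * Real.pi * (ρ * v * ξ) : ℝ) : ℂ) * Complex.I) • G v) ρ
    rw [abs_of_pos hρ] at this
    simp only [RCLike.inner_apply, conj_trivial, hf]
    rw [Complex.real_smul] at this
    refine Eq.trans ?_ (this.trans ?_)
    · refine MeasureTheory.integral_congr_ae (Filter.Eventually.of_forall fun v => ?_)
      beta_reduce
      congr 3
      field_simp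
    · congr 1
      refine MeasureTheory.integral_congr_ae (Filter.Eventually.of_forall fun v => ?_)
      beta_reduce
      congr 4
      ring
  have h := f.tsum_eq_tsum_fourier x
  simp only [hf, hF] at h
  convert h using 3 with k m
  · rw [div_eq_inv_mul]
  · rw [fourier_coe_apply, addExp]
    congr 2
    push_cast
    ring

open scoped SchwartzMap FourierTransform in
lemma SchwartzMap.exists_norm_fourier_le (G : 𝓢(ℝ, ℂ)) {b : ℝ} (hb : 0 ≤ b) :
    ∃ D : ℝ, 0 < D ∧ ∀ y : ℝ, y ≠ 0 → ‖𝓕 G y‖ ≤ D * |y| ^ (-b) := by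
  obtain ⟨C₀, h₀, hC₀⟩ := (𝓕 G).decay 0 0
  obtain ⟨C₁, h₁, hC₁⟩ := (𝓕 G).decay ⌈b⌉₊ 0
  refine ⟨C₀ + C₁, by positivity, fun y hy => ?_⟩
  have hy0 : 0 < |y| := abs_pos.mpr hy
  have a0 := hC₀ y
  have a1 := hC₁ y
  rw [norm_iteratedFDeriv_zero] at a0 a1
  rw [pow_zero, one_mul] at a0
  rw [Real.norm_eq_abs] at a1
  rw [Real.rpow_neg hy0.le, ← div_eq_mul_inv, le_div_iff₀ (by positivity), mul_comm]
  rcases le_total |y| 1 with h | h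
  · have : |y| ^ b ≤ 1 := Real.rpow_le_one hy0.le h hb
    have := mul_le_of_le_one_left (norm_nonneg (𝓕 G y)) this
    linarith
  · have : |y| ^ b ≤ |y| ^ ⌈b⌉₊ := by
      rw [← Real.rpow_natCast]
      exact Real.rpow_le_rpow_of_exponent_le h (Nat.le_ceil b)
    have := mul_le_mul_of_nonneg_right this (norm_nonneg (𝓕 G y))
    linarith

open scoped SchwartzMap FourierTransform in
lemma SchwartzMap.summable_fourier_mul_addExp (G : 𝓢(ℝ, ℂ)) {ρ : ℝ} (hρ : 0 < ρ) (x : ℝ) :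
    Summable fun m : ℤ => (ρ : ℂ) * 𝓕 G (ρ * m) * addExp (m * x) := by
  obtain ⟨D, hD, h⟩ := G.exists_norm_fourier_le (b := 2) (by norm_num)
  have hs := (Real.summable_abs_int_rpow (show (1 : ℝ) < 2 by norm_num)).mul_left
    (ρ * (D * ρ ^ (-2 : ℝ)))
  refine Summable.of_norm_bounded_eventually hs ?_
  have : ∀ᶠ m : ℤ in Filter.cofinite, m ≠ 0 := by
    rw [Filter.eventually_cofinite]
    simp
  filter_upwards [this] with m hm
  rw [norm_mul, norm_mul, norm_addExp, mul_one, Complex.norm_real, Real.norm_of_nonneg hρ.le,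
    mul_assoc, mul_assoc]
  gcongr
  have hm' : (m : ℝ) ≠ 0 := by exact_mod_cast hm
  refine (h _ (mul_ne_zero hρ.ne' hm')).trans ?_
  rw [abs_mul, abs_of_pos hρ, Real.mul_rpow hρ.le (abs_nonneg _)]

-- The frequency `m = 0` of the Poisson sum is the main term; every other frequency contributes an
-- exponential sum, dominated by a summable majorant.
open scoped SchwartzMap FourierTransform in
lemma SchwartzMap.norm_sum_tsum_dilate_sub_le (G : 𝓢(ℝ, ℂ)) {ρ : ℝ} (hρ : 0 < ρ) {ι : Type*}
    (s : Finset ι) (w x : ι → ℝ) {M : ℤ → ℝ} {a : ℝ} (ha : HasSum M a) (hM0 : 0 ≤ M 0)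
    (hM : ∀ m : ℤ, m ≠ 0 →
      ρ * ‖𝓕 G (ρ * m)‖ * ‖∑ i ∈ s, (w i : ℂ) * addExp (m * x i)‖ ≤ M m) :
    ‖∑ i ∈ s, (w i : ℂ) * ∑' k : ℤ, G ((x i + k) / ρ) -
      ρ * 𝓕 G 0 * ∑ i ∈ s, (w i : ℂ)‖ ≤ a := by
  have h1 : ∑ i ∈ s, (w i : ℂ) * ∑' k : ℤ, G ((x i + k) / ρ) =
      ∑' m : ℤ, (ρ : ℂ) * 𝓕 G (ρ * m) * ∑ i ∈ s, (w i : ℂ) * addExp (m * x i) := by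
    simp_rw [G.tsum_dilate_eq hρ, ← tsum_mul_left]
    rw [← Summable.tsum_finsetSum fun i _ =>
      (G.summable_fourier_mul_addExp hρ (x i)).mul_left (w i : ℂ)]
    refine tsum_congr fun m => ?_
    rw [Finset.mul_sum]
    refine Finset.sum_congr rfl fun i _ => ?_
    ring
  have hs : Summable fun m : ℤ =>
      (ρ : ℂ) * 𝓕 G (ρ * m) * ∑ i ∈ s, (w i : ℂ) * addExp (m * x i) := by
    refine (summable_sum (s := s) fun i _ =>
      (G.summable_fourier_mul_addExp hρ (x i)).mul_left (w i : ℂ)).congr fun m => ?_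
    rw [Finset.mul_sum]
    refine Finset.sum_congr rfl fun i _ => ?_
    ring
  have h0 : (ρ : ℂ) * 𝓕 G (ρ * ((0 : ℤ) : ℝ)) * ∑ i ∈ s, (w i : ℂ) * addExp (((0 : ℤ) : ℝ) * x i) =
      ρ * 𝓕 G 0 * ∑ i ∈ s, (w i : ℂ) := by
    simp [addExp_zero]
  rw [h1, hs.tsum_eq_add_tsum_ite 0, h0, add_sub_cancel_left]
  refine tsum_of_norm_bounded ha fun m => ?_
  split_ifs with hm
  · simpa [hm] using hM0
  · rw [norm_mul, norm_mul, Complex.norm_real, Real.norm_of_nonneg hρ.le]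
    exact hM m hm

lemma sum_Ioc_vonMangoldt_le {N N' : ℕ} (hN' : N' ≤ 2 * N) :
    ∑ n ∈ Finset.Ioc N N', ArithmeticFunction.vonMangoldt n ≤ 12 * N := by
  have h1 : ∑ n ∈ Finset.Ioc N N', ArithmeticFunction.vonMangoldt n ≤
      Chebyshev.psi ((2 * N : ℕ) : ℝ) := by
    rw [Chebyshev.psi, Nat.floor_natCast]
    exact Finset.sum_le_sum_of_subset_of_nonneg (Finset.Ioc_subset_Ioc (Nat.zero_le _) hN')
      fun _ _ _ => ArithmeticFunction.vonMangoldt_nonneg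
  have h2 := Chebyshev.psi_le_const_mul_self (Nat.cast_nonneg (α := ℝ) (2 * N))
  have h3 : Real.log 4 ≤ 2 := by
    rw [show (4 : ℝ) = 2 ^ 2 by norm_num, Real.log_pow]
    have := Real.log_two_lt_d9
    push_cast
    linarith
  push_cast at h1 h2
  have : (0 : ℝ) ≤ N := Nat.cast_nonneg N
  nlinarith

open scoped SchwartzMap FourierTransform in
open Filter in
/-- Equidistribution modulo one, on the scale `ρ ≥ N ^ (-t')`, from bounds for exponential sums. -/
lemma SchwartzMap.eventually_norm_sum_tsum_dilate_sub_le (G : 𝓢(ℝ, ℂ)) {φ : ℝ → ℝ} {t' t : ℝ}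
    (ht' : 0 < t') (htt : t' < t) (ht1 : t ≤ 1)
    (H : ∀ᶠ N : ℕ in atTop, ∀ N' : ℕ, N ≤ N' → N' ≤ 2 * N → ∀ m : ℕ, 1 ≤ m →
      (m : ℝ) ≤ (N : ℝ) ^ t →
      ‖∑ n ∈ Finset.Ioc N N', (ArithmeticFunction.vonMangoldt n : ℂ) * addExp (m * φ n)‖ ≤
        (N : ℝ) ^ (1 - t)) {δ : ℝ} (hδ : 0 < δ) :
    ∀ᶠ N : ℕ in atTop, ∀ N' : ℕ, N ≤ N' → N' ≤ 2 * N → ∀ ρ : ℝ, (N : ℝ) ^ (-t') ≤ ρ → ρ ≤ 1 →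
      ∀ σ : ℝ, σ = 1 ∨ σ = -1 →
      ‖∑ n ∈ Finset.Ioc N N', (ArithmeticFunction.vonMangoldt n : ℂ) *
        ∑' k : ℤ, G ((σ * φ n + k) / ρ) -
        ρ * 𝓕 G 0 * ∑ n ∈ Finset.Ioc N N', (ArithmeticFunction.vonMangoldt n : ℂ)‖ ≤
        δ * ρ * N := by
  -- Half of the gap `t - t'` gives summability over `m` through the decay exponent `1 + η`, the
  -- other half gives the saving `x ^ (-η)`.
  set η := (t - t') / 2 with hη
  have hη0 : 0 < η := by rw [hη]; linarith
  have hKt : 0 < t / (t - t') := div_pos (by linarith) (by linarith)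
  obtain ⟨D₁, hD₁, hb₁⟩ := G.exists_norm_fourier_le (b := 1 + η) (by linarith)
  -- For `|m| > x ^ t` one has `ρ |m| ≥ x ^ (t - t')`, so the extra exponent `t / (t - t')` yields a
  -- factor `x ^ (-t)` that makes the trivial bound `12 x` for the exponential sum sufficient.
  obtain ⟨D₂, hD₂, hb₂⟩ := G.exists_norm_fourier_le (b := 1 + η + t / (t - t')) (by linarith)
  set D := max D₁ D₂
  have hD : 0 < D := lt_max_of_lt_left hD₁
  have hZ := (Real.summable_abs_int_rpow (show 1 < 1 + η by linarith)).hasSum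
  set Z := ∑' m : ℤ, |(m : ℝ)| ^ (-(1 + η)) with hZdef
  have hlarge : ∀ᶠ N : ℕ in atTop, 12 * D * Z / δ ≤ (N : ℝ) ^ η :=
    ((tendsto_rpow_atTop hη0).comp tendsto_natCast_atTop_atTop).eventually_ge_atTop _
  filter_upwards [H, hlarge, eventually_ge_atTop 1] with N H hlarge hN1 N' hNN' hN' ρ hρ hρ1 σ hσ
  set x : ℝ := (N : ℝ) with hx
  have hx1 : 1 ≤ x := by rw [hx]; exact_mod_cast hN1
  have hx0 : 0 < x := by linarith
  have hρ0 : 0 < ρ := (Real.rpow_pos_of_pos hx0 _).trans_le hρ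
  have hmain := G.norm_sum_tsum_dilate_sub_le hρ0 (Finset.Ioc N N')
    (fun n => ArithmeticFunction.vonMangoldt n) (fun n => σ * φ n)
    (M := fun m : ℤ => 12 * D * ρ ^ (-η) * x ^ (1 - t) * |(m : ℝ)| ^ (-(1 + η)))
    (hZ.mul_left _) (by positivity) ?_
  · refine hmain.trans ?_
    have e1 : ρ ^ (-η) = ρ * ρ ^ (-(1 + η)) := by
      rw [← Real.rpow_one_add' hρ0.le (by linarith)]; congr 1; ring
    -- `t' (1 + η) ≤ t' + η = t - η`, by the choice of `η` and `t' ≤ 1`.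
    have e2 : ρ ^ (-(1 + η)) ≤ x ^ (t - η) := by
      calc ρ ^ (-(1 + η)) ≤ (x ^ (-t')) ^ (-(1 + η)) :=
            Real.rpow_le_rpow_of_nonpos (Real.rpow_pos_of_pos hx0 _) hρ (by linarith)
        _ = x ^ (t' * (1 + η)) := by rw [← Real.rpow_mul hx0.le]; congr 1; ring
        _ ≤ x ^ (t - η) := by
          refine Real.rpow_le_rpow_of_exponent_le hx1 ?_
          have : t' * η ≤ 1 * η := by gcongr; linarith
          rw [hη] at *
          linarith
    have hZ0 : 0 ≤ Z := tsum_nonneg fun m => by positivity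
    have e3 : x ^ (t - η) * x ^ (1 - t) * x ^ η = x := by
      rw [← Real.rpow_add hx0, ← Real.rpow_add hx0]
      conv_rhs => rw [← Real.rpow_one x]
      congr 1; ring
    rw [div_le_iff₀ hδ] at hlarge
    calc 12 * D * ρ ^ (-η) * x ^ (1 - t) * Z = (12 * D * Z) * ρ * ρ ^ (-(1 + η)) * x ^ (1 - t) := by
          rw [e1]; ring
      _ ≤ (x ^ η * δ) * ρ * x ^ (t - η) * x ^ (1 - t) := by gcongr
      _ = δ * ρ * (x ^ (t - η) * x ^ (1 - t) * x ^ η) := by ring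
      _ = δ * ρ * x := by rw [e3]
  · intro m hm
    have hm' : (m : ℝ) ≠ 0 := by exact_mod_cast hm
    have hma : 0 < |(m : ℝ)| := abs_pos.mpr hm'
    have hρm : 0 < ρ * |(m : ℝ)| := by positivity
    have habs : |ρ * (m : ℝ)| = ρ * |(m : ℝ)| := by rw [abs_mul, abs_of_pos hρ0]
    have hpow : ρ * (ρ * |(m : ℝ)|) ^ (-(1 + η)) = ρ ^ (-η) * |(m : ℝ)| ^ (-(1 + η)) := by
      rw [Real.mul_rpow hρ0.le hma.le, ← mul_assoc, ← Real.rpow_one_add' hρ0.le (by linarith)]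
      congr 2; ring
    have key : ‖𝓕 G (ρ * m)‖ * ‖∑ n ∈ Finset.Ioc N N',
        (ArithmeticFunction.vonMangoldt n : ℂ) * addExp (m * (σ * φ n))‖ ≤
        12 * D * x ^ (1 - t) * (ρ * |(m : ℝ)|) ^ (-(1 + η)) := by
      rcases le_or_gt |(m : ℝ)| (x ^ t) with hmt | hmt
      · have hS : ‖∑ n ∈ Finset.Ioc N N',
            (ArithmeticFunction.vonMangoldt n : ℂ) * addExp (m * (σ * φ n))‖ ≤ x ^ (1 - t) := by
          have h1 := H N' hNN' hN' m.natAbs (Int.natAbs_pos.mpr hm)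
          rw [Nat.cast_natAbs, Int.cast_abs] at h1
          refine le_of_eq_of_le ?_ (h1 hmt)
          -- The signs of `m` and `σ` cost nothing: a negative frequency gives the conjugate sum, as
          -- the weights are real.
          have h2 : (m : ℝ) * σ = |(m : ℝ)| ∨ (m : ℝ) * σ = -|(m : ℝ)| := by
            rcases hσ with rfl | rfl
            · rcases abs_choice (m : ℝ) with h | h
              · left; rw [h]; ring
              · right; rw [h]; ring
            · rcases abs_choice (m : ℝ) with h | h
              · right; rw [h]; ring
              · left; rw [h]; ring
          simp_rw [← mul_assoc]
          rcases h2 with h2 | h2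
          · rw [h2]
          · rw [h2, ← Complex.norm_conj, map_sum]
            congr 1
            refine Finset.sum_congr rfl fun n _ => ?_
            rw [map_mul, Complex.conj_ofReal, ← addExp_neg, neg_mul, neg_neg]
        have hG : ‖𝓕 G (ρ * m)‖ ≤ D * (ρ * |(m : ℝ)|) ^ (-(1 + η)) := by
          rw [← habs]
          refine (hb₁ _ (mul_ne_zero hρ0.ne' hm')).trans ?_
          gcongr
          exact le_max_left _ _
        calc _ ≤ (D * (ρ * |(m : ℝ)|) ^ (-(1 + η))) * x ^ (1 - t) := by gcongr
          _ = 1 * (D * x ^ (1 - t) * (ρ * |(m : ℝ)|) ^ (-(1 + η))) := by ring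
          _ ≤ 12 * (D * x ^ (1 - t) * (ρ * |(m : ℝ)|) ^ (-(1 + η))) := by gcongr; norm_num
          _ = _ := by ring
      · have hS : ‖∑ n ∈ Finset.Ioc N N',
            (ArithmeticFunction.vonMangoldt n : ℂ) * addExp (m * (σ * φ n))‖ ≤ 12 * x := by
          refine (norm_sum_le _ _).trans (le_trans (Finset.sum_le_sum fun n _ => ?_)
            (sum_Ioc_vonMangoldt_le hN'))
          rw [norm_mul, norm_addExp, mul_one, Complex.norm_real,
            Real.norm_of_nonneg ArithmeticFunction.vonMangoldt_nonneg]
        have hbig : x ^ (t - t') ≤ ρ * |(m : ℝ)| := by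
          rw [sub_eq_neg_add, Real.rpow_add hx0]
          gcongr
        have hG : ‖𝓕 G (ρ * m)‖ ≤ D * ((ρ * |(m : ℝ)|) ^ (-(1 + η)) * x ^ (-t)) := by
          refine (hb₂ _ (mul_ne_zero hρ0.ne' hm')).trans ?_
          rw [habs, neg_add, Real.rpow_add hρm]
          have : (ρ * |(m : ℝ)|) ^ (-(t / (t - t'))) ≤ x ^ (-t) := by
            calc _ ≤ (x ^ (t - t')) ^ (-(t / (t - t'))) :=
                  Real.rpow_le_rpow_of_nonpos (Real.rpow_pos_of_pos hx0 _) hbig (by linarith)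
              _ = _ := by
                rw [← Real.rpow_mul hx0.le]
                congr 1
                have : t - t' ≠ 0 := by linarith
                field_simp
          gcongr
          exact le_max_right _ _
        calc _ ≤ D * ((ρ * |(m : ℝ)|) ^ (-(1 + η)) * x ^ (-t)) * (12 * x) := by gcongr
          _ = 12 * D * (x * x ^ (-t)) * (ρ * |(m : ℝ)|) ^ (-(1 + η)) := by ring
          _ = _ := by
            rw [sub_eq_add_neg, Real.rpow_add hx0, Real.rpow_one]
    calc _ = ρ * (‖𝓕 G (ρ * m)‖ * ‖∑ n ∈ Finset.Ioc N N',
        (ArithmeticFunction.vonMangoldt n : ℂ) * addExp (m * (σ * φ n))‖) := by ring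
      _ ≤ ρ * (12 * D * x ^ (1 - t) * (ρ * |(m : ℝ)|) ^ (-(1 + η))) := by gcongr
      _ = 12 * D * x ^ (1 - t) * (ρ * (ρ * |(m : ℝ)|) ^ (-(1 + η))) := by ring
      _ = _ := by rw [hpow]; ring

open scoped SchwartzMap FourierTransform ContDiff in
lemma ContDiffBump.exists_schwartzMap {c : ℝ} (f : ContDiffBump c) :
    ∃ G : 𝓢(ℝ, ℂ), (∀ y, G y = (f y : ℂ)) ∧ 𝓕 G 0 = ((∫ y, f y : ℝ) : ℂ) := by
  have h1 : HasCompactSupport fun y => (f y : ℂ) :=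
    f.hasCompactSupport.comp_left Complex.ofReal_zero
  have h2 : ContDiff ℝ ∞ fun y => (f y : ℂ) := Complex.ofRealCLM.contDiff.comp f.contDiff
  refine ⟨h1.toSchwartzMap h2, fun y => rfl, ?_⟩
  rw [SchwartzMap.fourier_coe, Real.fourier_eq']
  simp only [inner_zero_right, mul_zero, Complex.ofReal_zero, zero_mul, Complex.exp_zero, one_smul]
  exact integral_ofReal

/-- A nonzero term needs `0 < x + k < ρ ≤ 1`, which singles out `k = -⌊x⌋`. -/
lemma tsum_dilate_le_indicator {f : ℝ → ℝ} (hf1 : ∀ y, f y ≤ 1)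
    (hf : ∀ y, f y ≠ 0 → y ∈ Set.Ioo 0 1) {ρ : ℝ} (hρ0 : 0 < ρ) (hρ1 : ρ ≤ 1) (x : ℝ) :
    ∑' k : ℤ, f ((x + k) / ρ) ≤ if Int.fract x < ρ then 1 else 0 := by
  have hk : ∀ k : ℤ, f ((x + k) / ρ) ≠ 0 → k = -⌊x⌋ ∧ Int.fract x < ρ := by
    intro k h
    obtain ⟨h1, h2⟩ := hf _ h
    rw [div_pos_iff_of_pos_right hρ0] at h1
    rw [div_lt_one hρ0] at h2
    have h3 : ⌊x⌋ = -k := by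
      rw [Int.floor_eq_iff]
      push_cast
      constructor <;> linarith
    refine ⟨by omega, ?_⟩
    rw [Int.fract, h3]
    push_cast
    linarith
  rw [tsum_eq_single (-⌊x⌋) fun k hk' => by
    by_contra h
    exact hk' (hk k h).1]
  split_ifs with h
  · exact hf1 _
  · by_contra h0
    push Not at h0
    exact h (hk _ h0.ne').2

lemma indicator_le_tsum_dilate {f : ℝ → ℝ} (hf0 : ∀ y, 0 ≤ f y) (hf1 : ∀ y ∈ Set.Icc 0 1, f y = 1)
    (hf : ∀ y, f y ≠ 0 → y ∈ Set.Ioo (-1) 2) {ρ : ℝ} (hρ0 : 0 < ρ) (x : ℝ) :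
    (if Int.fract x < ρ then 1 else 0) ≤ ∑' k : ℤ, f ((x + k) / ρ) := by
  split_ifs with h
  · have hs : Summable fun k : ℤ => f ((x + k) / ρ) := by
      refine summable_of_ne_finset_zero (s := Finset.Icc ⌊-ρ - x⌋ ⌈2 * ρ - x⌉) fun k hk => ?_
      by_contra h0
      obtain ⟨h1, h2⟩ := hf _ h0
      rw [lt_div_iff₀ hρ0] at h1
      rw [div_lt_iff₀ hρ0] at h2
      refine hk (Finset.mem_Icc.mpr ⟨?_, ?_⟩)
      · have : (⌊-ρ - x⌋ : ℝ) ≤ k := (Int.floor_le _).trans (by linarith)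
        exact_mod_cast this
      · have : (k : ℝ) ≤ ⌈2 * ρ - x⌉ := le_trans (by linarith) (Int.le_ceil _)
        exact_mod_cast this
    refine le_of_eq_of_le ?_ (hs.le_tsum (-⌊x⌋) fun k _ => hf0 _)
    rw [hf1]
    push_cast
    rw [← sub_eq_add_neg]
    exact ⟨div_nonneg (Int.fract_nonneg x) hρ0.le, (div_le_one hρ0).mpr h.le⟩
  · exact tsum_nonneg fun k => hf0 _

open scoped SchwartzMap FourierTransform in
open Filter in
/-- The values `σ φ n` are equidistributed modulo one, along `n` weighted by `Λ n`, on every scale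
`ρ ≥ N ^ (-t')`. -/
lemma eventually_abs_sum_vonMangoldt_fract_sub_le {φ : ℝ → ℝ} {t' t : ℝ}
    (ht' : 0 < t') (htt : t' < t) (ht1 : t ≤ 1)
    (H : ∀ᶠ N : ℕ in atTop, ∀ N' : ℕ, N ≤ N' → N' ≤ 2 * N → ∀ m : ℕ, 1 ≤ m →
      (m : ℝ) ≤ (N : ℝ) ^ t →
      ‖∑ n ∈ Finset.Ioc N N', (ArithmeticFunction.vonMangoldt n : ℂ) * addExp (m * φ n)‖ ≤
        (N : ℝ) ^ (1 - t)) {δ : ℝ} (hδ : 0 < δ) :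
    ∀ᶠ N : ℕ in atTop, ∀ N' : ℕ, N ≤ N' → N' ≤ 2 * N → ∀ ρ : ℝ, (N : ℝ) ^ (-t') ≤ ρ → ρ ≤ 1 →
      ∀ σ : ℝ, σ = 1 ∨ σ = -1 →
      |∑ n ∈ Finset.Ioc N N', ArithmeticFunction.vonMangoldt n *
        (if Int.fract (σ * φ n) < ρ then 1 else 0) -
        ρ * ∑ n ∈ Finset.Ioc N N', ArithmeticFunction.vonMangoldt n| ≤ δ * ρ * N := by
  -- The integrals of the bumps differ from `1` by at most `2ε`, which costs `2ε · 12 ρN` since the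
  -- total weight is at most `12 N`; the Poisson error adds `ε ρN`. Hence `25`.
  obtain ⟨ε, hε, hε4, hεδ⟩ : ∃ ε : ℝ, 0 < ε ∧ ε ≤ 1 / 4 ∧ ε * 25 ≤ δ :=
    ⟨min (1 / 4) (δ / 25), lt_min (by norm_num) (by positivity), min_le_left _ _, by
      have := min_le_right (1 / 4) (δ / 25)
      linarith⟩
  let f : ContDiffBump (1 / 2 : ℝ) := ⟨1 / 2 - ε, 1 / 2, by linarith, by linarith⟩
  let F : ContDiffBump (1 / 2 : ℝ) := ⟨1 / 2, 1 / 2 + ε, by norm_num, by linarith⟩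
  obtain ⟨g, hg, hg0⟩ := f.exists_schwartzMap
  obtain ⟨G, hG, hG0⟩ := F.exists_schwartzMap
  have hfI : 1 - 2 * ε ≤ ∫ y, f y := by
    have := f.measure_closedBall_le_integral (μ := MeasureTheory.volume)
    rw [Real.closedBall_eq_Icc, Real.volume_real_Icc, max_eq_left (by simp [f]; linarith)] at this
    simp only [f] at this ⊢
    linarith
  have hFI : ∫ y, F y ≤ 1 + 2 * ε := by
    have := F.integral_le_measure_closedBall (μ := MeasureTheory.volume)
    rw [Real.closedBall_eq_Icc, Real.volume_real_Icc, max_eq_left (by simp [F]; linarith)] at this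
    simp only [F] at this ⊢
    linarith
  have hfs : ∀ y, f y ≠ 0 → y ∈ Set.Ioo (0 : ℝ) 1 := by
    intro y hy
    have : y ∈ Function.support f := hy
    rw [f.support_eq, Real.ball_eq_Ioo] at this
    simp only [f] at this
    norm_num at this
    exact this
  have hFs : ∀ y, F y ≠ 0 → y ∈ Set.Ioo (-1 : ℝ) 2 := by
    intro y hy
    have : y ∈ Function.support F := hy
    rw [F.support_eq, Real.ball_eq_Ioo] at this
    simp only [F] at this
    constructor <;> [have := this.1; have := this.2] <;> linarith
  have hF1 : ∀ y ∈ Set.Icc (0 : ℝ) 1, F y = 1 := by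
    intro y hy
    refine F.one_of_mem_closedBall ?_
    rw [Real.closedBall_eq_Icc]
    simp only [F]
    constructor <;> [have := hy.1; have := hy.2] <;> linarith
  filter_upwards [g.eventually_norm_sum_tsum_dilate_sub_le ht' htt ht1 H hε,
    G.eventually_norm_sum_tsum_dilate_sub_le ht' htt ht1 H hε, eventually_ge_atTop 1] with
    N e1 e2 hN1 N' hNN' hN' ρ hρ hρ1 σ hσ
  have hN0 : (0 : ℝ) < N := by exact_mod_cast hN1
  have hρ0 : 0 < ρ := (Real.rpow_pos_of_pos hN0 _).trans_le hρ
  replace e1 := e1 N' hNN' hN' ρ hρ hρ1 σ hσ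
  replace e2 := e2 N' hNN' hN' ρ hρ hρ1 σ hσ
  simp only [hg, hg0] at e1
  simp only [hG, hG0] at e2
  norm_cast at e1 e2
  rw [Real.norm_eq_abs, abs_le] at e1 e2
  have hW := sum_Ioc_vonMangoldt_le hN'
  set W := ∑ n ∈ Finset.Ioc N N', ArithmeticFunction.vonMangoldt n
  have hW0 : 0 ≤ W := Finset.sum_nonneg fun _ _ => ArithmeticFunction.vonMangoldt_nonneg
  have c1 : ∑ n ∈ Finset.Ioc N N', ArithmeticFunction.vonMangoldt n *
      ∑' k : ℤ, f ((σ * φ n + k) / ρ) ≤ ∑ n ∈ Finset.Ioc N N', ArithmeticFunction.vonMangoldt n *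
        (if Int.fract (σ * φ n) < ρ then 1 else 0) :=
    Finset.sum_le_sum fun n _ => mul_le_mul_of_nonneg_left
      (tsum_dilate_le_indicator (fun _ => f.le_one) hfs hρ0 hρ1 _)
      ArithmeticFunction.vonMangoldt_nonneg
  have c2 : ∑ n ∈ Finset.Ioc N N', ArithmeticFunction.vonMangoldt n *
        (if Int.fract (σ * φ n) < ρ then 1 else 0) ≤
      ∑ n ∈ Finset.Ioc N N', ArithmeticFunction.vonMangoldt n *
      ∑' k : ℤ, F ((σ * φ n + k) / ρ) :=
    Finset.sum_le_sum fun n _ => mul_le_mul_of_nonneg_left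
      (indicator_le_tsum_dilate (fun _ => F.nonneg) hF1 hFs hρ0 _)
      ArithmeticFunction.vonMangoldt_nonneg
  have d1 : ρ * (1 - 2 * ε) * W ≤ ρ * (∫ y, f y) * W := by gcongr
  have d2 : ρ * (∫ y, F y) * W ≤ ρ * (1 + 2 * ε) * W := by gcongr
  have d3 : ε * ρ * W ≤ ε * ρ * (12 * N) := by gcongr
  have d4 : ε * 25 * (ρ * N) ≤ δ * (ρ * N) := by gcongr
  rw [abs_le]
  constructor
  · linarith [e1.1]
  · linarith [e2.2]

/-! ### The weight `ψ` and the exponent condition. -/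

-- The ratio limit with `k = 0` says `ψ ∼ φ₂'`, and `y φ₂' / φ₂ → 1 / c`. This reduces the size and
-- variation of `ψ` to those of `φ₂`.
open Filter Topology in
lemma AdmissibleWeight.tendsto_mul_div {d : ℕ} {c : ℝ} {h ψ : ℝ → ℝ} (hc : 1 ≤ c)
    (hh : InClassR c h) (hψ : AdmissibleWeight d (inverseOnIciOne h) ψ) :
    Tendsto (fun y => ψ y * y / inverseOnIciOne h y) atTop (𝓝 (1 / c)) := by
  obtain ⟨a, b, e, T, f₂, g₁, ha, -, -, -, -, hd, -⟩ := hh.inverse_derivatives hc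
  have hc0 : 0 < 1 / c := by positivity
  have h1 := (hψ.tendsto_ratio 0 (Nat.zero_le _)).mul ha
  rw [one_mul] at h1
  refine h1.congr' ?_
  filter_upwards [hd, ha.eventually (lt_mem_nhds hc0), eventually_gt_atTop 0,
    (hh.inverse_spec hc).2.2.1.eventually (eventually_gt_atTop 0)] with y hd ha hy hφ
  rw [iteratedDeriv_zero, zero_add, iteratedDeriv_one, hd.deriv]
  field_simp

-- The quotient `φ(y) / y²` is eventually decreasing, because `y φ' / φ → 1 / c < 2`.
open Filter Topology in
lemma InClassR.eventually_inverse_le_sq_mul {c : ℝ} {h : ℝ → ℝ} (hc : 1 ≤ c) (hh : InClassR c h) :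
    ∀ᶠ x in atTop, ∀ y, x ≤ y →
      inverseOnIciOne h x ≤ inverseOnIciOne h y ∧
      inverseOnIciOne h y ≤ (y / x) ^ 2 * inverseOnIciOne h x := by
  obtain ⟨a, b, e, T, f₂, g₁, ha, -, -, -, -, hd, -⟩ := hh.inverse_derivatives hc
  have hc1 : 1 / c < 2 := by
    rw [div_lt_iff₀ (by linarith)]
    linarith
  obtain ⟨-, hmono, htop, -⟩ := hh.inverse_spec hc
  have hev := eventually_forall_ge_atTop.mpr (hd.and ((ha.eventually (gt_mem_nhds hc1)).and
    (htop.eventually (eventually_gt_atTop 0))))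
  filter_upwards [hev, eventually_gt_atTop 1] with x hev hx y hxy
  have hx0 : 0 < x := by linarith
  have hy0 : 0 < y := by linarith
  refine ⟨hmono.monotoneOn hx.le (hx.le.trans hxy) hxy, ?_⟩
  have hder : ∀ z, x ≤ z → HasDerivAt (fun z => inverseOnIciOne h z / z ^ 2)
      ((inverseOnIciOne h z * a z / z * z ^ 2 - inverseOnIciOne h z * (2 * z)) / (z ^ 2) ^ 2)
      z := by
    intro z hz
    have hz0 : z ≠ 0 := by linarith
    have h2 : HasDerivAt (fun z : ℝ => z ^ 2) (2 * z) z := by simpa using hasDerivAt_pow 2 z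
    exact (hev z hz).1.div h2 (pow_ne_zero 2 hz0)
  have hanti : AntitoneOn (fun z => inverseOnIciOne h z / z ^ 2) (Set.Ici x) := by
    refine antitoneOn_of_deriv_nonpos (convex_Ici x)
      (fun z hz => (hder z hz).continuousAt.continuousWithinAt)
      (fun z hz => (hder z (interior_subset hz)).differentiableAt.differentiableWithinAt)
      fun z hz => ?_
    have hz' := interior_subset hz
    have hz0 : 0 < z := lt_of_lt_of_le hx0 hz'
    rw [(hder z hz').deriv]
    obtain ⟨-, e1, e2⟩ := hev z hz'
    refine div_nonpos_of_nonpos_of_nonneg ?_ (by positivity)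
    have : inverseOnIciOne h z * a z / z * z ^ 2 - inverseOnIciOne h z * (2 * z) =
        inverseOnIciOne h z * z * (a z - 2) := by
      field_simp
    rw [this]
    exact mul_nonpos_of_nonneg_of_nonpos (by positivity) (by linarith)
  have := hanti (Set.mem_Ici.mpr le_rfl) hxy hxy
  beta_reduce at this
  rw [div_le_div_iff₀ (by positivity) (by positivity)] at this
  rw [div_pow, div_mul_eq_mul_div, le_div_iff₀ (by positivity)]
  linarith

open Filter Topology in
/-- An admissible weight varies slowly on short multiplicative intervals. -/
lemma AdmissibleWeight.exists_forall_mem_Icc {d : ℕ} {c : ℝ} {h ψ : ℝ → ℝ} (hc : 1 ≤ c)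
    (hh : InClassR c h) (hψ : AdmissibleWeight d (inverseOnIciOne h) ψ) {κ : ℝ} (hκ : 1 < κ) :
    ∃ l : ℝ, 1 < l ∧ l ≤ κ ∧ ∀ᶠ x in atTop, ∀ y ∈ Set.Icc x (l * x),
      ψ y ∈ Set.Icc (ψ x / κ) (κ * ψ x) := by
  -- Two factors `l` come from replacing `ψ y · y / φ y` by its limit at `x` and at `y`, and two
  -- from `φ y ≤ l² φ x`.
  obtain ⟨l, hl1, hl4⟩ : ∃ l : ℝ, 1 < l ∧ l ^ 4 = κ := by
    refine ⟨κ ^ (1 / 4 : ℝ), Real.one_lt_rpow hκ (by norm_num), ?_⟩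
    rw [← Real.rpow_natCast, ← Real.rpow_mul (by linarith)]
    norm_num
  have hc0 : 0 < 1 / c := by positivity
  have hlim := hψ.tendsto_mul_div hc hh
  have b1 : 1 / c / l < 1 / c := div_lt_self hc0 hl1
  have b2 : 1 / c < 1 / c * l := lt_mul_of_one_lt_right hc0 hl1
  have hev := eventually_forall_ge_atTop.mpr ((hlim.eventually (lt_mem_nhds b1)).and
    ((hlim.eventually (gt_mem_nhds b2)).and
    ((hh.inverse_spec hc).2.2.1.eventually (eventually_gt_atTop 0))))
  refine ⟨l, hl1, ?_, ?_⟩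
  · rw [← hl4]
    exact le_self_pow₀ hl1.le (by norm_num)
  filter_upwards [hev, hh.eventually_inverse_le_sq_mul hc, eventually_gt_atTop 0] with
    x hev hφ hx y hy
  obtain ⟨x1, x2, x3⟩ := hev x le_rfl
  obtain ⟨y1, y2, y3⟩ := hev y hy.1
  obtain ⟨z1, z2⟩ := hφ y hy.1
  have hy0 : 0 < y := hx.trans_le hy.1
  have hl0 : 0 < l := by linarith
  set γ := 1 / c
  set u := inverseOnIciOne h x
  set v := inverseOnIciOne h y
  rw [lt_div_iff₀ x3] at x1
  rw [lt_div_iff₀ y3] at y1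
  rw [div_lt_iff₀ x3] at x2
  rw [div_lt_iff₀ y3] at y2
  have hyx : y / x ≤ l := (div_le_iff₀ hx).mpr hy.2
  have hv : v ≤ l ^ 2 * u := z2.trans (by gcongr)
  constructor
  · rw [div_le_iff₀ (by linarith), ← mul_le_mul_iff_of_pos_right hx]
    calc ψ x * x ≤ γ * l * u := x2.le
      _ ≤ γ * l * v := by gcongr
      _ = γ / l * v * l ^ 2 := by field_simp
      _ ≤ ψ y * y * l ^ 2 := by gcongr
      _ ≤ ψ y * (l * x) * l ^ 2 := by
        have : 0 ≤ ψ y := by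
          by_contra! hneg
          have : 0 ≤ γ / l * v := by positivity
          nlinarith
        gcongr
        exact hy.2
      _ = ψ y * l ^ 3 * x := by ring
      _ ≤ ψ y * κ * x := by
        have : 0 ≤ ψ y := by
          by_contra! hneg
          have : 0 ≤ γ / l * v := by positivity
          nlinarith
        rw [← hl4]
        gcongr
        · exact hl1.le
        · norm_num
  · rw [← mul_le_mul_iff_of_pos_right hy0]
    calc ψ y * y ≤ γ * l * v := y2.le
      _ ≤ γ * l * (l ^ 2 * u) := by gcongr
      _ = l ^ 4 * (γ / l * u) := by field_simp
      _ ≤ l ^ 4 * (ψ x * x) := by gcongr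
      _ = κ * ψ x * x := by rw [hl4]; ring
      _ ≤ κ * ψ x * y := by
        have : 0 ≤ ψ x := by
          by_contra! hneg
          have : 0 ≤ γ / l * u := by positivity
          nlinarith
        gcongr
        exact hy.1

-- `ψ` has size `y ^ (1 / c - 1 + o(1))`. The factor `2` keeps `ψ / (1 + s)` above `y ^ (-t)` as
-- well.
open Filter Topology in
lemma AdmissibleWeight.eventually_rpow_le {d : ℕ} {c : ℝ} {h ψ : ℝ → ℝ} (hc : 1 ≤ c)
    (hh : InClassR c h) (hψ : AdmissibleWeight d (inverseOnIciOne h) ψ) {t : ℝ}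
    (ht : 1 - 1 / c < t) : ∀ᶠ y : ℝ in atTop, 2 * y ^ (-t) ≤ ψ y := by
  have hc0 : 0 < 1 / c := by positivity
  set ε := (t - (1 - 1 / c)) / 2 with hε
  have hε0 : 0 < ε := by linarith
  have hb : 1 / c / 2 < 1 / c := by linarith
  filter_upwards [(hψ.tendsto_mul_div hc hh).eventually (lt_mem_nhds hb),
    hh.inverse_growth hc ε hε0, eventually_gt_atTop 0,
    (tendsto_rpow_atTop hε0).eventually_ge_atTop (4 / (1 / c))] with y h1 h2 hy h3
  have hφ : 0 < inverseOnIciOne h y := (Real.rpow_pos_of_pos hy _).trans_le h2.1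
  rw [lt_div_iff₀ hφ] at h1
  rw [div_le_iff₀ hc0] at h3
  rw [← mul_le_mul_iff_of_pos_right hy]
  have e1 : y ^ (-t) * y = y ^ (-t + 1) := by rw [Real.rpow_add hy, Real.rpow_one]
  have e2 : y ^ (1 / c - ε) = y ^ (-t + 1) * y ^ ε := by
    rw [← Real.rpow_add hy]; congr 1; rw [hε]; ring
  have hp := Real.rpow_pos_of_pos hy (-t + 1)
  calc 2 * y ^ (-t) * y = 4 * y ^ (-t + 1) / 2 := by rw [mul_assoc, e1]; ring
    _ ≤ (y ^ ε * (1 / c)) * y ^ (-t + 1) / 2 := by gcongr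
    _ = 1 / c / 2 * y ^ (1 / c - ε) := by rw [e2]; ring
    _ ≤ 1 / c / 2 * inverseOnIciOne h y := by gcongr; exact h2.1
    _ ≤ ψ y * y := h1.le

/-- The extreme case is `d = 1`, whose first inequality is exactly `15 (1 - γ₂) < γ₁`. The others
give smaller multiples of `γ₁`: `3/62`, at most `1/24` for `3 ≤ d ≤ 9`, and `2 / (3d(d+1)²)` for `d
≥ 10`. -/
lemma AdmissibleExponents.one_sub_lt {d : ℕ} (hd : 1 ≤ d) {γ₁ γ₂ : ℝ} (h₁ : 1 / 2 < γ₁)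
    (h₂ : γ₂ ≤ 1) (h : AdmissibleExponents d γ₁ γ₂) : 1 - γ₂ < γ₁ / 15 := by
  obtain ⟨a1, a2, a3, a4⟩ := h
  rcases Nat.lt_or_ge d 10 with hd10 | hd10
  · interval_cases d
    · have := a1 rfl
      linarith
    · have := a2 rfl
      linarith
    all_goals
      have := a3 ⟨by norm_num, by norm_num⟩
      norm_num at this
      linarith
  · have h10 := a4 hd10
    have hdR : (10 : ℝ) ≤ d := by exact_mod_cast hd10
    have hK : 0 < 3 * (d : ℝ) * ((d : ℝ) + 1) ^ 2 := by positivity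
    have hB : 0 ≤ 1 / (3 * (d : ℝ) * ((d : ℝ) + 1)) * (1 - γ₂) := by
      have : 0 ≤ 1 - γ₂ := by linarith
      positivity
    have h5 : (1 : ℝ) - γ₂ < 2 / (3 * (d : ℝ) * ((d : ℝ) + 1) ^ 2) * γ₁ := by linarith
    have h6 : 2 / (3 * (d : ℝ) * ((d : ℝ) + 1) ^ 2) ≤ 1 / 15 := by
      rw [div_le_div_iff₀ hK (by norm_num)]
      nlinarith
    have h7 := mul_le_mul_of_nonneg_right h6 (show 0 ≤ γ₁ by linarith)
    linarith

/-! ### Counting primes on short multiplicative blocks. -/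

/-- The number of primes `p ∈ (M, N]` with `f p < ψ p`. -/
noncomputable def countIoc (f ψ : ℝ → ℝ) (M N : ℕ) : ℝ :=
  ∑ n ∈ Finset.Ioc M N, if n.Prime ∧ f n < ψ n then 1 else 0

lemma countIoc_add {f ψ : ℝ → ℝ} {L M N : ℕ} (h₁ : L ≤ M) (h₂ : M ≤ N) :
    countIoc f ψ L M + countIoc f ψ M N = countIoc f ψ L N :=
  Finset.sum_Ioc_consecutive _ h₁ h₂

lemma countIoc_mul_log_le {f ψ : ℝ → ℝ} {N N' : ℕ} {ρ : ℝ} (hN : 1 ≤ N)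
    (hψ : ∀ n ∈ Finset.Ioc N N', ψ n ≤ ρ) :
    countIoc f ψ N N' * Real.log N ≤ ∑ n ∈ Finset.Ioc N N', ArithmeticFunction.vonMangoldt n *
      (if f n < ρ then 1 else 0) := by
  rw [countIoc, Finset.sum_mul]
  refine Finset.sum_le_sum fun n hn => ?_
  have hnn := Finset.mem_Ioc.mp hn
  have h0 := ArithmeticFunction.vonMangoldt_nonneg (n := n)
  by_cases h : n.Prime ∧ f n < ψ n
  · rw [if_pos h, if_pos (h.2.trans_le (hψ n hn)), one_mul, mul_one,
      ArithmeticFunction.vonMangoldt_apply_prime h.1]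
    exact Real.log_le_log (by exact_mod_cast hN) (by exact_mod_cast hnn.1.le)
  · rw [if_neg h, zero_mul]
    split_ifs <;> simp [h0]

/-- Primes weigh at most `log N'`; the terms that are not prime contribute at most the difference of
the two Chebyshev functions, which is the remainder on the right. -/
lemma sum_vonMangoldt_le_countIoc_mul_log {f ψ : ℝ → ℝ} {N N' : ℕ} {ρ : ℝ} (hNN' : N < N')
    (hψ : ∀ n ∈ Finset.Ioc N N', ρ ≤ ψ n) :
    ∑ n ∈ Finset.Ioc N N', ArithmeticFunction.vonMangoldt n * (if f n < ρ then 1 else 0) ≤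
      countIoc f ψ N N' * Real.log N' + 2 * √(N' : ℝ) * Real.log N' := by
  have h1 : ∑ n ∈ Finset.Ioc N N', (if n.Prime then 0 else ArithmeticFunction.vonMangoldt n) ≤
      2 * √(N' : ℝ) * Real.log N' := by
    have hN' : (1 : ℝ) ≤ N' := by exact_mod_cast (show 1 ≤ N' by omega)
    refine le_trans ?_ (Chebyshev.psi_sub_theta_le hN')
    rw [Chebyshev.psi_sub_theta_eq_sum_not_prime, Nat.floor_natCast, Finset.sum_filter]
    refine le_trans (le_of_eq ?_) (Finset.sum_le_sum_of_subset_of_nonneg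
      (Finset.Ioc_subset_Ioc_left (Nat.zero_le N)) fun n _ _ => ?_)
    · refine Finset.sum_congr rfl fun n _ => ?_
      split_ifs <;> simp_all
    · split_ifs
      · exact le_rfl
      · exact ArithmeticFunction.vonMangoldt_nonneg
  refine le_trans ?_ (add_le_add_right h1 _)
  rw [countIoc, Finset.sum_mul, ← Finset.sum_add_distrib]
  refine Finset.sum_le_sum fun n hn => ?_
  have hnn := Finset.mem_Ioc.mp hn
  have h0 := ArithmeticFunction.vonMangoldt_nonneg (n := n)
  have hl := Real.log_natCast_nonneg N'
  by_cases hp : n.Prime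
  · rw [if_pos hp, add_zero]
    by_cases h : f n < ρ
    · rw [if_pos h, if_pos ⟨hp, h.trans_le (hψ n hn)⟩, one_mul, mul_one,
        ArithmeticFunction.vonMangoldt_apply_prime hp]
      exact Real.log_le_log (by exact_mod_cast hp.pos) (by exact_mod_cast hnn.2)
    · rw [if_neg h, mul_zero]
      split_ifs <;> simp [hl]
  · rw [if_neg hp, if_neg (show ¬(n.Prime ∧ f n < ψ n) from fun h => hp h.1), zero_mul, zero_add]
    split_ifs <;> simp [h0]

lemma AdmissibleWeight.intervalIntegrable {d : ℕ} {φ ψ : ℝ → ℝ} (hψ : AdmissibleWeight d φ ψ)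
    {a b : ℝ} (ha : 2 ≤ a) (hab : a ≤ b) :
    IntervalIntegrable (fun x => ψ x / Real.log x) MeasureTheory.volume a b := by
  rw [intervalIntegrable_iff_integrableOn_Ioc_of_le hab]
  have hsub : Set.Ioc a b ⊆ Set.Ici 1 := fun x hx => by
    have := hx.1
    exact Set.mem_Ici.mpr (by linarith)
  refine MeasureTheory.Integrable.of_bound ?_ (1 / 2 / Real.log 2) ?_
  · exact ((hψ.measurable.mono_measure (MeasureTheory.Measure.restrict_mono hsub le_rfl)).div
      Real.measurable_log.aemeasurable).aestronglyMeasurable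
  · refine (MeasureTheory.ae_restrict_mem measurableSet_Ioc).mono fun x hx => ?_
    have hx1 : 1 ≤ x := hsub hx
    have hx2 : 2 < x := ha.trans_lt hx.1
    have hl2 : 0 < Real.log 2 := Real.log_pos (by norm_num)
    have hlx : Real.log 2 ≤ Real.log x := Real.log_le_log (by norm_num) hx2.le
    rw [Real.norm_of_nonneg (div_nonneg (hψ.pos x hx1).le (by linarith))]
    exact div_le_div₀ (by norm_num) (hψ.le_half x hx1) hl2 hlx

/-- Comparison of the prime count and the integral on one block, given the distribution of the
weighted sums. -/
lemma abs_sub_le_of_block_bounds {s p e L TΔ C S₁ S₂ W N δ E L' : ℝ}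
    (hs : 0 < s) (hs1 : s ≤ 1 / 10) (hp : 0 < p) (he : 0 < e) (hL : 0 < L) (hLL' : L ≤ L')
    (hL' : L' ≤ (1 + s) * L) (hδ : δ * N ≤ s * e)
    (hW : |W - e| ≤ δ * N) (hS₁ : |S₁ - p / (1 + s) * W| ≤ δ * (p / (1 + s)) * N)
    (hS₂ : |S₂ - (1 + s) * p * W| ≤ δ * ((1 + s) * p) * N) (hE : E ≤ δ * N * p) (hC0 : 0 ≤ C)
    (hC₁ : C * L ≤ S₂) (hC₂ : S₁ ≤ C * L' + E)
    (hT₁ : p / (1 + s) / L' * e ≤ TΔ) (hT₂ : TΔ ≤ (1 + s) * p / L * e) :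
    |C - TΔ| ≤ 10 * s * TΔ := by
  set k := 1 + s with hk
  have hk0 : 0 < k := by linarith
  have hk1 : k ≤ 11 / 10 := by linarith
  set u := p * e / L with hu
  have hu0 : 0 < u := by positivity
  rw [abs_le] at hW hS₁ hS₂
  have hup : C ≤ k * (1 + 2 * s) * u := by
    rw [hu, mul_div_assoc', le_div_iff₀ hL]
    have h1 : k * p * W ≤ k * p * ((1 + s) * e) := by gcongr; linarith
    have h2 : δ * (k * p) * N ≤ k * p * (s * e) := by
      calc δ * (k * p) * N = k * p * (δ * N) := by ring
        _ ≤ _ := by gcongr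
    linarith
  have hlow : (1 - 4 * s) * u ≤ k ^ 2 * C := by
    rw [hu, mul_div_assoc', div_le_iff₀ hL]
    have h1 : p / k * ((1 - s) * e) ≤ p / k * W := by gcongr; linarith
    have h2 : δ * (p / k) * N ≤ p / k * (s * e) := by
      calc δ * (p / k) * N = p / k * (δ * N) := by ring
        _ ≤ _ := by gcongr
    have h3 : E ≤ p * (s * e) := by
      calc E ≤ p * (δ * N) := by linarith
        _ ≤ _ := by gcongr
    have h4 : C * L' ≤ C * (k * L) := by gcongr
    have h5 : p / k * ((1 - 2 * s) * e) - p * (s * e) ≤ C * (k * L) := by linarith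
    have h6 : p / k * ((1 - 2 * s) * e) * k = p * ((1 - 2 * s) * e) := by field_simp
    have h7 := mul_le_mul_of_nonneg_right h5 hk0.le
    rw [sub_mul, h6] at h7
    have h8 : p * (s * e) * k ≤ p * (s * e) * 2 := by gcongr; linarith
    nlinarith
  have hTlow : u ≤ k ^ 2 * TΔ := by
    have h1 : p / k / (k * L) * e ≤ TΔ := by
      refine le_trans ?_ hT₁
      gcongr
      linarith
    have h2 : u = k ^ 2 * (p / k / (k * L) * e) := by
      rw [hu]; field_simp
    rw [h2]
    gcongr
  have hTup : TΔ ≤ k * u := by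
    refine hT₂.trans (le_of_eq ?_)
    rw [hu]; ring
  have hT0 : 0 < TΔ := by
    by_contra! h
    nlinarith [sq_nonneg k]
  rw [abs_le]
  -- One factor `k` comes from replacing `ψ` by a constant in the count, two more from comparing `u`
  -- with the integral, where both `ψ` and `log` vary; for `s ≤ 1/10` the constant `10` covers the
  -- expansion.
  have k3 : k ^ 3 * (1 + 2 * s) ≤ 1 + 10 * s := by
    rw [hk]
    nlinarith [mul_pos hs hs, mul_pos (mul_pos hs hs) hs]
  have k3' : (1 - 10 * s) * k ^ 3 ≤ 1 - 4 * s := by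
    rw [hk]
    nlinarith [mul_pos hs hs, mul_pos (mul_pos hs hs) hs, mul_pos (mul_pos (mul_pos hs hs) hs) hs]
  constructor
  · have h1 : k ^ 2 * ((1 - 10 * s) * TΔ) ≤ k ^ 2 * C := by
      calc k ^ 2 * ((1 - 10 * s) * TΔ) = k ^ 2 * (1 - 10 * s) * TΔ := by ring
        _ ≤ k ^ 2 * (1 - 10 * s) * (k * u) := by gcongr; nlinarith
        _ = (1 - 10 * s) * k ^ 3 * u := by ring
        _ ≤ (1 - 4 * s) * u := by gcongr
        _ ≤ _ := hlow
    have := le_of_mul_le_mul_left h1 (by positivity)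
    linarith
  · have : C ≤ (1 + 10 * s) * TΔ := by
      calc C ≤ k * (1 + 2 * s) * u := hup
        _ ≤ k * (1 + 2 * s) * (k ^ 2 * TΔ) := by gcongr
        _ = k ^ 3 * (1 + 2 * s) * TΔ := by ring
        _ ≤ _ := by gcongr
    linarith

lemma sum_Ioc_vonMangoldt_eq {N N' : ℕ} (h : N ≤ N') :
    ∑ n ∈ Finset.Ioc N N', ArithmeticFunction.vonMangoldt n =
      Chebyshev.psi N' - Chebyshev.psi N := by
  rw [Chebyshev.psi, Chebyshev.psi, Nat.floor_natCast, Nat.floor_natCast,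
    ← Finset.sum_Ioc_consecutive _ (Nat.zero_le N) h, add_sub_cancel_left]

set_option maxHeartbeats 800000 in
open Filter Topology in
/-- On a short multiplicative interval the count of primes is close to the integral. -/
lemma AdmissibleWeight.exists_block {d : ℕ} {c : ℝ} {h ψ f : ℝ → ℝ} (hc : 1 ≤ c)
    (hh : InClassR c h) (hψ : AdmissibleWeight d (inverseOnIciOne h) ψ) {t : ℝ}
    (ht : 1 - 1 / c < t) (ht2 : t < 1 / 2)
    (hE : ∀ δ : ℝ, 0 < δ → ∀ᶠ N : ℕ in atTop, ∀ N' : ℕ, N ≤ N' → N' ≤ 2 * N → ∀ ρ : ℝ,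
      (N : ℝ) ^ (-t) ≤ ρ → ρ ≤ 1 →
      |∑ n ∈ Finset.Ioc N N', ArithmeticFunction.vonMangoldt n * (if f n < ρ then 1 else 0) -
        ρ * ∑ n ∈ Finset.Ioc N N', ArithmeticFunction.vonMangoldt n| ≤ δ * ρ * N)
    {s : ℝ} (hs : 0 < s) (hs1 : s ≤ 1 / 10) :
    ∃ l : ℝ, 1 < l ∧ ∀ᶠ N : ℕ in atTop, ∀ N' : ℕ, (1 + (l - 1) / (2 * l)) * (N : ℝ) ≤ N' →
      (N' : ℝ) ≤ l * N →
      |countIoc f ψ N N' - ∫ x in (N : ℝ)..N', ψ x / Real.log x| ≤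
        10 * s * ∫ x in (N : ℝ)..N', ψ x / Real.log x := by
  obtain ⟨l, hl1, hls, hvar⟩ := hψ.exists_forall_mem_Icc hc hh (show 1 < 1 + s by linarith)
  refine ⟨l, hl1, ?_⟩
  -- A block has length at least `c₀ N`, so an error `δ N` with `δ = s c₀` is at most the fraction
  -- `s` of the block. Shorter blocks would be lost in the error of the prime number theorem.
  set c₀ := (l - 1) / (2 * l) with hc₀
  have hc₀0 : 0 < c₀ := div_pos (by linarith) (by linarith)
  set δ := s * c₀ with hδ
  have hδ0 : 0 < δ := by positivity
  -- Prime powers contribute about `x ^ (1/2 + η)`, against a main term of at least `x ^ (1 - t) = x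
  -- ^ (1/2 + 2η)`.
  set η := (1 / 2 - t) / 2 with hη
  have hη0 : 0 < η := by linarith
  have hpnt : ∀ᶠ x : ℝ in atTop, |Chebyshev.psi x - x| ≤ δ / 3 * x := by
    have h1 := tendsto_psi_div_self.eventually (Metric.closedBall_mem_nhds 1
      (show 0 < δ / 3 by positivity))
    filter_upwards [h1, eventually_gt_atTop 0] with x h1 hx
    rw [Real.dist_eq, div_sub_one hx.ne', abs_div, abs_of_pos hx,
      div_le_iff₀ hx] at h1
    exact h1
  have hcast := tendsto_natCast_atTop_atTop (R := ℝ)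
  filter_upwards [hcast.eventually hvar, hcast.eventually (eventually_forall_ge_atTop.mpr hpnt),
    hE δ hδ0, hcast.eventually (hψ.eventually_rpow_le hc hh ht),
    hcast.eventually (Real.tendsto_log_atTop.eventually_ge_atTop (1 / s)),
    hcast.eventually (eventually_log_le_rpow hη0),
    hcast.eventually ((tendsto_rpow_atTop hη0).eventually_ge_atTop (1 / δ)),
    eventually_ge_atTop 2] with N hvar hpnt hE hψN hlogN hlog2 hδN hN2 N' hN'1 hN'2
  set x : ℝ := (N : ℝ) with hx
  have hx2 : 2 ≤ x := by rw [hx]; exact_mod_cast hN2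
  have hx0 : 0 < x := by linarith
  have he0 : c₀ * x ≤ (N' : ℝ) - x := by linarith
  have he : 0 < (N' : ℝ) - x := lt_of_lt_of_le (by positivity) he0
  have hNN'R : x < N' := by linarith
  have hNN' : N < N' := by rw [hx] at hNN'R; exact_mod_cast hNN'R
  have hl2 : l ≤ 2 := by linarith
  have hN'2x : (N' : ℝ) ≤ 2 * x := hN'2.trans (by gcongr)
  have hN'2N : N' ≤ 2 * N := by rw [hx] at hN'2x; exact_mod_cast hN'2x
  have hψ0 : 0 < ψ x := hψ.pos x (by linarith)
  have hψh : ψ x ≤ 1 / 2 := hψ.le_half x (by linarith)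
  have hxt := Real.rpow_pos_of_pos hx0 (-t)
  have hL0 : 0 < Real.log x := Real.log_pos (by linarith)
  have hLL' : Real.log x ≤ Real.log N' := Real.log_le_log hx0 hNN'R.le
  have hL' : Real.log N' ≤ (1 + s) * Real.log x := by
    have h1 : Real.log N' ≤ Real.log l + Real.log x := by
      rw [← Real.log_mul (by linarith) hx0.ne']
      exact Real.log_le_log (by linarith) hN'2
    have h2 := Real.log_le_sub_one_of_pos (show 0 < l by linarith)
    rw [div_le_iff₀ hs] at hlogN
    linarith
  have hk0 : 0 < 1 + s := by linarith
  have hmem : ∀ y, x ≤ y → y ≤ N' → ψ y ∈ Set.Icc (ψ x / (1 + s)) ((1 + s) * ψ x) :=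
    fun y h1 h2 => hvar y ⟨h1, h2.trans hN'2⟩
  have hmemn : ∀ n ∈ Finset.Ioc N N', ψ n ∈ Set.Icc (ψ x / (1 + s)) ((1 + s) * ψ x) := by
    intro n hn
    rw [Finset.mem_Ioc] at hn
    exact hmem n (by rw [hx]; exact_mod_cast hn.1.le) (by exact_mod_cast hn.2)
  have hint := hψ.intervalIntegrable hx2 hNN'R.le
  have hW : |∑ n ∈ Finset.Ioc N N', ArithmeticFunction.vonMangoldt n - ((N' : ℝ) - x)| ≤ δ * x := by
    rw [sum_Ioc_vonMangoldt_eq hNN'.le]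
    have h1 := hpnt x le_rfl
    have h2 := hpnt N' hNN'R.le
    have h3 : δ / 3 * (N' : ℝ) ≤ δ / 3 * (2 * x) := by gcongr
    rw [abs_le] at *
    constructor <;> linarith
  have hT₁ : ψ x / (1 + s) / Real.log N' * ((N' : ℝ) - x) ≤
      ∫ y in x..N', ψ y / Real.log y := by
    have h1 := intervalIntegral.integral_mono_on hNN'R.le
      (intervalIntegrable_const (c := ψ x / (1 + s) / Real.log N')) hint fun y hy => by
        have := (hmem y hy.1 hy.2).1
        have hly : 0 < Real.log y := Real.log_pos (by linarith [hy.1])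
        have hly' : Real.log y ≤ Real.log N' := Real.log_le_log (by linarith [hy.1]) hy.2
        exact div_le_div₀ (le_trans (by positivity) this) this hly hly'
    rw [intervalIntegral.integral_const, smul_eq_mul] at h1
    linarith
  have hT₂ : ∫ y in x..N', ψ y / Real.log y ≤
      (1 + s) * ψ x / Real.log x * ((N' : ℝ) - x) := by
    have h1 := intervalIntegral.integral_mono_on hNN'R.le hint
      (intervalIntegrable_const (c := (1 + s) * ψ x / Real.log x)) fun y hy => by
        have hly' : Real.log x ≤ Real.log y := Real.log_le_log hx0 hy.1
        exact div_le_div₀ (by positivity) (hmem y hy.1 hy.2).2 hL0 hly'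
    rw [intervalIntegral.integral_const, smul_eq_mul] at h1
    linarith
  have hrem : 2 * √(N' : ℝ) * Real.log N' ≤ δ * x * ψ x := by
    have h1 : √(N' : ℝ) ≤ 2 * x ^ (1 / 2 : ℝ) := by
      rw [← Real.sqrt_eq_rpow]
      calc √(N' : ℝ) ≤ √(2 ^ 2 * x) := Real.sqrt_le_sqrt (by linarith)
        _ = 2 * √x := by rw [Real.sqrt_mul (by norm_num), Real.sqrt_sq (by norm_num)]
    have h2 : Real.log N' ≤ x ^ η / 2 := by
      have := Real.log_le_log (by linarith) hN'2x
      linarith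
    rw [div_le_iff₀ hδ0] at hδN
    have e1 : x * x ^ (-t) = x ^ (1 / 2 : ℝ) * x ^ η * x ^ η := by
      rw [← Real.rpow_add hx0, ← Real.rpow_add hx0, ← Real.rpow_one_add' hx0.le (by linarith)]
      congr 1; rw [hη]; ring
    calc 2 * √(N' : ℝ) * Real.log N' ≤ 2 * (2 * x ^ (1 / 2 : ℝ)) * (x ^ η / 2) := by
          gcongr
      _ = 2 * (x ^ (1 / 2 : ℝ) * x ^ η) * 1 := by ring
      _ ≤ 2 * (x ^ (1 / 2 : ℝ) * x ^ η) * (x ^ η * δ) := by gcongr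
      _ = δ * (2 * (x ^ (1 / 2 : ℝ) * x ^ η * x ^ η)) := by ring
      _ = δ * x * (2 * x ^ (-t)) := by rw [← e1]; ring
      _ ≤ δ * x * ψ x := by gcongr
  have hρ₁ : x ^ (-t) ≤ ψ x / (1 + s) := by
    rw [le_div_iff₀ hk0]
    calc x ^ (-t) * (1 + s) ≤ x ^ (-t) * 2 := by gcongr; linarith
      _ ≤ ψ x := by linarith
  have hρ₁' : ψ x / (1 + s) ≤ 1 := by
    rw [div_le_one hk0]
    linarith
  have hρ₂ : x ^ (-t) ≤ (1 + s) * ψ x := by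
    have : 1 * ψ x ≤ (1 + s) * ψ x := by gcongr; linarith
    linarith
  -- Here `ψ ≤ 1/2` is needed: equidistribution is available only for scales `ρ ≤ 1`.
  have hρ₂' : (1 + s) * ψ x ≤ 1 := by
    calc (1 + s) * ψ x ≤ 2 * (1 / 2) := by gcongr; linarith
      _ = 1 := by norm_num
  refine abs_sub_le_of_block_bounds hs hs1 hψ0 he hL0 hLL' hL' (N := x) (δ := δ) ?_ hW
    (hE N' hNN'.le hN'2N _ hρ₁ hρ₁') (hE N' hNN'.le hN'2N _ hρ₂ hρ₂') hrem
    (Finset.sum_nonneg fun n _ => by split_ifs <;> norm_num)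
    (countIoc_mul_log_le (by omega) fun n hn => (hmemn n hn).2)
    (sum_vonMangoldt_le_countIoc_mul_log hNN' fun n hn => (hmemn n hn).1) hT₁ hT₂
  rw [hδ, mul_assoc]
  gcongr

-- Each large `M` is the right end of an admissible block starting at a smaller `M'`. The block
-- errors are multiples of increments of `T`, so they telescope by strong induction, and finitely
-- many small `M` go into the constant.
open Filter in
lemma exists_abs_sub_le_of_blocks {A T : ℕ → ℝ} {l ε : ℝ} (hl : 1 < l)
    (h : ∀ᶠ N : ℕ in atTop, ∀ N' : ℕ, (1 + (l - 1) / (2 * l)) * (N : ℝ) ≤ N' →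
      (N' : ℝ) ≤ l * N → |A N' - A N - (T N' - T N)| ≤ ε * (T N' - T N)) :
    ∃ C : ℝ, ∀ M : ℕ, |A M - T M| ≤ ε * T M + C := by
  obtain ⟨N₁, hN₁⟩ := eventually_atTop.mp h
  set q := 1 + (l - 1) / (2 * l) with hq
  have hl0 : 0 < l := by linarith
  have hq1 : 1 < q := by
    have : 0 < (l - 1) / (2 * l) := div_pos (by linarith) (by linarith)
    linarith
  have hql : q < l := by
    have : (l - 1) / (2 * l) < l - 1 := div_lt_self (by linarith) (by linarith)
    linarith
  have hcast := tendsto_natCast_atTop_atTop (R := ℝ)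
  obtain ⟨N₂, hN₂⟩ := eventually_atTop.mp ((hcast.eventually_ge_atTop (l * N₁)).and
    (hcast.eventually_ge_atTop (q / (1 - q / l))))
  refine ⟨∑ M ∈ Finset.range (N₂ + 1), (|A M - T M| + |ε * T M|), fun M => ?_⟩
  induction M using Nat.strong_induction_on with
  | _ M ih =>
    rcases Nat.lt_or_ge N₂ M with hM | hM
    · obtain ⟨h1, h2⟩ := hN₂ M hM.le
      have hql' : 0 < 1 - q / l := by
        have := (div_lt_one hl0).mpr hql
        linarith
      rw [div_le_iff₀ hql'] at h2
      -- Rounding up gives `M ≤ l M'`; since `q < l`, the rounding still leaves `q M' ≤ M` once `M ≥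
      -- q / (1 - q / l)`.
      set M' := ⌈(M : ℝ) / l⌉₊
      have hM0 : (0 : ℝ) < M := by exact_mod_cast Nat.zero_lt_of_lt hM
      have hM'0 : 0 < M' := Nat.ceil_pos.mpr (by positivity)
      have c1 : (M : ℝ) / l ≤ M' := Nat.le_ceil _
      have c2 : (M' : ℝ) < M / l + 1 := Nat.ceil_lt_add_one (by positivity)
      have c3 : q * (M' : ℝ) ≤ M := by
        have : q * (M' : ℝ) ≤ q * (M / l + 1) := by gcongr
        have e : (M : ℝ) * (1 - q / l) = M - q * (M / l) := by ring
        linarith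
      have c4 : (M' : ℝ) < M := by
        have : (0 : ℝ) < M' := by exact_mod_cast hM'0
        nlinarith
      have c5 : N₁ ≤ M' := by
        have : (N₁ : ℝ) ≤ M / l := by
          rw [le_div_iff₀ hl0]
          linarith
        exact_mod_cast this.trans c1
      rw [div_le_iff₀ hl0] at c1
      have b1 := hN₁ M' c5 M c3 (by linarith)
      have b2 := ih M' (by exact_mod_cast c4)
      rw [abs_le] at *
      constructor <;> linarith [b1.1, b1.2, b2.1, b2.2]
    · have := Finset.single_le_sum (f := fun M => |A M - T M| + |ε * T M|)
        (fun i _ => by positivity) (Finset.mem_range.mpr (Nat.lt_succ_of_le hM))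
      beta_reduce at this
      have h2 := neg_abs_le (ε * T M)
      linarith

-- As `1 - 1 / c < 1/2`, the integrand eventually exceeds `y ^ (-3/4)`, so the integral grows at
-- least like `N ^ (1/4)`; this divergence absorbs the constant left by chaining blocks.
open Filter in
lemma AdmissibleWeight.tendsto_integral {d : ℕ} {c : ℝ} {h ψ : ℝ → ℝ} (hc : 1 ≤ c)
    (hh : InClassR c h) (hψ : AdmissibleWeight d (inverseOnIciOne h) ψ) (hc2 : 1 - 1 / c < 1 / 2) :
    Tendsto (fun N : ℕ => ∫ x in (2 : ℝ)..(N : ℝ), ψ x / Real.log x) atTop atTop := by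
  have hcast := tendsto_natCast_atTop_atTop (R := ℝ)
  have hev : ∀ᶠ y : ℝ in atTop, y ^ (-(3 / 4) : ℝ) ≤ ψ y / Real.log y := by
    filter_upwards [hψ.eventually_rpow_le hc hh hc2,
      eventually_log_le_rpow (show (0 : ℝ) < 1 / 4 by norm_num), eventually_gt_atTop 1] with
      y h1 h2 hy
    have hy0 : 0 < y := by linarith
    have hl : 0 < Real.log y := Real.log_pos hy
    have hl2 : Real.log y ≤ y ^ (1 / 4 : ℝ) := by
      have := Real.log_le_log hy0 (show y ≤ 2 * y by linarith)
      linarith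
    rw [le_div_iff₀ hl]
    calc y ^ (-(3 / 4) : ℝ) * Real.log y ≤ y ^ (-(3 / 4) : ℝ) * y ^ (1 / 4 : ℝ) := by gcongr
      _ = y ^ (-(1 / 2) : ℝ) := by rw [← Real.rpow_add hy0]; norm_num
      _ ≤ 2 * y ^ (-(1 / 2) : ℝ) := by
        have := Real.rpow_pos_of_pos hy0 (-(1 / 2))
        linarith
      _ ≤ ψ y := h1
  obtain ⟨N₀, hN₀⟩ := eventually_atTop.mp ((hcast.eventually
    (eventually_forall_ge_atTop.mpr hev)).and (eventually_ge_atTop 2))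
  obtain ⟨hN₀, hN₀2⟩ := hN₀ N₀ le_rfl
  have hN₀R : (2 : ℝ) ≤ N₀ := by exact_mod_cast hN₀2
  have hlim : Tendsto (fun N : ℕ => (∫ x in (2 : ℝ)..N₀, ψ x / Real.log x) +
      1 / 2 * (N : ℝ) ^ (1 / 4 : ℝ)) atTop atTop :=
    tendsto_atTop_add_const_left _ _ (((tendsto_rpow_atTop (by norm_num)).comp hcast).const_mul_atTop
      (by norm_num))
  refine tendsto_atTop_mono' _ ?_ hlim
  filter_upwards [eventually_ge_atTop (2 * N₀)] with N hN
  have hNR : 2 * (N₀ : ℝ) ≤ N := by exact_mod_cast hN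
  have hN0 : (0 : ℝ) < N := by linarith
  have hNN₀ : (N₀ : ℝ) ≤ N := by linarith
  rw [← intervalIntegral.integral_add_adjacent_intervals
    (hψ.intervalIntegrable le_rfl hN₀R) (hψ.intervalIntegrable hN₀R hNN₀)]
  refine add_le_add le_rfl ?_
  have h1 := intervalIntegral.integral_mono_on hNN₀
    (intervalIntegrable_const (c := (N : ℝ) ^ (-(3 / 4) : ℝ)))
    (hψ.intervalIntegrable hN₀R hNN₀) fun y hy =>
      (Real.rpow_le_rpow_of_nonpos (by linarith [hy.1]) hy.2 (by norm_num)).trans (hN₀ y hy.1)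
  rw [intervalIntegral.integral_const, smul_eq_mul] at h1
  refine le_trans ?_ h1
  have e : (N : ℝ) ^ (1 / 4 : ℝ) = N * (N : ℝ) ^ (-(3 / 4) : ℝ) := by
    rw [← Real.rpow_one_add' hN0.le (by norm_num)]
    norm_num
  rw [e, ← mul_assoc]
  gcongr
  linarith

lemma ncard_inter_Icc_eq_countIoc {f ψ : ℝ → ℝ} (N : ℕ) :
    (({p : ℕ | p.Prime ∧ f p < ψ p} ∩ Set.Icc 1 N).ncard : ℝ) = countIoc f ψ 0 N := by
  classical
  have : {p : ℕ | p.Prime ∧ f p < ψ p} ∩ Set.Icc 1 N =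
      ((Finset.Ioc 0 N).filter fun n : ℕ => n.Prime ∧ f n < ψ n : Finset ℕ) := by
    ext n
    simp only [Set.mem_inter_iff, Set.mem_ofPred_eq, Set.mem_Icc, Finset.coe_filter, Finset.mem_Ioc]
    exact and_comm
  rw [this, Set.ncard_coe_finset, countIoc, Finset.sum_boole]

/-! ### Conclusion. -/

open Filter in
/-- The count of primes with `{σ φ₁ p} < ψ p` is asymptotic to the integral, for `σ = ±1`. -/
lemma AdmissibleWeight.isEquivalent_countIoc {d : ℕ} (hd : 1 ≤ d) {c₁ c₂ : ℝ}
    (hc₁ : c₁ ∈ Set.Ico (1 : ℝ) 2) (hc₂ : c₂ ∈ Set.Ico (1 : ℝ) 2)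
    (hexp : AdmissibleExponents d (1 / c₁) (1 / c₂)) {h₁ h₂ : ℝ → ℝ} (hh₁ : InClassR c₁ h₁)
    (hh₂ : InClassR c₂ h₂) {ψ : ℝ → ℝ} (hψ : AdmissibleWeight d (inverseOnIciOne h₂) ψ) {σ : ℝ}
    (hσ : σ = 1 ∨ σ = -1) :
    Asymptotics.IsEquivalent atTop
      (fun N : ℕ => countIoc (fun x => Int.fract (σ * inverseOnIciOne h₁ x)) ψ 0 N)
      (fun N : ℕ => ∫ x in (2 : ℝ)..(N : ℝ), ψ x / Real.log x) := by
  have hg : 1 / 2 < 1 / c₁ := one_div_lt_one_div_of_lt (by linarith [hc₁.1]) hc₁.2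
  have hg1 : 1 / c₁ ≤ 1 := (div_le_one (by linarith [hc₁.1])).mpr hc₁.1
  have hg2 : 1 / c₂ ≤ 1 := (div_le_one (by linarith [hc₂.1])).mpr hc₂.1
  have hlt := hexp.one_sub_lt hd hg hg2
  -- `t'` is the exponent of the finest scale reached by `ψ`, `t` that of the exponential sum bound;
  -- equidistribution needs the strict gap `t' < t`.
  obtain ⟨t', h1t', ht'2⟩ := exists_between hlt
  obtain ⟨t, ht't, ht⟩ := exists_between ht'2
  obtain ⟨f₁, f₂, g₁, hreg⟩ := hh₁.exists_regularPhase hc₁.1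
  have hsum := hreg.eventually_norm_sum_vonMangoldt_le hg hg1 (show 0 < t by linarith) ht
  have hE : ∀ δ : ℝ, 0 < δ → ∀ᶠ N : ℕ in atTop, ∀ N' : ℕ, N ≤ N' → N' ≤ 2 * N → ∀ ρ : ℝ,
      (N : ℝ) ^ (-t') ≤ ρ → ρ ≤ 1 →
      |∑ n ∈ Finset.Ioc N N', ArithmeticFunction.vonMangoldt n *
        (if Int.fract (σ * inverseOnIciOne h₁ n) < ρ then 1 else 0) -
        ρ * ∑ n ∈ Finset.Ioc N N', ArithmeticFunction.vonMangoldt n| ≤ δ * ρ * N := by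
    intro δ hδ
    filter_upwards [eventually_abs_sum_vonMangoldt_fract_sub_le (show 0 < t' by linarith) ht't
      (by linarith) hsum hδ] with N h N' hN hN' ρ hρ hρ1
    exact h N' hN hN' ρ hρ hρ1 σ hσ
  set f : ℝ → ℝ := fun x => Int.fract (σ * inverseOnIciOne h₁ x) with hf
  set T : ℕ → ℝ := fun N => ∫ x in (2 : ℝ)..(N : ℝ), ψ x / Real.log x with hT
  have hTtop : Tendsto T atTop atTop := hψ.tendsto_integral hc₂.1 hh₂ (by linarith)
  rw [Asymptotics.IsEquivalent, Asymptotics.isLittleO_iff]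
  intro ε hε
  obtain ⟨s, hs, hs1, hsε⟩ : ∃ s : ℝ, 0 < s ∧ s ≤ 1 / 10 ∧ s ≤ ε / 20 :=
    ⟨min (1 / 10) (ε / 20), lt_min (by norm_num) (by positivity), min_le_left _ _,
      min_le_right _ _⟩
  obtain ⟨l, hl, hblock⟩ := hψ.exists_block (f := f) hc₂.1 hh₂ h1t' (by linarith) hE hs hs1
  obtain ⟨C, hC⟩ := exists_abs_sub_le_of_blocks (A := fun N => countIoc f ψ 0 N) (T := T)
    (ε := 10 * s) hl (by
      filter_upwards [hblock, eventually_ge_atTop 2] with N h hN N' hN1 hN2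
      have hpos : 0 < (l - 1) / (2 * l) := div_pos (by linarith) (by linarith)
      have hNR : (2 : ℝ) ≤ N := by exact_mod_cast hN
      have hNN'R : (N : ℝ) ≤ N' := by
        refine le_trans ?_ hN1
        exact le_mul_of_one_le_left (by linarith) (by linarith)
      have hNN' : N ≤ N' := by exact_mod_cast hNN'R
      have e1 : countIoc f ψ 0 N' - countIoc f ψ 0 N = countIoc f ψ N N' := by
        rw [← countIoc_add (Nat.zero_le N) hNN', add_sub_cancel_left]
      have e2 : T N' - T N = ∫ x in (N : ℝ)..N', ψ x / Real.log x := by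
        rw [hT]
        exact intervalIntegral.integral_interval_sub_left
          (hψ.intervalIntegrable le_rfl (hNR.trans hNN'R)) (hψ.intervalIntegrable le_rfl hNR)
      rw [e1, e2]
      exact h N' hN1 hN2)
  -- Half of `ε` covers the relative error `10 s`, the other half the constant `C`.
  filter_upwards [hTtop.eventually_ge_atTop (2 * C / ε), hTtop.eventually_ge_atTop 0] with N h1 h0
  rw [Real.norm_of_nonneg h0, Real.norm_eq_abs]
  rw [div_le_iff₀ hε] at h1
  have h2 : 10 * s * T N ≤ 10 * (ε / 20) * T N := by gcongr
  have h3 := hC N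
  simp only [Pi.sub_apply]
  linarith

theorem mainTheorem7
    (d : ℕ) (hd : 1 ≤ d)
    (c₁ c₂ : ℝ) (hc₁ : c₁ ∈ Set.Ico (1 : ℝ) 2) (hc₂ : c₂ ∈ Set.Ico (1 : ℝ) 2)
    (hexp : AdmissibleExponents d (1 / c₁) (1 / c₂))
    (h₁ h₂ : ℝ → ℝ) (hh₁ : InClassR c₁ h₁) (hh₂ : InClassR c₂ h₂)
    (ψ : ℝ → ℝ) (hψ : AdmissibleWeight d (inverseOnIciOne h₂) ψ)
    (P : Set ℕ)
    (hP : P = thinPrimesMinus (inverseOnIciOne h₁) ψ ∨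
      P = thinPrimesPlus (inverseOnIciOne h₁) ψ) :
    Asymptotics.IsEquivalent Filter.atTop
      (fun N : ℕ => ((P ∩ Set.Icc 1 N).ncard : ℝ))
      (fun N : ℕ => ∫ x in (2 : ℝ)..(N : ℝ), ψ x / Real.log x) := by
  rcases hP with rfl | rfl
  · refine (hψ.isEquivalent_countIoc hd hc₁ hc₂ hexp hh₁ hh₂ (σ := -1) (Or.inr rfl)).congr_left
      (Filter.Eventually.of_forall fun N => ?_)
    beta_reduce
    rw [← ncard_inter_Icc_eq_countIoc]
    simp only [neg_one_mul]
    rfl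
  · refine (hψ.isEquivalent_countIoc hd hc₁ hc₂ hexp hh₁ hh₂ (σ := 1) (Or.inl rfl)).congr_left
      (Filter.Eventually.of_forall fun N => ?_)
    beta_reduce
    rw [← ncard_inter_Icc_eq_countIoc]
    simp only [one_mul]
    rfl
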